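/- Let $N\ge 2$ and $0\le i\le N$. Let $F$ be a field with an involution ${}^*$, and let $q\in F^\times$ and $q_{ab}\in F$ ($a,b\in[N]=\{1,\dots,N\}$) satisfy $q_{aa}=1$, $q_{ab}q_{ba}=q^2$ for $a\ne b$, $q^*=q$ and $q_{ab}^*=q_{ba}$. Write $[n]=1+q^2+\dots+q^{2(n-1)}$, $[n]!=[1]\cdots[n]$ and $\binom{N}{i}_q=\frac{[N]!}{[i]!\,[N-i]!}$, and suppose $[n]\neq 0$ for $1\le n\le N$. (The main example: $q$ and the $q_{ab}$ with $a<b$ are independent indeterminates over $\mathbb C$ and $F$ is the fraction field over them; the one-parameter case is $q_{ab}=q$ for all $a\ne b$.) Let $R=\sum_{a,b}q_{ab}\,e_{aa}\otimes e_{bb}+(1-q^2)\sum_{a<b}e_{ab}\otimes e_{ba}$ and $\hat R=\Sigma R$, where $\Sigma$ is the flip. Let $\mathcal O^{\mathbb R}_{q,Q}(M_N(\mathbb C))$ be the $F$-algebra generated by the entries of $N\times N$ matrices $X$, $Y$ with relations $$R_{12}X_{01}X_{02}=X_{02}X_{01}R_{12},\qquad R_{12}Y_{02}Y_{01}=Y_{01}Y_{02}R_{12},\qquad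 X_{01}R_{12}Y_{02}=Y_{02}R_{12}X_{01},$$ where the leg $0$ is the algebra, with the conjugate-linear anti-multiplicative involution given by $X_{ab}^*=Y_{ba}$; for a matrix $M$ over the algebra let $(M^*)_{ab}=(M_{ba})^*$. For a map $s:[m]\to[N]$ put $(-q)_{s,c}=\prod_{k<l,\ s(k)>s(l)}(-q_{s(l)s(k)})$. Let $u=\sum_{s\in S_N}(-q)_{s,c}\,e_{s(1)}\otimes\dots\otimes e_{s(N)}$. The coefficients $\sigma_{q,Q}(i)$ of the quantum Cayley–Hamilton identity $\sum_{i=0}^N\sigma_{q,Q}(i)(-XY)^{N-i}=0$ are $\sigma_{q,Q}(0)=1$ and, for $i\ge1$, $$\sigma_{q,Q}(i)=q^{-i(i-1)}\,\frac{1}{u^*u}\binom{N}{i}_q\;u^*\big((XY)_{01}\hat R_{12}\hat R_{23}\cdots\hat R_{i-1,i}\big)^i u .$$ For $i$-element subsets $J=\{j_1<\dots<j_i\}$ and $K=\{k_1<\dots<k_i\}$ of $[N]$, the quantum minor of $M\in\{X,DX,XD'\}$ is $$[M]_{q,Q,J,K}=\sum_{s\in S_i}(-q)_{k_s,c}\,M_{j_1k_{s(1)}}\cdots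 M_{j_ik_{s(i)}},\qquad k_s(n)=k_{s(n)},$$ and that of $M\in\{Y,YD,D'Y\}$ is $[M]_{q,Q,J,K}=([M^*]_{q,Q,K,J})^*$, where $D=\mathrm{diag}(1,q,\dots,q^{N-1})$ and $D'=\mathrm{diag}(q^{N-1},\dots,q,1)$. Then $$\sigma_{q,Q}(i)=\sum_{J,K}[DX]_{q,Q,J,K}\,[YD]_{q,Q,K,J}=\sum_{J,K}[D'Y]_{q,Q,J,K}\,[XD']_{q,Q,K,J},$$ the sums running over all $i$-element subsets $J,K$ of $[N]$. In particular, $\sigma_{q,Q}(i)$ is a deformation, with one term for each term and without additional terms, of the commutative case: there are Laurent monomials $m_{J,K,s,t}$ and $m'_{J,K,s,t}$ in $q$ and the $q_{ab}$ (with coefficient $1$), whose exponents depend only on $N,i,J,K,s,t$ and not on $F$ or on the values of the parameters, such that $$\sigma_{q,Q}(i)=\sum_{J,K}\sum_{s,t\in S_i}\mathrm{sgn}(s)\,\mathrm{sgn}(t)\,m_{J,K,s,t}\;X_{j_1k_{s(1)}}\cdots X_{j_ik_{s(i)}}\;Y_{k_{t(i)}j_i}\cdots Y_{k_{t(1)}j_1},$$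 $$\sigma_{q,Q}(i)=\sum_{J,K}\sum_{s,t\in S_i}\mathrm{sgn}(s)\,\mathrm{sgn}(t)\,m'_{J,K,s,t}\;Y_{j_{t(i)}k_i}\cdots Y_{j_{t(1)}k_1}\;X_{k_1j_{s(1)}}\cdots X_{k_ij_{s(i)}}.$$ (So in the one-parameter case every coefficient is, up to sign, an integral power of $q$, and no term vanishes as $q\to1$.) -/

import Mathlib

open scoped Kronecker

/-- A system of multiparameters of size `N`: a field `F` with an involution `*`, elements `q ≠ 0`
and `Q a b` of `F` with `Q a a = 1`, `Q a b * Q b a = q ^ 2` for `a ≠ b`, `q* = q` and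
`(Q a b)* = Q b a`.  The case of independent indeterminates over `ℂ` is `QParam.generic` below;
the one-parameter case is `Q a b = q` for all `a ≠ b`. -/
structure QParam (N : ℕ) (F : Type*) [Field F] [StarRing F] where
  q : F
  Q : Fin N → Fin N → F
  q_ne_zero : q ≠ 0
  Q_diag : ∀ a, Q a a = 1
  Q_mul : ∀ a b, a ≠ b → Q a b * Q b a = q ^ 2
  star_q : star q = q
  star_Q : ∀ a b, star (Q a b) = Q b a

namespace QParam

/-! ### The generic parameters: the fraction field over `q` and `Q a b`, `a < b` -/

/-- Exponents of Laurent monomials in `q` and in the `Q a b` with `a < b`. -/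
abbrev GenExp (N : ℕ) : Type := ℤ × ({p : Fin N × Fin N // p.1 < p.2} → ℤ)

/-- Laurent polynomials over `ℂ` in the independent indeterminates `q` and `Q a b`, `a < b`. -/
abbrev GenRing (N : ℕ) : Type := AddMonoidAlgebra ℂ (GenExp N)

/-- The fraction field over the indeterminates. -/
def GenField (N : ℕ) : Type := FractionRing (GenRing N)

noncomputable instance (N : ℕ) : Field (GenField N) :=
  inferInstanceAs (Field (FractionRing (GenRing N)))

noncomputable instance (N : ℕ) : Algebra (GenRing N) (GenField N) :=
  inferInstanceAs (Algebra (GenRing N) (FractionRing (GenRing N)))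

instance (N : ℕ) : IsFractionRing (GenRing N) (GenField N) :=
  inferInstanceAs (IsFractionRing (GenRing N) (FractionRing (GenRing N)))

/-- On exponents: `q ↦ q` and `Q a b ↦ q ^ 2 * (Q a b)⁻¹`. -/
def genExpStar (N : ℕ) : GenExp N ≃+ GenExp N where
  toFun x := (x.1 + 2 * ∑ p, x.2 p, -x.2)
  invFun x := (x.1 + 2 * ∑ p, x.2 p, -x.2)
  left_inv x := by ext <;> simp
  right_inv x := by ext <;> simp
  map_add' x y := by
    ext
    · simp [Finset.sum_add_distrib]; ring
    · simp; ring

/-- Complex conjugation of the coefficients, together with `q ↦ q`, `Q a b ↦ Q b a`. -/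
noncomputable def genStar (N : ℕ) : GenRing N ≃+* GenRing N :=
  (AddMonoidAlgebra.mapRingEquiv (GenExp N) (starRingAut : ℂ ≃+* ℂ)).trans
    (AddMonoidAlgebra.domCongr ℂ ℂ (genExpStar N)).toRingEquiv

theorem genStar_single (N : ℕ) (e : GenExp N) (c : ℂ) :
    genStar N (AddMonoidAlgebra.single e c) =
      AddMonoidAlgebra.single (genExpStar N e) (star c) := by
  simp [genStar, AddMonoidAlgebra.domCongr_single]

theorem genStar_genStar (N : ℕ) (x : GenRing N) : genStar N (genStar N x) = x := by
  have h : ((genStar N : GenRing N →+* GenRing N).comp (genStar N : GenRing N →+* GenRing N)) =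
      RingHom.id _ := by
    refine AddMonoidAlgebra.ringHom_ext (fun r => ?_) (fun m => ?_)
    · simp [genStar_single]
    · have : genExpStar N (genExpStar N m) = m := (genExpStar N).left_inv m
      simp [genStar_single, this]
  exact congrArg (fun f : GenRing N →+* GenRing N => f x) h

noncomputable instance (N : ℕ) : StarRing (GenField N) where
  star := IsFractionRing.ringEquivOfRingEquiv (K := GenField N) (L := GenField N) (genStar N)
  star_involutive x := by
    have h : ((IsFractionRing.ringEquivOfRingEquiv (K := GenField N) (L := GenField N)
        (genStar N) : GenField N →+* GenField N).comp
        (IsFractionRing.ringEquivOfRingEquiv (K := GenField N) (L := GenField N)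
        (genStar N) : GenField N →+* GenField N)) = RingHom.id _ := by
      refine IsFractionRing.ringHom_ext (A := GenRing N) (fun a => ?_)
      simp [genStar_genStar]
    exact congrArg (fun f : GenField N →+* GenField N => f x) h
  star_mul x y := by rw [map_mul, mul_comm]
  star_add x y := map_add _ x y

/-- A Laurent monomial in the indeterminates. -/
noncomputable def genMono {N : ℕ} (e : GenExp N) : GenField N :=
  algebraMap (GenRing N) (GenField N) (AddMonoidAlgebra.single e 1)

theorem genMono_mul {N : ℕ} (e f : GenExp N) : genMono e * genMono f = genMono (e + f) := by
  rw [genMono, genMono, genMono, ← map_mul, AddMonoidAlgebra.single_mul_single, one_mul]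

theorem genMono_zero {N : ℕ} : genMono (0 : GenExp N) = 1 := by
  rw [genMono, ← AddMonoidAlgebra.one_def, map_one]

theorem star_genMono {N : ℕ} (e : GenExp N) : star (genMono e) = genMono (genExpStar N e) := by
  change IsFractionRing.ringEquivOfRingEquiv (K := GenField N) (L := GenField N) (genStar N)
    (genMono e) = _
  simp [genMono, genStar_single]

/-- The generic multiparameters: `q` and the `Q a b` with `a < b` are independent indeterminates
over `ℂ`, and `Q b a = q ^ 2 * (Q a b)⁻¹`. -/
noncomputable def generic (N : ℕ) : QParam N (GenField N) where
  q := genMono (1, 0)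
  Q a b :=
    if h : a < b then genMono (0, Pi.single ⟨(a, b), h⟩ 1)
    else if h : b < a then genMono (2, -Pi.single ⟨(b, a), h⟩ 1)
    else 1
  q_ne_zero h := by
    have := genMono_mul ((1, 0) : GenExp N) (-1, 0)
    rw [h, zero_mul] at this
    have h0 : ((1, 0) + (-1, 0) : GenExp N) = 0 := by ext <;> simp
    rw [h0, genMono_zero] at this
    exact zero_ne_one this
  Q_diag a := by simp
  Q_mul a b hab := by
    rcases lt_or_gt_of_ne hab with h | h
    · rw [dif_pos h, dif_neg h.not_gt, dif_pos h, genMono_mul, pow_two, genMono_mul]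
      congr 1
      ext <;> simp
    · rw [dif_neg h.not_gt, dif_pos h, dif_pos h, genMono_mul, pow_two, genMono_mul]
      congr 1
      ext <;> simp
  star_q := by rw [star_genMono]; congr 1; ext <;> simp [genExpStar]
  star_Q a b := by
    rcases lt_trichotomy a b with h | h | h
    · rw [dif_pos h, dif_neg h.not_gt, dif_pos h, star_genMono]
      congr 1
      ext <;> simp [genExpStar]
    · subst h; simp
    · rw [dif_neg h.not_gt, dif_pos h, dif_pos h, star_genMono]
      congr 1
      ext <;> simp [genExpStar]

/-! ### `q`-numbers, the `R`-matrix and the algebra -/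

section Scalars

variable {N : ℕ} {F : Type*} [Field F] [StarRing F] (P : QParam N F)

/-- The `q`-number `[n] = 1 + q ^ 2 + ⋯ + q ^ (2 * (n - 1))`. -/
def qNum (n : ℕ) : F := ∑ k ∈ Finset.range n, P.q ^ (2 * k)

/-- The `q`-numbers of the generic parameters do not vanish. -/
theorem generic_qNum_ne_zero (N n : ℕ) (hn : 1 ≤ n) : (generic N).qNum n ≠ 0 := by
  have h1 : ∀ k : ℕ, (generic N).q ^ k = genMono ((k : ℤ), 0) := by
    intro k
    induction k with
    | zero => rw [pow_zero, ← genMono_zero]; rfl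
    | succ k ih =>
      rw [pow_succ, ih]
      change genMono _ * genMono (1, 0) = _
      rw [genMono_mul]
      congr 1
  have h2 : (generic N).qNum n = algebraMap (GenRing N) (GenField N)
      (∑ k ∈ Finset.range n, AddMonoidAlgebra.single (((2 * k : ℕ) : ℤ), 0) 1) := by
    simp only [qNum, h1, map_sum, genMono]
  rw [h2, Ne, IsFractionRing.to_map_eq_zero_iff]
  intro h
  have h3 := congrArg (AddMonoidAlgebra.lift ℂ ℂ (GenExp N) 1) h
  simp only [map_sum, AddMonoidAlgebra.lift_single, map_zero] at h3
  simp at h3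
  omega

/-- The `q`-factorial `[n]! = [1] [2] ⋯ [n]`. -/
def qFact (n : ℕ) : F := ∏ k ∈ Finset.range n, P.qNum (k + 1)

/-- The `q`-binomial coefficient `[n]! / ([k]! [n - k]!)`, used for `k ≤ n`. -/
def qBinom (n k : ℕ) : F := P.qFact n / (P.qFact k * P.qFact (n - k))

/-- The `R`-matrix
`R = ∑ a b, Q a b • (e_aa ⊗ e_bb) + (1 - q ^ 2) • ∑ a < b, e_ab ⊗ e_ba`,
as a matrix with rows and columns indexed by pairs. -/
def R : Matrix (Fin N × Fin N) (Fin N × Fin N) F :=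
  ∑ a, ∑ b, P.Q a b • (Matrix.single a a (1 : F) ⊗ₖ Matrix.single b b (1 : F)) +
    (1 - P.q ^ 2) • ∑ a, ∑ b, if a < b then
      Matrix.single a b (1 : F) ⊗ₖ Matrix.single b a (1 : F) else 0

/-- The flip operator `∑ a b, e_ab ⊗ e_ba`. -/
def flip (N : ℕ) (F : Type*) [Field F] : Matrix (Fin N × Fin N) (Fin N × Fin N) F :=
  ∑ a, ∑ b, Matrix.single a b (1 : F) ⊗ₖ Matrix.single b a (1 : F)

/-- The braid form of the `R`-matrix: the flip composed with `R`. -/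
def Rhat : Matrix (Fin N × Fin N) (Fin N × Fin N) F := flip N F * P.R

/-- `(-q)_{s,r}`: the product of `-q_{s(i) s(j)}` over all `i < j` with `s(i) > s(j)`. -/
def negQRow {m : ℕ} (s : Fin m → Fin N) : F :=
  ∏ i, ∏ j, if i < j ∧ s j < s i then -P.Q (s i) (s j) else 1

/-- `(-q)_{s,c}`: the product of `-q_{s(j) s(i)}` over all `i < j` with `s(i) > s(j)`. -/
def negQCol {m : ℕ} (s : Fin m → Fin N) : F :=
  ∏ i, ∏ j, if i < j ∧ s j < s i then -P.Q (s j) (s i) else 1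

/-- The quantum Levi-Civita tensor `∑ s, (-q)_{s,c} e_{s(1)} ⊗ ⋯ ⊗ e_{s(N)}`, the sum running over
all permutations.  The basis of the `N`-fold tensor power of `F ^ N` is indexed by the maps
`Fin N → Fin N`. -/
def leviCivita : (Fin N → Fin N) → F :=
  ∑ s : Equiv.Perm (Fin N), Pi.single (⇑s) (P.negQCol ⇑s)

/-- The Laurent monomial with exponent `d` of `q` and exponents `e a b` of the `Q a b`. -/
def laurent (d : ℤ) (e : Fin N → Fin N → ℤ) : F := P.q ^ d * ∏ a, ∏ b, P.Q a b ^ e a b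

/-- In the one-parameter case a Laurent monomial is an integral power of `q`. -/
theorem laurent_eq_zpow (hQ : ∀ a b, a ≠ b → P.Q a b = P.q) (d : ℤ) (e : Fin N → Fin N → ℤ) :
    P.laurent d e = P.q ^ (d + ∑ a, ∑ b, if a = b then 0 else e a b) := by
  have h : ∀ a b, P.Q a b ^ e a b = P.q ^ (if a = b then 0 else e a b) := by
    intro a b
    split_ifs with hab
    · rw [hab, P.Q_diag, one_zpow, zpow_zero]
    · rw [hQ a b hab]
  have h2 : ∀ (f : Fin N → ℤ), ∏ a, P.q ^ f a = P.q ^ ∑ a, f a := by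
    intro f
    induction (Finset.univ : Finset (Fin N)) using Finset.induction_on with
    | empty => simp
    | insert x t hx ih =>
      rw [Finset.prod_insert hx, Finset.sum_insert hx, ih, zpow_add₀ P.q_ne_zero]
  simp only [laurent, h, h2, zpow_add₀ P.q_ne_zero]

theorem R_apply (a b c d : Fin N) : P.R (a, b) (c, d) =
    (if a = c ∧ b = d then P.Q a b else 0) +
      (if a = d ∧ b = c ∧ a < b then 1 - P.q ^ 2 else 0) := by
  have h1 : (∑ x, ∑ y, P.Q x y •
      (Matrix.single x x (1 : F) ⊗ₖ Matrix.single y y (1 : F))) (a, b) (c, d) =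
      if a = c ∧ b = d then P.Q a b else 0 := by
    simp only [Matrix.sum_apply, Matrix.smul_apply, Matrix.kroneckerMap_apply,
      Matrix.single_apply, smul_eq_mul]
    rw [Finset.sum_eq_single a, Finset.sum_eq_single b]
    · by_cases h : a = c <;> by_cases h' : b = d <;> simp [h, h']
    · intro y _ hy; simp [hy]
    · simp
    · intro x _ hx; simp [hx]
    · simp
  have h2 : (∑ x, ∑ y, if x < y then
      Matrix.single x y (1 : F) ⊗ₖ Matrix.single y x (1 : F) else 0) (a, b) (c, d) =
      if a = d ∧ b = c ∧ a < b then 1 else 0 := by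
    have h3 : ∀ x y : Fin N, (if x < y then
        Matrix.single x y (1 : F) ⊗ₖ Matrix.single y x (1 : F) else 0) (a, b) (c, d) =
        if x < y ∧ x = a ∧ y = c ∧ y = b ∧ x = d then 1 else 0 := by
      intro x y
      by_cases h : x < y
      · simp only [h, if_true, Matrix.kroneckerMap_apply, Matrix.single_apply, true_and]
        split_ifs <;> first | (exfalso; tauto) | simp only [mul_one, mul_zero]
      · simp [h]
    simp only [Matrix.sum_apply, h3]
    rw [Finset.sum_eq_single a, Finset.sum_eq_single b]
    · congr 1
      apply propext
      constructor
      · rintro ⟨h, -, h', -, h''⟩; exact ⟨h'', h', h⟩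
      · rintro ⟨h, h', h''⟩; exact ⟨h'', rfl, h', rfl, h⟩
    · intro y _ hy; simp [hy]
    · simp
    · intro x _ hx; simp [hx]
    · simp
  rw [R, Matrix.add_apply, Matrix.smul_apply, h1, h2]
  simp

theorem star_R (a b c d : Fin N) : star (P.R (a, b) (c, d)) = P.R (d, c) (b, a) := by
  rw [R_apply, R_apply, star_add]
  congr 1
  · by_cases h : a = c ∧ b = d
    · rw [if_pos h, if_pos ⟨h.2.symm, h.1.symm⟩, P.star_Q, h.1, h.2]
    · have h' : ¬ (d = b ∧ c = a) := fun h' => h ⟨h'.2.symm, h'.1.symm⟩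
      rw [if_neg h, if_neg h', star_zero]
  · by_cases h : a = d ∧ b = c ∧ a < b
    · rw [if_pos h, if_pos ⟨h.1.symm, h.2.1.symm, h.1 ▸ h.2.1 ▸ h.2.2⟩]
      rw [star_sub, star_pow, star_one, P.star_q]
    · have h' : ¬ (d = a ∧ c = b ∧ d < c) := by
        rintro ⟨rfl, rfl, h'⟩; exact h ⟨rfl, rfl, h'⟩
      rw [if_neg h, if_neg h', star_zero]

end Scalars

/-- The generators: `Sum.inl (i, j)` stands for `X i j` and `Sum.inr (i, j)` for `Y i j`. -/
abbrev Gen (N : ℕ) : Type := (Fin N × Fin N) ⊕ (Fin N × Fin N)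

section Legs

variable {N : ℕ} {B : Type*} [Ring B]

/-- A matrix acting in the first leg of a two-fold tensor product. -/
def leg1 (M : Matrix (Fin N) (Fin N) B) : Matrix (Fin N × Fin N) (Fin N × Fin N) B :=
  M ⊗ₖ (1 : Matrix (Fin N) (Fin N) B)

/-- A matrix acting in the second leg of a two-fold tensor product. -/
def leg2 (M : Matrix (Fin N) (Fin N) B) : Matrix (Fin N × Fin N) (Fin N × Fin N) B :=
  (1 : Matrix (Fin N) (Fin N) B) ⊗ₖ M

/-- A matrix acting in leg `k` of the `N`-fold tensor power. -/
def legAt (k : Fin N) (M : Matrix (Fin N) (Fin N) B) :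
    Matrix (Fin N → Fin N) (Fin N → Fin N) B :=
  Matrix.of fun a b => if ∀ l, l ≠ k → a l = b l then M (a k) (b k) else 0

/-- A matrix acting in the legs `k` and `l` (in this order) of the `N`-fold tensor power. -/
def legsAt (k l : Fin N) (M : Matrix (Fin N × Fin N) (Fin N × Fin N) B) :
    Matrix (Fin N → Fin N) (Fin N → Fin N) B :=
  Matrix.of fun a b =>
    if ∀ m, m ≠ k → m ≠ l → a m = b m then M (a k, a l) (b k, b l) else 0

theorem mul_leg1_apply (S : Matrix (Fin N × Fin N) (Fin N × Fin N) B)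
    (M : Matrix (Fin N) (Fin N) B) (r : Fin N × Fin N) (c d : Fin N) :
    (S * leg1 M) r (c, d) = ∑ e, S r (e, d) * M e c := by
  simp [Matrix.mul_apply, leg1, Fintype.sum_prod_type, Matrix.one_apply]

theorem mul_leg2_apply (S : Matrix (Fin N × Fin N) (Fin N × Fin N) B)
    (M : Matrix (Fin N) (Fin N) B) (r : Fin N × Fin N) (c d : Fin N) :
    (S * leg2 M) r (c, d) = ∑ f, S r (c, f) * M f d := by
  simp [Matrix.mul_apply, leg2, Fintype.sum_prod_type, Matrix.one_apply]

theorem leg1_mul_apply (S : Matrix (Fin N × Fin N) (Fin N × Fin N) B)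
    (M : Matrix (Fin N) (Fin N) B) (a b : Fin N) (r : Fin N × Fin N) :
    (leg1 M * S) (a, b) r = ∑ e, M a e * S (e, b) r := by
  simp [Matrix.mul_apply, leg1, Fintype.sum_prod_type, Matrix.one_apply]

theorem leg2_mul_apply (S : Matrix (Fin N × Fin N) (Fin N × Fin N) B)
    (M : Matrix (Fin N) (Fin N) B) (a b : Fin N) (r : Fin N × Fin N) :
    (leg2 M * S) (a, b) r = ∑ f, M b f * S (a, f) r := by
  simp [Matrix.mul_apply, leg2, Fintype.sum_prod_type, Matrix.one_apply]

end Legs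

section Algebra

variable {N : ℕ} {F : Type*} [Field F] [StarRing F] (P : QParam N F)

/-- The free algebra on the generators `X i j` and `Y i j`. -/
abbrev Free (N : ℕ) (F : Type*) [Field F] : Type _ := FreeAlgebra F (Gen N)

/-- The matrix of the free generators `X i j`. -/
def freeX (N : ℕ) (F : Type*) [Field F] : Matrix (Fin N) (Fin N) (Free N F) :=
  Matrix.of fun i j => FreeAlgebra.ι F (Sum.inl (i, j))

/-- The matrix of the free generators `Y i j`. -/
def freeY (N : ℕ) (F : Type*) [Field F] : Matrix (Fin N) (Fin N) (Free N F) :=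
  Matrix.of fun i j => FreeAlgebra.ι F (Sum.inr (i, j))

/-- The defining relations, entry by entry: `R X₁ X₂ = X₂ X₁ R`, `R Y₂ Y₁ = Y₁ Y₂ R` and
`X₁ R Y₂ = Y₂ R X₁`. -/
inductive Rel : Free N F → Free N F → Prop
  | XX (r s : Fin N × Fin N) : Rel
      ((P.R.map (algebraMap F (Free N F)) * leg1 (freeX N F) * leg2 (freeX N F)) r s)
      ((leg2 (freeX N F) * leg1 (freeX N F) * P.R.map (algebraMap F (Free N F))) r s)
  | YY (r s : Fin N × Fin N) : Rel
      ((P.R.map (algebraMap F (Free N F)) * leg2 (freeY N F) * leg1 (freeY N F)) r s)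
      ((leg1 (freeY N F) * leg2 (freeY N F) * P.R.map (algebraMap F (Free N F))) r s)
  | XY (r s : Fin N × Fin N) : Rel
      ((leg1 (freeX N F) * P.R.map (algebraMap F (Free N F)) * leg2 (freeY N F)) r s)
      ((leg2 (freeY N F) * P.R.map (algebraMap F (Free N F)) * leg1 (freeX N F)) r s)

/-- The multiparameter quantized algebra of functions on the `N × N`-matrices as a real variety:
the `F`-algebra generated by the `X i j` and `Y i j` subject to the above relations. -/
def OqR : Type _ := RingQuot P.Rel

noncomputable instance : Ring P.OqR := inferInstanceAs (Ring (RingQuot P.Rel))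

noncomputable instance : Algebra F P.OqR := inferInstanceAs (Algebra F (RingQuot P.Rel))

/-- The quotient map from the free algebra. -/
noncomputable def toOqR : Free N F →ₐ[F] P.OqR := RingQuot.mkAlgHom F P.Rel

/-- The generating matrix `X`. -/
noncomputable def X : Matrix (Fin N) (Fin N) P.OqR := (freeX N F).map P.toOqR

/-- The generating matrix `Y`. -/
noncomputable def Y : Matrix (Fin N) (Fin N) P.OqR := (freeY N F).map P.toOqR

/-! ### The `*`-structure -/

theorem rel_XX (a b c d : Fin N) :
    ∑ f, ∑ e, algebraMap F P.OqR (P.R (a, b) (e, f)) * P.X e c * P.X f d =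
      ∑ f, ∑ e, P.X b f * (P.X a e * algebraMap F P.OqR (P.R (e, f) (c, d))) := by
  have h := RingQuot.mkAlgHom_rel F (Rel.XX (P := P) (a, b) (c, d))
  change P.toOqR _ = P.toOqR _ at h
  rw [Matrix.mul_assoc (leg2 (freeX N F))] at h
  simp only [mul_leg1_apply, mul_leg2_apply, leg1_mul_apply, leg2_mul_apply, map_sum, map_mul,
    Matrix.map_apply, AlgHom.commutes, Finset.mul_sum, Finset.sum_mul] at h
  exact h

theorem rel_YY (a b c d : Fin N) :
    ∑ e, ∑ f, algebraMap F P.OqR (P.R (a, b) (e, f)) * P.Y f d * P.Y e c =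
      ∑ e, ∑ f, P.Y a e * (P.Y b f * algebraMap F P.OqR (P.R (e, f) (c, d))) := by
  have h := RingQuot.mkAlgHom_rel F (Rel.YY (P := P) (a, b) (c, d))
  change P.toOqR _ = P.toOqR _ at h
  rw [Matrix.mul_assoc (leg1 (freeY N F))] at h
  simp only [mul_leg1_apply, mul_leg2_apply, leg1_mul_apply, leg2_mul_apply, map_sum, map_mul,
    Matrix.map_apply, AlgHom.commutes, Finset.mul_sum, Finset.sum_mul] at h
  exact h

theorem rel_XY (a b c d : Fin N) :
    ∑ f, ∑ e, P.X a e * algebraMap F P.OqR (P.R (e, b) (c, f)) * P.Y f d =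
      ∑ e, ∑ f, P.Y b f * algebraMap F P.OqR (P.R (a, f) (e, d)) * P.X e c := by
  have h := RingQuot.mkAlgHom_rel F (Rel.XY (P := P) (a, b) (c, d))
  change P.toOqR _ = P.toOqR _ at h
  simp only [mul_leg1_apply, mul_leg2_apply, leg1_mul_apply, leg2_mul_apply, map_sum, map_mul,
    Matrix.map_apply, AlgHom.commutes, Finset.sum_mul] at h
  exact h

/-- Scalars act on the opposite algebra through the involution of `F`. -/
noncomputable def starScalar : F →+* (P.OqR)ᵐᵒᵖ :=
  (algebraMap F (P.OqR)ᵐᵒᵖ).comp (starRingEnd F)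

/-- The conjugate-linear anti-homomorphism on the free algebra that sends `X i j` to `Y j i` and
`Y i j` to `X j i`. -/
noncomputable def freeStar : Free N F →+* (P.OqR)ᵐᵒᵖ :=
  letI : Algebra F (P.OqR)ᵐᵒᵖ := P.starScalar.toAlgebra' fun c x =>
    Algebra.commutes (starRingEnd F c) x
  (FreeAlgebra.lift F (Sum.elim (fun p : Fin N × Fin N => MulOpposite.op (P.Y p.2 p.1))
    (fun p : Fin N × Fin N => MulOpposite.op (P.X p.2 p.1)))).toRingHom

theorem freeStar_algebraMap (r : F) : P.freeStar (algebraMap F (Free N F) r) =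
    MulOpposite.op (algebraMap F P.OqR (star r)) := by
  let _ : Algebra F (P.OqR)ᵐᵒᵖ := P.starScalar.toAlgebra' fun c x =>
    Algebra.commutes (starRingEnd F c) x
  exact AlgHom.commutes (FreeAlgebra.lift F (Sum.elim (fun p : Fin N × Fin N => MulOpposite.op (P.Y p.2 p.1))
    (fun p : Fin N × Fin N => MulOpposite.op (P.X p.2 p.1)))) r

theorem freeStar_X (i j : Fin N) :
    P.freeStar (freeX N F i j) = MulOpposite.op (P.Y j i) := by
  let _ : Algebra F (P.OqR)ᵐᵒᵖ := P.starScalar.toAlgebra' fun c x =>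
    Algebra.commutes (starRingEnd F c) x
  exact FreeAlgebra.lift_ι_apply (R := F) (A := (P.OqR)ᵐᵒᵖ) _ (Sum.inl (i, j))

theorem freeStar_Y (i j : Fin N) :
    P.freeStar (freeY N F i j) = MulOpposite.op (P.X j i) := by
  let _ : Algebra F (P.OqR)ᵐᵒᵖ := P.starScalar.toAlgebra' fun c x =>
    Algebra.commutes (starRingEnd F c) x
  exact FreeAlgebra.lift_ι_apply (R := F) (A := (P.OqR)ᵐᵒᵖ) _ (Sum.inr (i, j))

theorem freeStar_rel ⦃x y : Free N F⦄ (h : P.Rel x y) : P.freeStar x = P.freeStar y := by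
  apply MulOpposite.unop_injective
  cases h with
  | XX r s =>
    obtain ⟨a, b⟩ := r
    obtain ⟨c, d⟩ := s
    rw [Matrix.mul_assoc (leg2 (freeX N F))]
    simp only [mul_leg1_apply, mul_leg2_apply, leg1_mul_apply, leg2_mul_apply, map_sum, map_mul,
      Matrix.map_apply, freeStar_algebraMap, freeStar_X, star_R, Finset.mul_sum, Finset.sum_mul,
      MulOpposite.unop_mul, MulOpposite.unop_op, Finset.unop_sum]
    exact (P.rel_YY d c b a).symm
  | YY r s =>
    obtain ⟨a, b⟩ := r
    obtain ⟨c, d⟩ := s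
    rw [Matrix.mul_assoc (leg1 (freeY N F))]
    simp only [mul_leg1_apply, mul_leg2_apply, leg1_mul_apply, leg2_mul_apply, map_sum, map_mul,
      Matrix.map_apply, freeStar_algebraMap, freeStar_Y, star_R, Finset.mul_sum, Finset.sum_mul,
      MulOpposite.unop_mul, MulOpposite.unop_op, Finset.unop_sum]
    exact (P.rel_XX d c b a).symm
  | XY r s =>
    obtain ⟨a, b⟩ := r
    obtain ⟨c, d⟩ := s
    simp only [mul_leg1_apply, mul_leg2_apply, leg1_mul_apply, leg2_mul_apply, map_sum, map_mul,
      Matrix.map_apply, freeStar_algebraMap, freeStar_X, freeStar_Y, star_R,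
      Finset.sum_mul, MulOpposite.unop_mul, MulOpposite.unop_op, Finset.unop_sum, ← mul_assoc]
    rw [Finset.sum_comm, P.rel_XY d c b a, Finset.sum_comm]

/-- The conjugate-linear anti-endomorphism underlying the `*`-structure. -/
noncomputable def starHom : P.OqR →+* (P.OqR)ᵐᵒᵖ :=
  RingQuot.lift ⟨P.freeStar, P.freeStar_rel⟩

theorem starHom_toOqR (x : Free N F) : P.starHom (P.toOqR x) = P.freeStar x := by
  have h : P.toOqR x = RingQuot.mkRingHom P.Rel x := by
    rw [← RingQuot.mkAlgHom_coe F P.Rel]; rfl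
  rw [h]
  exact RingQuot.lift_mkRingHom_apply P.freeStar P.freeStar_rel x

theorem starHom_algebraMap (r : F) : P.starHom (algebraMap F P.OqR r) =
    MulOpposite.op (algebraMap F P.OqR (star r)) := by
  rw [← AlgHom.commutes P.toOqR r, starHom_toOqR, freeStar_algebraMap]

theorem starHom_X (i j : Fin N) : P.starHom (P.X i j) = MulOpposite.op (P.Y j i) :=
  (P.starHom_toOqR _).trans (P.freeStar_X i j)

theorem starHom_Y (i j : Fin N) : P.starHom (P.Y i j) = MulOpposite.op (P.X j i) :=
  (P.starHom_toOqR _).trans (P.freeStar_Y i j)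

theorem starHom_starHom (x : P.OqR) :
    (P.starHom (P.starHom x).unop).unop = x := by
  obtain ⟨y, rfl⟩ : ∃ y, P.toOqR y = x := RingQuot.mkAlgHom_surjective F P.Rel x
  induction y using FreeAlgebra.induction with
  | grade0 r => simp [AlgHom.commutes, starHom_algebraMap]
  | grade1 g =>
    rcases g with ⟨i, j⟩ | ⟨i, j⟩
    · change (P.starHom (P.starHom (P.X i j)).unop).unop = P.X i j
      simp [starHom_X, starHom_Y]
    · change (P.starHom (P.starHom (P.Y i j)).unop).unop = P.Y i j
      simp [starHom_X, starHom_Y]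
  | mul x y hx hy => simp [map_mul, hx, hy]
  | add x y hx hy => simp [map_add, hx, hy]

/-- The `*`-structure: conjugate-linear, reversing products, with `(X i j)* = Y j i`. -/
noncomputable instance : StarRing P.OqR where
  star x := (P.starHom x).unop
  star_involutive := P.starHom_starHom
  star_mul x y := by rw [map_mul, MulOpposite.unop_mul]
  star_add x y := by rw [map_add, MulOpposite.unop_add]

theorem star_algebraMap (r : F) :
    star (algebraMap F P.OqR r) = algebraMap F P.OqR (star r) :=
  congrArg MulOpposite.unop (P.starHom_algebraMap r)

theorem star_X (i j : Fin N) : star (P.X i j) = P.Y j i :=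
  congrArg MulOpposite.unop (P.starHom_X i j)

theorem star_Y (i j : Fin N) : star (P.Y i j) = P.X j i :=
  congrArg MulOpposite.unop (P.starHom_Y i j)

/-! ### The coefficients of the quantum Cayley-Hamilton identity -/

/-- The diagonal matrix `D = diag (1, q, …, q ^ (N - 1))`. -/
noncomputable def D : Matrix (Fin N) (Fin N) P.OqR :=
  Matrix.diagonal fun k => algebraMap F P.OqR (P.q ^ (k : ℕ))

/-- The diagonal matrix `D' = diag (q ^ (N - 1), …, q, 1)`. -/
noncomputable def D' : Matrix (Fin N) (Fin N) P.OqR :=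
  Matrix.diagonal fun k => algebraMap F P.OqR (P.q ^ (N - 1 - (k : ℕ)))

/-- The operator `Rhat` in the legs `k`, `l` of the `N`-fold tensor power, with entries in the
algebra. -/
noncomputable def RhatAt (k l : Fin N) : Matrix (Fin N → Fin N) (Fin N → Fin N) P.OqR :=
  legsAt k l (P.Rhat.map (algebraMap F P.OqR))

/-- `(X Y)₁ Rhat₁₂ ⋯ Rhat_{i, i + 1}` for `i < N` (with legs numbered from `1`). -/
noncomputable def sigmaMat (i : ℕ) (hi : i < N) :
    Matrix (Fin N → Fin N) (Fin N → Fin N) P.OqR :=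
  legAt ⟨0, Nat.zero_lt_of_lt hi⟩ (P.X * P.Y) *
    (List.ofFn fun k : Fin i =>
      P.RhatAt ⟨(k : ℕ), k.2.trans hi⟩ ⟨(k : ℕ) + 1, (Nat.succ_le_of_lt k.2).trans_lt hi⟩).prod

/-- The scalar `α_i = ‖u‖⁻² [N choose i]`, where `u` is the Levi-Civita tensor. -/
def alpha (i : ℕ) : F := (star P.leviCivita ⬝ᵥ P.leviCivita)⁻¹ * P.qBinom N i

/-- The coefficient `σ(i)`, `0 ≤ i ≤ N`, of the quantum Cayley-Hamilton identity for `X Y`: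
`σ(0) = 1` and `σ(i) = q ^ (-(i - 1) i) α_i u* ((X Y)₁ Rhat₁₂ ⋯ Rhat_{i - 1, i}) ^ i u`. -/
noncomputable def sigma : (i : ℕ) → i ≤ N → P.OqR
  | 0, _ => 1
  | i + 1, hi =>
    algebraMap F P.OqR ((P.q ^ (i * (i + 1)))⁻¹ * P.alpha (i + 1)) *
      ((fun a => algebraMap F P.OqR (star P.leviCivita a)) ⬝ᵥ
        (P.sigmaMat i hi ^ (i + 1)).mulVec (fun a => algebraMap F P.OqR (P.leviCivita a)))

/-! ### Multiparameter quantum minors -/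

/-- The `i`-element subsets of the index set. -/
abbrev Sub (N i : ℕ) : Type := {J : Finset (Fin N) // J.card = i}

/-- The increasing enumeration `j_1 < ⋯ < j_i` of an `i`-element subset. -/
def Sub.enum {N i : ℕ} (J : Sub N i) : Fin i → Fin N := J.1.orderEmbOfFin J.2

/-- The multiparameter quantum minor
`∑ s, (-q)_{s,c} M_{j_1 k_{s(1)}} ⋯ M_{j_i k_{s(i)}}` of a matrix `M` that satisfies the relations
of `X`. -/
noncomputable def minorX (M : Matrix (Fin N) (Fin N) P.OqR) {i : ℕ} (J K : Sub N i) : P.OqR :=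
  ∑ s : Equiv.Perm (Fin i), algebraMap F P.OqR (P.negQCol fun n => K.enum (s n)) *
    (List.ofFn fun n => M (J.enum n) (K.enum (s n))).prod

/-- The multiparameter quantum minor of a matrix `M` that satisfies the relations of `Y`: the `*` of
the minor of `M*` with the index sets interchanged. -/
noncomputable def minorY (M : Matrix (Fin N) (Fin N) P.OqR) {i : ℕ} (J K : Sub N i) : P.OqR :=
  star (P.minorX M.conjTranspose K J)

/-- The monomial `X_{j_1 k_{s(1)}} ⋯ X_{j_i k_{s(i)}}`. -/
noncomputable def monX {i : ℕ} (J K : Sub N i) (s : Equiv.Perm (Fin i)) : P.OqR :=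
  (List.ofFn fun n => P.X (J.enum n) (K.enum (s n))).prod

/-- The monomial `Y_{j_{s(i)} k_i} ⋯ Y_{j_{s(1)} k_1}`. -/
noncomputable def monY {i : ℕ} (J K : Sub N i) (s : Equiv.Perm (Fin i)) : P.OqR :=
  (List.ofFn fun n => P.Y (J.enum (s n.rev)) (K.enum n.rev)).prod

end Algebra

end QParam

/-!
# The coefficients of the quantum Cayley-Hamilton identity as sums of products of minors

Tensors are functions of words, and `Rhat` in the legs `k`, `k + 1` becomes the operator `braid k`.
A tensor is antisymmetric (`IsAlt`) if every `braid k` acts on it by `-q ^ 2`.  If `1 + q ^ 2 ≠ 0`,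
the antisymmetric tensors of degree `m` have the basis `altTensor m J`, where `J` runs over the
`m`-element sets (`IsAlt.eq_sum`); it is orthogonal, and each element has the norm `[m]!`.  The
Levi-Civita tensor is the one with `m = N`.

*Reduction to degree `i`.*  The relations between `X`, `Y` and `Rhat` allow reordering the power
`((X Y)₁ Rhat₁₂ ⋯ Rhat_{i-1,i}) ^ i` into `X₁ ⋯ X_i Y_i ⋯ Y₁ (Rhat₁₂ ⋯ Rhat_{i-1,i}) ^ i`
(`pow_eq_prodUp_mul_prodDown`), and the last factor acts on the Levi-Civita tensor by a scalar.  The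
remaining operator only involves `i` letters.  Contracting the other letters one at a time
(`altTrace_snocOp`) expresses `σ(i)` as a weighted trace `altTrace` of `X₁ ⋯ X_i Y_i ⋯ Y₁` over
the antisymmetric tensors of degree `i` (`qFact_smul_sigma`).

*First formula.*  The operators `prodX` and `prodY` commute with the braid generators, so they
preserve antisymmetric tensors.  Their matrix coefficients are the minors of `X`
(`altPair_prodX`) and, after applying the involution, the starred minors (`prodY_altTensor`).  This
turns the trace into the sum of the products of minors; the weights of the trace are the powers of
`q` that come from `D`.

*Second formula.*  The relation `X₁ R₁₂ Y₂ = Y₂ R₁₂ X₁` moves a letter of `X` across all of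
`Y_m ⋯ Y₁` at the cost of crossings of strands (`prodY_mul_crossing_mul_leg_X`).  The twisted
partial traces of `Rhat` over either leg are the identity (`sum_smul_braid_consTensor` and
`sum_smul_braid_snocTensor`), the weights being powers of `q ^ 2` that increase for one leg and
decrease for the other.  Contracting with the decreasing weights removes the crossings on one side
of the relation; the weights of the trace, which increase, remove them on the other side
(`sum_wordEntry_altTensor`).  Both contractions produce the same scalar, because a crossing acts on
antisymmetric tensors by a power of `-q ^ 2`.  This yields the trace with `X` and `Y`
interchanged and with reversed weights (`altTrace_prodX_mul_prodY`).

*Laurent monomials.*  The coefficient `(-q)_{s,c}` is the sign of `s` times the product of the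
`q_{s(l) s(k)}` over the inversions (`negQCol_enum`), and the involution exchanges `q_{ab}` and
`q_{ba}`.
-/

namespace QParam

/-! ### Operators on tensors, written as functions of words -/


/-- Words of length `m` in the letters `Fin N`; they index the basis of the `m`-fold tensor power
of `F ^ N`, so that a tensor with coefficients in `M` is a function `Word N m → M`. -/
abbrev Word (N m : ℕ) : Type := Fin m → Fin N

/-- Functions of words of positive length agree if they agree on all `Fin.cons a w`. -/
theorem word_ext_cons {N m : ℕ} {X : Type*} {f g : Word N (m + 1) → X}
    (h : ∀ a (w : Word N m), f (Fin.cons a w) = g (Fin.cons a w)) : f = g := by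
  ext w
  rw [← Fin.cons_self_tail w]
  exact h _ _

theorem word_ext_snoc {N m : ℕ} {X : Type*} {f g : Word N (m + 1) → X}
    (h : ∀ (w : Word N m) a, f (Fin.snoc w a) = g (Fin.snoc w a)) : f = g := by
  ext w
  rw [← Fin.snoc_init_self w]
  exact h _ _

theorem cons_comp_swap_succ {m : ℕ} {X : Type*} (a : X) (w : Fin m → X) (i j : Fin m) :
    (Fin.cons a w : Fin (m + 1) → X) ∘ Equiv.swap i.succ j.succ =
      Fin.cons a (w ∘ Equiv.swap i j) := by
  ext x
  refine Fin.cases ?_ (fun x => ?_) x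
  · simp [Equiv.swap_apply_of_ne_of_ne (Fin.succ_ne_zero i).symm (Fin.succ_ne_zero j).symm]
  · simp only [Function.comp_apply, Fin.cons_succ]
    rw [(Fin.succ_injective m).swap_apply, Fin.cons_succ]

theorem snoc_comp_swap_castSucc {m : ℕ} {X : Type*} (a : X) (w : Fin m → X) (i j : Fin m) :
    (Fin.snoc w a : Fin (m + 1) → X) ∘ Equiv.swap i.castSucc j.castSucc =
      Fin.snoc (w ∘ Equiv.swap i j) a := by
  ext x
  refine Fin.lastCases ?_ (fun x => ?_) x
  · simp [Equiv.swap_apply_of_ne_of_ne (Fin.castSucc_ne_last i).symm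
      (Fin.castSucc_ne_last j).symm]
  · simp only [Function.comp_apply, Fin.snoc_castSucc]
    rw [(Fin.castSucc_injective m).swap_apply, Fin.snoc_castSucc]

section Operators

variable {N : ℕ} {F : Type*} [Field F] {m : ℕ} {M : Type*} [AddCommGroup M] [Module F M]

/-- The operator that acts by `A` on all letters but the first, that is, `1 ⊗ A`. -/
def consOp (A : Module.End F (Word N m → M)) : Module.End F (Word N (m + 1) → M) where
  toFun f w := A (fun d => f (Fin.cons (w 0) d)) (Fin.tail w)
  map_add' f g := by
    ext w
    exact congrFun (map_add A (fun d => f (Fin.cons (w 0) d)) fun d => g (Fin.cons (w 0) d)) _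
  map_smul' r f := by
    ext w
    exact congrFun (map_smul A r fun d => f (Fin.cons (w 0) d)) _

/-- The operator that acts by `A` on all letters but the last, that is, `A ⊗ 1`. -/
def snocOp (A : Module.End F (Word N m → M)) : Module.End F (Word N (m + 1) → M) where
  toFun f w := A (fun d => f (Fin.snoc d (w (Fin.last m)))) (Fin.init w)
  map_add' f g := by
    ext w
    exact congrFun (map_add A (fun d => f (Fin.snoc d (w (Fin.last m))))
      fun d => g (Fin.snoc d (w (Fin.last m)))) _
  map_smul' r f := by
    ext w
    exact congrFun (map_smul A r fun d => f (Fin.snoc d (w (Fin.last m)))) _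

theorem consOp_apply_cons (A : Module.End F (Word N m → M)) (f : Word N (m + 1) → M) (a : Fin N)
    (w : Word N m) : consOp A f (Fin.cons a w) = A (fun d => f (Fin.cons a d)) w := by
  simp [consOp]

theorem snocOp_apply_snoc (A : Module.End F (Word N m → M)) (f : Word N (m + 1) → M) (a : Fin N)
    (w : Word N m) : snocOp A f (Fin.snoc w a) = A (fun d => f (Fin.snoc d a)) w := by
  simp [snocOp]

theorem end_ext_cons {A B : Module.End F (Word N (m + 1) → M)}
    (h : ∀ f a (w : Word N m), A f (Fin.cons a w) = B f (Fin.cons a w)) : A = B :=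
  LinearMap.ext fun f => word_ext_cons (h f)

theorem end_ext_snoc {A B : Module.End F (Word N (m + 1) → M)}
    (h : ∀ f (w : Word N m) a, A f (Fin.snoc w a) = B f (Fin.snoc w a)) : A = B :=
  LinearMap.ext fun f => word_ext_snoc (h f)

@[simp] theorem consOp_one : consOp (1 : Module.End F (Word N m → M)) = 1 :=
  end_ext_cons fun f a w => by simp [consOp_apply_cons]

@[simp] theorem snocOp_one : snocOp (1 : Module.End F (Word N m → M)) = 1 :=
  end_ext_snoc fun f w a => by simp [snocOp_apply_snoc]

theorem consOp_mul (A B : Module.End F (Word N m → M)) :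
    consOp (A * B) = consOp A * consOp B :=
  end_ext_cons fun f a w => by simp [consOp_apply_cons]

theorem snocOp_mul (A B : Module.End F (Word N m → M)) :
    snocOp (A * B) = snocOp A * snocOp B :=
  end_ext_snoc fun f w a => by simp [snocOp_apply_snoc]

theorem consOp_snocOp (A : Module.End F (Word N m → M)) :
    consOp (snocOp A) = snocOp (consOp A) := by
  refine end_ext_cons fun f a w => ?_
  rw [← Fin.snoc_init_self w, consOp_apply_cons, snocOp_apply_snoc, Fin.cons_snoc_eq_snoc_cons,
    snocOp_apply_snoc, consOp_apply_cons]
  simp only [Fin.cons_snoc_eq_snoc_cons]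

variable {B : Type*} [Ring B] [Algebra F B]

/-- A matrix acting on letter `k`. -/
def leg (M : Matrix (Fin N) (Fin N) B) (k : Fin m) : Module.End F (Word N m → B) where
  toFun f w := ∑ e, M (w k) e * f (Function.update w k e)
  map_add' f g := by ext w; simp [mul_add, Finset.sum_add_distrib]
  map_smul' r f := by ext w; simp [Finset.smul_sum]

theorem leg_apply (M : Matrix (Fin N) (Fin N) B) (k : Fin m) (f : Word N m → B) (w : Word N m) :
    leg (F := F) M k f w = ∑ e, M (w k) e * f (Function.update w k e) := rfl

theorem consOp_leg (M : Matrix (Fin N) (Fin N) B) (k : Fin m) :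
    consOp (leg (F := F) M k) = leg M k.succ := by
  refine end_ext_cons fun f a w => ?_
  rw [consOp_apply_cons, leg_apply, leg_apply]
  simp [Fin.cons_update]

theorem snocOp_leg (M : Matrix (Fin N) (Fin N) B) (k : Fin m) :
    snocOp (leg (F := F) M k) = leg M k.castSucc := by
  refine end_ext_snoc fun f w a => ?_
  rw [snocOp_apply_snoc, leg_apply, leg_apply]
  simp [Fin.snoc_update]

theorem leg_zero_apply (M : Matrix (Fin N) (Fin N) B) (f : Word N (m + 1) → B) (a : Fin N)
    (w : Word N m) :
    leg (F := F) M 0 f (Fin.cons a w) = ∑ e, M a e * f (Fin.cons e w) := by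
  rw [leg_apply]
  simp [Fin.update_cons_zero]

theorem leg_last_apply (M : Matrix (Fin N) (Fin N) B) (f : Word N (m + 1) → B) (a : Fin N)
    (w : Word N m) :
    leg (F := F) M (Fin.last m) f (Fin.snoc w a) = ∑ e, M a e * f (Fin.snoc w e) := by
  rw [leg_apply]
  simp [Fin.update_snoc_last]

variable [StarRing F] (P : QParam N F)

/-- The matrix `Rhat` acting on the letters `k` and `k + 1`. -/
def braid (k : Fin m) : Module.End F (Word N (m + 1) → M) where
  toFun f w := P.Q (w k.succ) (w k.castSucc) • f (w ∘ Equiv.swap k.castSucc k.succ) +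
    if w k.succ < w k.castSucc then (1 - P.q ^ 2) • f w else 0
  map_add' f g := by
    ext w
    simp only [Pi.add_apply, smul_add]
    split_ifs <;> abel
  map_smul' r f := by
    ext w
    simp only [Pi.smul_apply, smul_add, RingHom.id_apply]
    split_ifs
    · simp only [smul_comm r]
    · simp only [smul_comm r, smul_zero]

theorem braid_apply (k : Fin m) (f : Word N (m + 1) → M) (w : Word N (m + 1)) :
    P.braid k f w = P.Q (w k.succ) (w k.castSucc) • f (w ∘ Equiv.swap k.castSucc k.succ) +
      if w k.succ < w k.castSucc then (1 - P.q ^ 2) • f w else 0 := rfl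

theorem consOp_braid (k : Fin m) : consOp (P.braid (M := M) k) = P.braid k.succ := by
  refine end_ext_cons fun f a w => ?_
  rw [consOp_apply_cons, braid_apply, braid_apply, ← Fin.succ_castSucc, cons_comp_swap_succ]
  simp only [Fin.cons_succ]

theorem snocOp_braid (k : Fin m) : snocOp (P.braid (M := M) k) = P.braid k.castSucc := by
  refine end_ext_snoc fun f w a => ?_
  rw [snocOp_apply_snoc, braid_apply, braid_apply, Fin.succ_castSucc, snoc_comp_swap_castSucc]
  simp only [Fin.snoc_castSucc]

theorem braid_zero_apply (f : Word N (m + 2) → M) (a b : Fin N) (w : Word N m) :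
    P.braid 0 f (Fin.cons a (Fin.cons b w)) = P.Q b a • f (Fin.cons b (Fin.cons a w)) +
      if b < a then (1 - P.q ^ 2) • f (Fin.cons a (Fin.cons b w)) else 0 := by
  have h : (Fin.cons a (Fin.cons b w) : Word N (m + 2)) ∘
      Equiv.swap (Fin.castSucc 0) (Fin.succ 0) = Fin.cons b (Fin.cons a w) := by
    ext x
    refine Fin.cases ?_ (fun x => Fin.cases ?_ (fun x => ?_) x) x
    · simp
    · simp
    · rw [Function.comp_apply, Equiv.swap_apply_of_ne_of_ne]
      · simp
      · exact Fin.succ_ne_zero _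
      · exact fun h => Fin.succ_ne_zero _ (Fin.succ_injective _ h)
  rw [braid_apply, h]
  rfl

theorem braid_last_apply (f : Word N (m + 2) → M) (a b : Fin N) (w : Word N m) :
    P.braid (Fin.last m) f (Fin.snoc (Fin.snoc w a) b) =
      P.Q b a • f (Fin.snoc (Fin.snoc w b) a) +
      if b < a then (1 - P.q ^ 2) • f (Fin.snoc (Fin.snoc w a) b) else 0 := by
  have h : (Fin.snoc (Fin.snoc w a) b : Word N (m + 2)) ∘
      Equiv.swap (Fin.last m).castSucc (Fin.last m).succ = Fin.snoc (Fin.snoc w b) a := by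
    ext x
    refine Fin.lastCases ?_ (fun x => Fin.lastCases ?_ (fun x => ?_) x) x
    · simp
    · simp
    · rw [Function.comp_apply, Equiv.swap_apply_of_ne_of_ne]
      · simp
      · exact fun h => Fin.castSucc_ne_last _ (Fin.castSucc_injective _ h)
      · exact Fin.castSucc_ne_last _
  rw [braid_apply, h]
  simp

theorem braid_zero_mul_consOp_consOp (A : Module.End F (Word N m → M)) :
    P.braid 0 * consOp (consOp A) = consOp (consOp A) * P.braid 0 := by
  refine end_ext_cons fun f a w => ?_
  rw [← Fin.cons_self_tail w]
  simp only [Module.End.mul_apply, braid_zero_apply, consOp_apply_cons]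
  generalize w 0 = b
  generalize Fin.tail w = w
  have h : (fun d => P.Q b a • f (Fin.cons b (Fin.cons a d)) +
      if b < a then (1 - P.q ^ 2) • f (Fin.cons a (Fin.cons b d)) else 0) =
      P.Q b a • (fun d => f (Fin.cons b (Fin.cons a d))) +
      if b < a then (1 - P.q ^ 2) • (fun d => f (Fin.cons a (Fin.cons b d))) else 0 := by
    split_ifs <;> rfl
  rw [h, map_add, map_smul]
  split_ifs <;> simp

theorem leg_zero_mul_consOp_braid (M : Matrix (Fin N) (Fin N) B) (k : Fin m) :
    leg (F := F) M 0 * consOp (P.braid k) = consOp (P.braid k) * leg M 0 := by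
  refine end_ext_cons fun f a w => ?_
  simp only [Module.End.mul_apply, leg_zero_apply, consOp_apply_cons, braid_apply]
  split_ifs <;> simp [mul_add, Finset.sum_add_distrib, Finset.smul_sum]

end Operators

/-! ### The braid relation, and the defining relations on adjacent letters -/

section Relations

variable {N : ℕ} {F : Type*} [Field F] [StarRing F] (P : QParam N F) {m : ℕ}
  {M : Type*} [AddCommGroup M] [Module F M]

/-- The braid relation for the first three letters. -/
theorem braid_zero_braid_one_braid_zero :
    P.braid (M := M) (0 : Fin (m + 2)) * consOp (P.braid 0) * P.braid 0 =
      consOp (P.braid 0) * P.braid 0 * consOp (P.braid 0) := by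
  refine end_ext_cons fun f a w => ?_
  rw [← Fin.cons_self_tail w, ← Fin.cons_self_tail (Fin.tail w)]
  generalize w 0 = b
  generalize Fin.tail w 0 = c
  generalize Fin.tail (Fin.tail w) = w
  simp only [Module.End.mul_apply, braid_zero_apply, consOp_apply_cons]
  rcases lt_trichotomy a b with hab | hab | hab <;>
    rcases lt_trichotomy b c with hbc | hbc | hbc <;>
    rcases lt_trichotomy a c with hac | hac | hac <;>
    first
    | (exfalso; order)
    | (have h1 := fun h : a ≠ b => P.Q_mul a b h
       have h2 := fun h : b ≠ c => P.Q_mul b c h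
       have h3 := fun h : a ≠ c => P.Q_mul a c h
       try subst hab
       try subst hbc
       try subst hac
       simp only [*, not_lt_of_gt, lt_irrefl, if_true, if_false, P.Q_diag, smul_add, add_zero]
       try (match_scalars <;> grind))

/-- The relation `R X₁ X₂ = X₂ X₁ R`, in coordinates. -/
theorem X_mul_X (a b c d : Fin N) :
    P.Q a b • (P.X a c * P.X b d) + (if a < b then (1 - P.q ^ 2) • (P.X b c * P.X a d) else 0) =
      P.Q c d • (P.X b d * P.X a c) +
        if d < c then (1 - P.q ^ 2) • (P.X b c * P.X a d) else 0 := by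
  have h := P.rel_XX a b c d
  simp only [R_apply, map_add, add_mul, mul_add, Finset.sum_add_distrib,
    apply_ite (algebraMap F P.OqR), map_zero, ite_mul, mul_ite, zero_mul, mul_zero, ite_and,
    Finset.sum_ite_eq, Finset.sum_ite_eq', Finset.sum_ite_irrel, Finset.sum_const_zero,
    Finset.mem_univ, if_true] at h
  simp only [Algebra.smul_def]
  convert h using 2
  · rw [mul_assoc]
  · split_ifs <;> simp [mul_assoc]
  · rw [Algebra.commutes, mul_assoc]
  · split_ifs
    · rw [Algebra.commutes, mul_assoc]
    · rfl

/-- The relation `R Y₂ Y₁ = Y₁ Y₂ R`, in coordinates. -/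
theorem Y_mul_Y (a b c d : Fin N) :
    P.Q a b • (P.Y b d * P.Y a c) + (if a < b then (1 - P.q ^ 2) • (P.Y a d * P.Y b c) else 0) =
      P.Q c d • (P.Y a c * P.Y b d) +
        if d < c then (1 - P.q ^ 2) • (P.Y a d * P.Y b c) else 0 := by
  have h := P.rel_YY a b c d
  simp only [R_apply, map_add, add_mul, mul_add, Finset.sum_add_distrib,
    apply_ite (algebraMap F P.OqR), map_zero, ite_mul, mul_ite, zero_mul, mul_zero, ite_and,
    Finset.sum_ite_eq, Finset.sum_ite_eq', Finset.sum_ite_irrel, Finset.sum_const_zero,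
    Finset.mem_univ, if_true] at h
  simp only [Algebra.smul_def]
  convert h using 2
  · rw [mul_assoc]
  · split_ifs <;> simp [mul_assoc]
  · rw [Algebra.commutes, mul_assoc]
  · split_ifs
    · rw [Algebra.commutes, mul_assoc]
    · rfl

/-- The relation `X₁ R Y₂ = Y₂ R X₁`, in coordinates. -/
theorem X_mul_Y (a b c d : Fin N) :
    P.Q c b • (P.X a c * P.Y b d) + (if c = b then
        ∑ e, if e < b then (1 - P.q ^ 2) • (P.X a e * P.Y e d) else 0 else 0) =
      P.Q a d • (P.Y b d * P.X a c) + if d = a then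
        ∑ f, if a < f then (1 - P.q ^ 2) • (P.Y b f * P.X f c) else 0 else 0 := by
  have h := P.rel_XY a b c d
  simp only [R_apply, map_add, add_mul, mul_add, Finset.sum_add_distrib,
    apply_ite (algebraMap F P.OqR), map_zero, ite_mul, mul_ite, zero_mul, mul_zero, ite_and,
    Finset.sum_ite_eq, Finset.sum_ite_eq', Finset.sum_ite_irrel, Finset.sum_const_zero,
    Finset.mem_univ, if_true] at h
  simp only [Algebra.smul_def]
  convert h using 2
  · rw [← mul_assoc, ← Algebra.commutes]
  · by_cases hcb : c = b
    · subst hcb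
      simp only [if_true]
      refine Finset.sum_congr rfl fun e _ => ?_
      split_ifs
      · rw [← mul_assoc, ← Algebra.commutes]
      · rfl
    · simp [hcb, Ne.symm hcb]
  · rw [← mul_assoc, ← Algebra.commutes]
  · by_cases hda : d = a
    · subst hda
      simp only [if_true]
      refine Finset.sum_congr rfl fun e _ => ?_
      split_ifs
      · rw [← mul_assoc, ← Algebra.commutes]
      · rfl
    · simp [hda, Ne.symm hda]

theorem braid_zero_mul_leg_X :
    P.braid (0 : Fin (m + 1)) * (leg (F := F) P.X 0 * leg P.X 1) =
      leg (F := F) P.X 0 * leg P.X 1 * P.braid 0 := by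
  refine end_ext_cons fun f a w => ?_
  rw [← Fin.cons_self_tail w, ← Fin.succ_zero_eq_one, ← consOp_leg]
  generalize w 0 = b
  generalize Fin.tail w = w
  simp only [Module.End.mul_apply, braid_zero_apply, consOp_apply_cons, leg_zero_apply]
  have h : ∀ e g, P.X a e * (P.X b g * (P.Q g e • f (Fin.cons g (Fin.cons e w)) +
      if g < e then (1 - P.q ^ 2) • f (Fin.cons e (Fin.cons g w)) else 0)) =
      P.Q g e • (P.X a e * P.X b g) * f (Fin.cons g (Fin.cons e w)) +
      (if g < e then (1 - P.q ^ 2) • (P.X a e * P.X b g) else 0) *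
        f (Fin.cons e (Fin.cons g w)) := by
    intro e g
    split_ifs <;> simp [mul_add, mul_assoc]
  simp only [Finset.mul_sum, h, Finset.sum_add_distrib]
  rw [Finset.sum_comm (f := fun e g => P.Q g e • (P.X a e * P.X b g) * _)]
  rw [← Finset.sum_add_distrib]
  simp only [← Finset.sum_add_distrib, ← add_mul, ← P.X_mul_X b a]
  simp only [add_mul, Finset.sum_add_distrib, Finset.smul_sum]
  split_ifs <;> simp [mul_assoc]

theorem braid_zero_mul_leg_Y :
    P.braid (0 : Fin (m + 1)) * (leg (F := F) P.Y 1 * leg P.Y 0) =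
      leg (F := F) P.Y 1 * leg P.Y 0 * P.braid 0 := by
  refine end_ext_cons fun f a w => ?_
  rw [← Fin.cons_self_tail w, ← Fin.succ_zero_eq_one, ← consOp_leg]
  generalize w 0 = b
  generalize Fin.tail w = w
  simp only [Module.End.mul_apply, braid_zero_apply, consOp_apply_cons, leg_zero_apply]
  have h : ∀ e g, P.Y b g * (P.Y a e * (P.Q g e • f (Fin.cons g (Fin.cons e w)) +
      if g < e then (1 - P.q ^ 2) • f (Fin.cons e (Fin.cons g w)) else 0)) =
      P.Q g e • (P.Y b g * P.Y a e) * f (Fin.cons g (Fin.cons e w)) +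
      (if g < e then (1 - P.q ^ 2) • (P.Y b g * P.Y a e) else 0) *
        f (Fin.cons e (Fin.cons g w)) := by
    intro e g
    split_ifs <;> simp [mul_add, mul_assoc]
  simp only [Finset.mul_sum, h, Finset.sum_add_distrib]
  rw [Finset.sum_comm (f := fun g e => P.Q g e • (P.Y b g * P.Y a e) * _)]
  rw [← Finset.sum_add_distrib]
  simp only [← Finset.sum_add_distrib, ← add_mul, ← P.Y_mul_Y b a]
  simp only [add_mul, Finset.sum_add_distrib, Finset.smul_sum]
  split_ifs <;> simp [mul_assoc]

theorem leg_X_mul_braid_zero_mul_leg_Y :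
    leg (F := F) P.X 1 * P.braid (0 : Fin (m + 1)) * leg P.Y 1 =
      leg (F := F) P.Y 0 * P.braid 0 * leg P.X 0 := by
  refine end_ext_cons fun f a w => ?_
  rw [← Fin.cons_self_tail w, ← Fin.succ_zero_eq_one, ← consOp_leg, ← consOp_leg]
  generalize w 0 = b
  generalize Fin.tail w = w
  simp only [Module.End.mul_apply, braid_zero_apply, consOp_apply_cons, leg_zero_apply]
  have hl : ∑ e, P.X b e * (P.Q e a • ∑ d, P.Y a d * f (Fin.cons e (Fin.cons d w)) +
      if e < a then (1 - P.q ^ 2) • ∑ d, P.Y e d * f (Fin.cons a (Fin.cons d w)) else 0) =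
      ∑ c, ∑ d, (P.Q c a • (P.X b c * P.Y a d) + (if c = a then
        ∑ e, if e < a then (1 - P.q ^ 2) • (P.X b e * P.Y e d) else 0 else 0)) *
          f (Fin.cons c (Fin.cons d w)) := by
    simp only [add_mul, mul_add, Finset.sum_add_distrib, ite_mul, zero_mul, Finset.sum_ite_irrel,
      Finset.sum_const_zero, Finset.sum_ite_eq', Finset.mem_univ, if_true]
    congr 1
    · simp [Finset.mul_sum, Finset.smul_sum, mul_assoc]
    · simp only [Finset.sum_mul]
      rw [Finset.sum_comm]
      refine Finset.sum_congr rfl fun e _ => ?_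
      split_ifs <;> simp [Finset.mul_sum, Finset.smul_sum, mul_assoc]
  have hr : ∑ e, P.Y a e * (P.Q b e • ∑ c, P.X b c * f (Fin.cons c (Fin.cons e w)) +
      if b < e then (1 - P.q ^ 2) • ∑ c, P.X e c * f (Fin.cons c (Fin.cons b w)) else 0) =
      ∑ c, ∑ d, (P.Q b d • (P.Y a d * P.X b c) + (if d = b then
        ∑ e, if b < e then (1 - P.q ^ 2) • (P.Y a e * P.X e c) else 0 else 0)) *
          f (Fin.cons c (Fin.cons d w)) := by
    rw [Finset.sum_comm]
    simp only [add_mul, mul_add, Finset.sum_add_distrib, ite_mul, zero_mul, Finset.sum_ite_irrel,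
      Finset.sum_const_zero, Finset.sum_ite_eq', Finset.mem_univ, if_true]
    congr 1
    · simp [Finset.mul_sum, Finset.smul_sum, mul_assoc]
    · simp only [Finset.sum_mul]
      rw [Finset.sum_comm]
      refine Finset.sum_congr rfl fun e _ => ?_
      split_ifs <;> simp [Finset.mul_sum, Finset.smul_sum, mul_assoc]
  rw [hl, hr]
  refine Finset.sum_congr rfl fun c _ => Finset.sum_congr rfl fun d _ => ?_
  rw [P.X_mul_Y b a c d]

end Relations

/-! ### Ordered products of letters and the crossing of one strand with the others -/

section Prefix

variable {N : ℕ} {F : Type*} [Field F] [StarRing F] (P : QParam N F) {m : ℕ}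
  {M : Type*} [AddCommGroup M] [Module F M]

/-- The operator `X₁ X₂ ⋯ X_m`. -/
noncomputable def prodX : (m : ℕ) → Module.End F (Word N m → P.OqR)
  | 0 => 1
  | m + 1 => snocOp (prodX m) * leg P.X (Fin.last m)

/-- The operator `Y_m ⋯ Y₂ Y₁`. -/
noncomputable def prodY : (m : ℕ) → Module.End F (Word N m → P.OqR)
  | 0 => 1
  | m + 1 => leg P.Y (Fin.last m) * snocOp (prodY m)

/-- The braid `Rhat_{m,m+1} ⋯ Rhat_{2,3} Rhat_{1,2}` on `m + 1` letters, in which the first strand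
crosses all the others. -/
noncomputable def crossing (M : Type*) [AddCommGroup M] [Module F M] :
    (m : ℕ) → Module.End F (Word N (m + 1) → M)
  | 0 => 1
  | m + 1 => consOp (crossing M m) * P.braid 0

theorem prodX_succ (m : ℕ) :
    P.prodX (m + 1) = snocOp (P.prodX m) * leg P.X (Fin.last m) := rfl

theorem prodY_succ (m : ℕ) :
    P.prodY (m + 1) = leg P.Y (Fin.last m) * snocOp (P.prodY m) := rfl

theorem crossing_succ (m : ℕ) :
    P.crossing M (m + 1) = consOp (P.crossing M m) * P.braid 0 := rfl

theorem prodX_succ_eq_cons (m : ℕ) :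
    P.prodX (m + 1) = leg P.X 0 * consOp (P.prodX m) := by
  induction m with
  | zero => simp [prodX]
  | succ m ih =>
    rw [prodX_succ, ih, snocOp_mul, snocOp_leg, ← consOp_snocOp, mul_assoc, ← ih,
      P.prodX_succ m, consOp_mul, consOp_leg, Fin.castSucc_zero, Fin.succ_last]

theorem prodY_succ_eq_cons (m : ℕ) :
    P.prodY (m + 1) = consOp (P.prodY m) * leg P.Y 0 := by
  induction m with
  | zero => simp [prodY]
  | succ m ih =>
    rw [prodY_succ, ih, snocOp_mul, snocOp_leg, ← consOp_snocOp, ← mul_assoc, ← ih,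
      P.prodY_succ m, consOp_mul, consOp_leg, Fin.castSucc_zero, Fin.succ_last]

theorem crossing_succ_eq_snoc (m : ℕ) :
    P.crossing M (m + 1) = P.braid (Fin.last m) * snocOp (P.crossing M m) := by
  induction m with
  | zero => simp [crossing]
  | succ m ih =>
    rw [crossing_succ, ih, consOp_mul, consOp_braid, consOp_snocOp, mul_assoc, ← ih,
      P.crossing_succ m, snocOp_mul, snocOp_braid, Fin.castSucc_zero, Fin.succ_last]

/-! ### Commutation with the braid generators -/

theorem leg_zero_mul_consOp_crossing (A : Matrix (Fin N) (Fin N) P.OqR) :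
    leg (F := F) A 0 * consOp (P.crossing P.OqR m) =
      consOp (P.crossing P.OqR m) * leg A 0 := by
  induction m generalizing A with
  | zero => simp [crossing]
  | succ m ih =>
    rw [crossing_succ_eq_snoc, consOp_mul, ← mul_assoc, leg_zero_mul_consOp_braid, mul_assoc,
      consOp_snocOp, mul_assoc]
    congr 1
    rw [← Fin.castSucc_zero, ← snocOp_leg, ← snocOp_mul, ih, snocOp_mul]

theorem braid_mul_prodX (k : Fin m) :
    P.braid k * P.prodX (m + 1) = P.prodX (m + 1) * P.braid k := by
  induction m with
  | zero => exact k.elim0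
  | succ m ih =>
    refine Fin.cases ?_ (fun k => ?_) k
    · rw [prodX_succ_eq_cons, prodX_succ_eq_cons, consOp_mul, consOp_leg, ← mul_assoc (leg P.X 0),
        ← mul_assoc, Fin.succ_zero_eq_one, braid_zero_mul_leg_X, mul_assoc,
        braid_zero_mul_consOp_consOp, mul_assoc, mul_assoc, mul_assoc]
    · rw [prodX_succ_eq_cons, ← consOp_braid, ← mul_assoc, ← leg_zero_mul_consOp_braid, mul_assoc,
        ← consOp_mul, ih, consOp_mul, mul_assoc]

theorem braid_mul_prodY (k : Fin m) :
    P.braid k * P.prodY (m + 1) = P.prodY (m + 1) * P.braid k := by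
  induction m with
  | zero => exact k.elim0
  | succ m ih =>
    refine Fin.cases ?_ (fun k => ?_) k
    · rw [prodY_succ_eq_cons, prodY_succ_eq_cons, consOp_mul, consOp_leg, mul_assoc,
        Fin.succ_zero_eq_one, mul_assoc, ← braid_zero_mul_leg_Y, ← mul_assoc,
        braid_zero_mul_consOp_consOp, mul_assoc]
    · rw [prodY_succ_eq_cons, ← consOp_braid, mul_assoc, leg_zero_mul_consOp_braid, ← mul_assoc,
        ← consOp_mul, ih, consOp_mul, mul_assoc]

/-- Conjugation by the crossing moves a braid generator by one strand. -/
theorem braid_castSucc_mul_crossing (k : Fin m) :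
    P.braid k.castSucc * P.crossing M (m + 1) = P.crossing M (m + 1) * P.braid k.succ := by
  induction m with
  | zero => exact k.elim0
  | succ m ih =>
    refine Fin.cases ?_ (fun k => ?_) k
    · rw [crossing, crossing, consOp_mul, ← mul_assoc, ← mul_assoc, Fin.castSucc_zero,
        braid_zero_mul_consOp_consOp, mul_assoc, mul_assoc, ← mul_assoc (P.braid 0),
        braid_zero_braid_one_braid_zero, ← consOp_braid]
      simp only [mul_assoc]
    · have h : P.braid (M := M) 0 * P.braid k.succ.succ = P.braid k.succ.succ * P.braid 0 := by
        rw [← consOp_braid, ← consOp_braid, braid_zero_mul_consOp_consOp]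
      rw [crossing, mul_assoc, h, ← mul_assoc, ← Fin.succ_castSucc, ← consOp_braid, ← mul_assoc,
        ← consOp_mul, ih, consOp_mul, consOp_braid]

/-- The relation `X₁ R₁₂ Y₂ = Y₂ R₁₂ X₁` for one letter of `X` and `m` letters of `Y`. -/
theorem prodY_mul_crossing_mul_leg_X (m : ℕ) :
    snocOp (P.prodY m) * P.crossing P.OqR m * leg P.X 0 =
      leg P.X (Fin.last m) * P.crossing P.OqR m * consOp (P.prodY m) := by
  induction m with
  | zero => simp [prodY, crossing]
  | succ m ih =>
    calc snocOp (P.prodY (m + 1)) * P.crossing P.OqR (m + 1) * leg P.X 0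
        = consOp (snocOp (P.prodY m)) * (leg P.Y 0 * consOp (P.crossing P.OqR m)) *
            P.braid 0 * leg P.X 0 := by
          rw [prodY_succ_eq_cons, snocOp_mul, ← consOp_snocOp, snocOp_leg, crossing,
            Fin.castSucc_zero]
          simp only [mul_assoc]
      _ = consOp (snocOp (P.prodY m)) * consOp (P.crossing P.OqR m) *
            (leg P.Y 0 * P.braid 0 * leg P.X 0) := by
          rw [leg_zero_mul_consOp_crossing]
          simp only [mul_assoc]
      _ = consOp (snocOp (P.prodY m) * P.crossing P.OqR m * leg P.X 0) *
            P.braid 0 * leg P.Y 1 := by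
          rw [← leg_X_mul_braid_zero_mul_leg_Y, consOp_mul, consOp_mul, consOp_leg,
            Fin.succ_zero_eq_one]
          simp only [mul_assoc]
      _ = leg P.X (Fin.last (m + 1)) * consOp (P.crossing P.OqR m) *
            (consOp (consOp (P.prodY m)) * P.braid 0) * leg P.Y 1 := by
          rw [ih, consOp_mul, consOp_mul, consOp_leg, Fin.succ_last]
          simp only [mul_assoc]
      _ = _ := by
          rw [← braid_zero_mul_consOp_consOp, crossing, prodY_succ_eq_cons, consOp_mul,
            consOp_leg, Fin.succ_zero_eq_one]
          simp only [mul_assoc]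

end Prefix

/-! ### Antisymmetric tensors -/

section Antisymmetric

variable {N : ℕ} {F : Type*} [Field F] [StarRing F] (P : QParam N F) {m : ℕ}
  {M : Type*} [AddCommGroup M] [Module F M]

theorem comp_swap_eq_self {X Y : Type*} [DecidableEq X] {f : X → Y} {i j : X} (h : f i = f j) :
    f ∘ Equiv.swap i j = f := by
  ext x
  rw [Function.comp_apply, Equiv.swap_apply_def]
  split_ifs with h1 h2
  · rw [h1, h]
  · rw [h2, h]
  · rfl

theorem Q_ne_zero (a b : Fin N) : P.Q a b ≠ 0 := by
  by_cases h : a = b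
  · rw [h, P.Q_diag]; exact one_ne_zero
  · exact left_ne_zero_of_mul (b := P.Q b a) (P.Q_mul a b h ▸ pow_ne_zero 2 P.q_ne_zero)

/-- A tensor is `q`-antisymmetric if every braid generator acts on it by `-q ^ 2`. -/
def IsAlt (f : Word N (m + 1) → M) : Prop := ∀ k : Fin m, P.braid k f = -P.q ^ 2 • f

variable {P} in
theorem IsAlt.apply_of_lt {f : Word N (m + 1) → M} (hf : P.IsAlt f) {k : Fin m}
    {w : Word N (m + 1)} (h : w k.succ < w k.castSucc) :
    f w = -P.Q (w k.succ) (w k.castSucc) • f (w ∘ Equiv.swap k.castSucc k.succ) := by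
  have h1 := congrFun (hf k) w
  rw [braid_apply, if_pos h, Pi.smul_apply] at h1
  rw [neg_smul, eq_neg_iff_add_eq_zero]
  linear_combination (norm := module) h1

variable {P} in
theorem IsAlt.apply_of_eq (h2 : 1 + P.q ^ 2 ≠ 0) {f : Word N (m + 1) → M} (hf : P.IsAlt f)
    {k : Fin m} {w : Word N (m + 1)} (h : w k.succ = w k.castSucc) : f w = 0 := by
  have h1 := congrFun (hf k) w
  have hw : w ∘ Equiv.swap k.castSucc k.succ = w :=
    comp_swap_eq_self h.symm
  rw [braid_apply, if_neg h.not_lt, hw, h, P.Q_diag, Pi.smul_apply] at h1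
  have h3 : (1 + P.q ^ 2) • f w = 0 := by linear_combination (norm := module) h1
  exact (smul_eq_zero.mp h3).resolve_left h2

theorem isAlt_of_apply {f : Word N (m + 1) → M}
    (h1 : ∀ (k : Fin m) w, w k.succ < w k.castSucc →
      f w = -P.Q (w k.succ) (w k.castSucc) • f (w ∘ Equiv.swap k.castSucc k.succ))
    (h2 : ∀ (k : Fin m) w, w k.succ = w k.castSucc → f w = 0) : P.IsAlt f := by
  intro k
  ext w
  rw [braid_apply, Pi.smul_apply]
  rcases lt_trichotomy (w k.succ) (w k.castSucc) with h | h | h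
  · rw [if_pos h, h1 k w h]
    module
  · have hw : w ∘ Equiv.swap k.castSucc k.succ = w :=
      comp_swap_eq_self h.symm
    rw [if_neg h.not_lt, hw, h2 k w h]
    simp
  · rw [if_neg h.not_gt, h1 k (w ∘ Equiv.swap k.castSucc k.succ) (by simpa using h)]
    have hw : (w ∘ Equiv.swap k.castSucc k.succ) ∘ Equiv.swap k.castSucc k.succ = w := by
      ext x; simp
    rw [hw, add_zero, smul_smul]
    simp only [Function.comp_apply, Equiv.swap_apply_left, Equiv.swap_apply_right]
    rw [← P.Q_mul _ _ h.ne, mul_comm]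
    congr 1
    ring

theorem IsAlt.smul {f : Word N (m + 1) → M} (hf : P.IsAlt f) (r : F) : P.IsAlt (r • f) := by
  intro k
  rw [map_smul, hf k, smul_comm]

theorem IsAlt.sub {f g : Word N (m + 1) → M} (hf : P.IsAlt f) (hg : P.IsAlt g) :
    P.IsAlt (f - g) := by
  intro k
  rw [map_sub, hf k, hg k, smul_sub]

theorem isAlt_sum {ι : Type*} (s : Finset ι) {f : ι → Word N (m + 1) → M}
    (hf : ∀ x ∈ s, P.IsAlt (f x)) : P.IsAlt (∑ x ∈ s, f x) := by
  intro k
  rw [map_sum, Finset.smul_sum]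
  exact Finset.sum_congr rfl fun x hx => hf x hx k

variable {P} in
theorem IsAlt.map {f : Word N (m + 1) → M} (hf : P.IsAlt f)
    {M' : Type*} [AddCommGroup M'] [Module F M']
    {A : (Word N (m + 1) → M) →ₗ[F] (Word N (m + 1) → M')}
    (hA : ∀ k f, P.braid k (A f) = A (P.braid k f)) : P.IsAlt (A f) := by
  intro k
  rw [hA, hf k, map_smul]

variable {P} in
/-- A `q`-antisymmetric tensor is determined by its coefficients at the increasing words. -/
theorem IsAlt.eq_zero (h2 : 1 + P.q ^ 2 ≠ 0) {f : Word N (m + 1) → M} (hf : P.IsAlt f)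
    (h : ∀ w, StrictMono w → f w = 0) : f = 0 := by
  have hswap : ∀ (k : Fin m) w, f w = 0 → f (w ∘ Equiv.swap k.castSucc k.succ) = 0 := by
    intro k w hw
    rcases lt_trichotomy (w k.succ) (w k.castSucc) with h | h | h
    · rw [hf.apply_of_lt h, smul_eq_zero, neg_eq_zero] at hw
      exact hw.resolve_left (P.Q_ne_zero _ _)
    · exact hf.apply_of_eq h2 (k := k) (by simpa using h.symm)
    · rw [hf.apply_of_lt (k := k) (by simpa using h)]
      have hw' : (w ∘ Equiv.swap k.castSucc k.succ) ∘ Equiv.swap k.castSucc k.succ = w := by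
        ext x; simp
      rw [hw', hw, smul_zero]
  have hperm : ∀ (s : Equiv.Perm (Fin (m + 1))) w, f w = 0 → f (w ∘ s) = 0 := by
    intro s
    have hs : s ∈ Submonoid.closure
        (Set.range fun k : Fin m => Equiv.swap k.castSucc k.succ) := by
      rw [Equiv.Perm.mclosure_swap_castSucc_succ]; trivial
    induction hs using Submonoid.closure_induction with
    | mem s hs =>
      obtain ⟨k, rfl⟩ := hs
      exact hswap k
    | one => exact fun w hw => hw
    | mul s t _ _ hs ht => exact fun w hw => ht _ (hs _ hw)
  ext w
  have hsort : f (w ∘ Tuple.sort w) = 0 := by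
    by_cases hm : StrictMono (w ∘ Tuple.sort w)
    · exact h _ hm
    · rw [Fin.strictMono_iff_lt_succ] at hm
      push Not at hm
      obtain ⟨k, hk⟩ := hm
      exact hf.apply_of_eq h2 (k := k)
        (le_antisymm hk (Tuple.monotone_sort w k.castSucc_le_succ))
  have := hperm (Tuple.sort w)⁻¹ _ hsort
  have hw : (w ∘ Tuple.sort w) ∘ ((Tuple.sort w)⁻¹ : Equiv.Perm _) = w := by
    ext x; simp
  rwa [hw] at this

/-! ### The antisymmetric tensors attached to subsets -/

theorem negQCol_snoc (w : Word N m) (a : Fin N) :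
    P.negQCol (Fin.snoc w a : Word N (m + 1)) =
      P.negQCol w * ∏ i, if a < w i then -P.Q a (w i) else 1 := by
  simp only [negQCol, Fin.prod_univ_castSucc, Fin.snoc_castSucc, Fin.snoc_last, lt_irrefl,
    and_false, if_false, mul_one, Fin.castSucc_lt_castSucc_iff, Fin.castSucc_lt_last, true_and,
    (Fin.castSucc_lt_last _).not_gt, false_and, Finset.prod_const_one, Finset.prod_mul_distrib]

theorem negQCol_swap (k : Fin m) (w : Word N (m + 1)) (h : w k.succ < w k.castSucc) :
    P.negQCol w = -P.Q (w k.succ) (w k.castSucc) *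
      P.negQCol (w ∘ Equiv.swap k.castSucc k.succ) := by
  induction m with
  | zero => exact k.elim0
  | succ m ih =>
    revert h
    rw [← Fin.snoc_init_self w]
    generalize w (Fin.last (m + 1)) = a
    generalize Fin.init w = w
    refine Fin.lastCases ?_ (fun k => ?_) k
    · rw [← Fin.snoc_init_self w]
      generalize w (Fin.last m) = b
      generalize Fin.init w = w
      intro h
      have hs : (Fin.snoc (Fin.snoc w b) a : Word N (m + 2)) ∘
          Equiv.swap (Fin.last m).castSucc (Fin.last m).succ = Fin.snoc (Fin.snoc w a) b := by
        ext x
        refine Fin.lastCases ?_ (fun x => Fin.lastCases ?_ (fun x => ?_) x) x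
        · simp
        · simp
        · rw [Function.comp_apply, Equiv.swap_apply_of_ne_of_ne]
          · simp
          · exact fun h => Fin.castSucc_ne_last _ (Fin.castSucc_injective _ h)
          · exact Fin.castSucc_ne_last _
      rw [hs]
      simp only [Fin.snoc_castSucc, Fin.succ_last, Fin.snoc_last] at h ⊢
      simp only [negQCol_snoc, Fin.prod_univ_castSucc, Fin.snoc_castSucc, Fin.snoc_last]
      rw [if_pos h, if_neg h.not_gt]
      ring
    · rw [Fin.succ_castSucc, snoc_comp_swap_castSucc, negQCol_snoc, negQCol_snoc,
        Fin.snoc_castSucc, Fin.snoc_castSucc]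
      intro h
      rw [ih k w h, mul_assoc]
      congr 2
      exact (Equiv.prod_comp (Equiv.swap k.castSucc k.succ)
        fun i => if a < w i then -P.Q a (w i) else 1).symm

/-- The antisymmetric tensor `∑ s, (-q)_{s,c} e_{s(1)} ⊗ ⋯ ⊗ e_{s(m)}`, where `s` runs over the
enumerations of the set `J`; it vanishes unless `J` has `m` elements. -/
def altTensor (m : ℕ) (J : Finset (Fin N)) (w : Word N m) : F :=
  if Function.Injective w ∧ Finset.univ.image w = J then P.negQCol w else 0

theorem isAlt_altTensor (J : Finset (Fin N)) : P.IsAlt (P.altTensor (m + 1) J) := by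
  refine P.isAlt_of_apply (fun k w h => ?_) fun k w h => ?_
  · have h1 : Function.Injective (w ∘ Equiv.swap k.castSucc k.succ) ↔ Function.Injective w :=
      Function.Injective.of_comp_iff' w (Equiv.swap k.castSucc k.succ).bijective
    have h2 : Finset.univ.image (w ∘ Equiv.swap k.castSucc k.succ) = Finset.univ.image w := by
      rw [← Finset.image_image, Finset.image_univ_equiv]
    simp only [altTensor, h1, h2]
    split_ifs
    · exact P.negQCol_swap k w h
    · simp
  · rw [altTensor, if_neg]
    exact fun h' => Fin.castSucc_lt_succ.ne' (h'.1 h)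

end Antisymmetric

/-! ### Expansion of antisymmetric tensors and their pairings -/

section Expansion

variable {N : ℕ} {F : Type*} [Field F] [StarRing F] (P : QParam N F) {m : ℕ}
  {M : Type*} [AddCommGroup M] [Module F M]

theorem sum_word_snoc {X : Type*} [AddCommMonoid X] (f : Word N (m + 1) → X) :
    ∑ w, f w = ∑ a, ∑ w : Word N m, f (Fin.snoc w a) := by
  rw [← Fintype.sum_prod_type']
  exact ((Fin.snocEquiv fun _ => Fin N).sum_comp f).symm

theorem sum_word_cons {X : Type*} [AddCommMonoid X] (f : Word N (m + 1) → X) :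
    ∑ w, f w = ∑ a, ∑ w : Word N m, f (Fin.cons a w) := by
  rw [← Fintype.sum_prod_type']
  exact ((Fin.consEquiv fun _ => Fin N).sum_comp f).symm

/-- Numbering the elements of a finite set by the number of smaller elements. -/
theorem sum_pow_card_lt {R α : Type*} [CommSemiring R] [LinearOrder α] (x : R) (s : Finset α) :
    ∑ a ∈ s, x ^ (s.filter fun b => b < a).card = ∑ k ∈ Finset.range s.card, x ^ k := by
  induction s using Finset.induction_on_max with
  | empty => simp
  | insert a s hs ih =>
    have ha : a ∉ s := fun h => lt_irrefl a (hs a h)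
    rw [Finset.sum_insert ha, Finset.card_insert_of_notMem ha, Finset.sum_range_succ, ← ih,
      add_comm]
    congr 1
    · refine Finset.sum_congr rfl fun b hb => ?_
      rw [Finset.filter_insert, if_neg (hs b hb).not_gt]
    · rw [Finset.filter_insert, if_neg (lt_irrefl a), Finset.filter_true_of_mem hs]

theorem sum_pow_card_gt {R α : Type*} [CommSemiring R] [LinearOrder α] (x : R) (s : Finset α) :
    ∑ a ∈ s, x ^ (s.filter fun b => a < b).card = ∑ k ∈ Finset.range s.card, x ^ k :=
  sum_pow_card_lt (α := αᵒᵈ) x s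

theorem altTensor_snoc (J : Finset (Fin N)) (w : Word N m) (a : Fin N) :
    P.altTensor (m + 1) J (Fin.snoc w a : Word N (m + 1)) =
      if a ∈ J then (∏ b ∈ J with a < b, -P.Q a b) * P.altTensor m (J.erase a) w else 0 := by
  have himg : Finset.univ.image (Fin.snoc w a : Word N (m + 1)) =
      insert a (Finset.univ.image w) := by
    apply Finset.coe_injective
    simp [Fin.range_snoc]
  simp only [altTensor, himg, Fin.snoc_injective_iff]
  by_cases haJ : a ∈ J
  · rw [if_pos haJ]
    have hiff : ((Function.Injective w ∧ a ∉ Set.range w) ∧ insert a (Finset.univ.image w) = J) ↔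
        (Function.Injective w ∧ Finset.univ.image w = J.erase a) := by
      constructor
      · rintro ⟨⟨h1, h2⟩, h3⟩
        refine ⟨h1, ?_⟩
        rw [← h3, Finset.erase_insert]
        simpa using h2
      · rintro ⟨h1, h2⟩
        refine ⟨⟨h1, ?_⟩, ?_⟩
        · have : a ∉ Finset.univ.image w := by rw [h2]; exact Finset.notMem_erase a J
          simpa using this
        · rw [h2, Finset.insert_erase haJ]
    simp only [hiff, mul_ite, mul_zero]
    refine if_ctx_congr Iff.rfl (fun h => ?_) fun _ => rfl
    rw [negQCol_snoc, mul_comm]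
    congr 1
    have hf : (J.filter fun b => a < b) = (J.erase a).filter fun b => a < b := by
      ext b
      simp only [Finset.mem_filter, Finset.mem_erase]
      exact ⟨fun h => ⟨⟨h.2.ne', h.1⟩, h.2⟩, fun h => ⟨h.1.2, h.2⟩⟩
    rw [hf, ← h.2, Finset.prod_filter, Finset.prod_image h.1.injOn]
  · rw [if_neg haJ, if_neg]
    rintro ⟨-, h⟩
    exact haJ (h ▸ Finset.mem_insert_self _ _)

theorem altTensor_eq_zero {J : Finset (Fin N)} (h : J.card ≠ m) : P.altTensor m J = 0 := by
  ext w
  rw [altTensor, if_neg]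
  · rfl
  · rintro ⟨h1, rfl⟩
    exact h (by rw [Finset.card_image_of_injective _ h1, Finset.card_fin])

theorem negQCol_of_strictMono {w : Word N m} (hw : StrictMono w) : P.negQCol w = 1 := by
  rw [negQCol]
  refine Finset.prod_eq_one fun i _ => Finset.prod_eq_one fun j _ => if_neg ?_
  rintro ⟨h1, h2⟩
  exact (hw h1).not_gt h2

theorem Sub.enum_strictMono (J : Sub N m) : StrictMono J.enum :=
  (J.1.orderEmbOfFin J.2).strictMono

theorem Sub.image_enum (J : Sub N m) : Finset.univ.image J.enum = J.1 :=
  Finset.image_orderEmbOfFin_univ J.1 J.2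

theorem altTensor_enum (J : Finset (Fin N)) (K : Sub N m) :
    P.altTensor m J K.enum = if K.1 = J then 1 else 0 := by
  simp [altTensor, K.image_enum, K.enum_strictMono.injective,
    P.negQCol_of_strictMono K.enum_strictMono]

theorem exists_enum_eq {w : Word N m} (hw : StrictMono w) : ∃ J : Sub N m, J.enum = w := by
  refine ⟨⟨Finset.univ.image w, ?_⟩, ?_⟩
  · rw [Finset.card_image_of_injective _ hw.injective, Finset.card_fin]
  · exact (Finset.orderEmbOfFin_unique _ (by simp) hw).symm

theorem isAlt_altTensor_smul (J : Finset (Fin N)) (x : M) :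
    P.IsAlt fun w => P.altTensor (m + 1) J w • x := by
  intro k
  ext w
  have h := congrArg (· • x) (congrFun (P.isAlt_altTensor J k) w)
  rw [braid_apply] at h ⊢
  simp only [Pi.smul_apply, smul_assoc, add_smul, ite_smul, zero_smul] at h ⊢
  exact h

variable {P} in
/-- A `q`-antisymmetric tensor is a combination of the tensors attached to subsets. -/
theorem IsAlt.eq_sum (h2 : 1 + P.q ^ 2 ≠ 0) {f : Word N (m + 1) → M} (hf : P.IsAlt f)
    (w : Word N (m + 1)) :
    f w = ∑ J : Sub N (m + 1), P.altTensor (m + 1) J.1 w • f J.enum := by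
  have h : f - ∑ J : Sub N (m + 1), (fun w => P.altTensor (m + 1) J.1 w • f J.enum) = 0 := by
    refine IsAlt.eq_zero h2 (IsAlt.sub P hf (P.isAlt_sum _ fun J _ =>
      P.isAlt_altTensor_smul J.1 _)) fun w hw => ?_
    obtain ⟨K, rfl⟩ := exists_enum_eq hw
    rw [Pi.sub_apply, Finset.sum_apply, Finset.sum_eq_single K]
    · rw [altTensor_enum, if_pos rfl, one_smul, sub_self]
    · intro J _ hJ
      rw [altTensor_enum, if_neg fun h => hJ (Subtype.ext h.symm), zero_smul]
    · simp
  have := congrFun h w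
  rwa [Pi.sub_apply, Finset.sum_apply, Pi.zero_apply, sub_eq_zero] at this

/-- The matrices `Rhat` are self-adjoint. -/
theorem sum_star_smul_braid (k : Fin m) (g : Word N (m + 1) → F) (f : Word N (m + 1) → M) :
    ∑ w, star (g w) • P.braid k f w = ∑ w, star (P.braid k g w) • f w := by
  simp only [braid_apply, smul_add, star_add, add_smul, Finset.sum_add_distrib]
  congr 1
  · rw [← (Equiv.arrowCongr (Equiv.swap k.castSucc k.succ) (Equiv.refl (Fin N))).sum_comp]
    refine Finset.sum_congr rfl fun w _ => ?_
    have hw : (w ∘ Equiv.swap k.castSucc k.succ) ∘ Equiv.swap k.castSucc k.succ = w := by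
      ext x; simp
    have he : (Equiv.arrowCongr (Equiv.swap k.castSucc k.succ) (Equiv.refl (Fin N))) w =
        w ∘ Equiv.swap k.castSucc k.succ := by
      ext x; simp [Equiv.arrowCongr]
    rw [he, hw]
    simp only [Function.comp_apply, Equiv.swap_apply_left, Equiv.swap_apply_right, smul_eq_mul,
      star_mul', P.star_Q, smul_smul, mul_comm]
  · refine Finset.sum_congr rfl fun w _ => ?_
    split_ifs
    · simp [smul_smul, P.star_q, mul_comm]
    · simp

/-- The pairing with the tensor attached to `J`. -/
def altPair (J : Finset (Fin N)) : (Word N m → M) →ₗ[F] M where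
  toFun f := ∑ w, star (P.altTensor m J w) • f w
  map_add' f g := by simp [Finset.sum_add_distrib]
  map_smul' r f := by simp [Finset.smul_sum, smul_comm r]

theorem altPair_apply (J : Finset (Fin N)) (f : Word N m → M) :
    P.altPair J f = ∑ w, star (P.altTensor m J w) • f w := rfl

theorem altPair_braid (J : Finset (Fin N)) (k : Fin m) (f : Word N (m + 1) → M) :
    P.altPair J (P.braid k f) = -P.q ^ 2 • P.altPair J f := by
  rw [altPair_apply, sum_star_smul_braid, P.isAlt_altTensor J k, altPair_apply, Finset.smul_sum]
  refine Finset.sum_congr rfl fun w _ => ?_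
  simp [P.star_q, smul_smul]

theorem star_prod_mul_prod (J : Finset (Fin N)) (a : Fin N) :
    star (∏ b ∈ J with a < b, -P.Q a b) * (∏ b ∈ J with a < b, -P.Q a b) =
      (P.q ^ 2) ^ (J.filter fun b => a < b).card := by
  rw [star_prod, ← Finset.prod_mul_distrib, Finset.prod_congr rfl, Finset.prod_const]
  intro b hb
  rw [star_neg, P.star_Q, neg_mul_neg, P.Q_mul _ _ (Finset.mem_filter.mp hb).2.ne']

theorem qNum_eq (n : ℕ) : P.qNum n = ∑ k ∈ Finset.range n, (P.q ^ 2) ^ k := by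
  simp only [qNum, pow_mul]

theorem qFact_succ (n : ℕ) : P.qFact (n + 1) = P.qNum (n + 1) * P.qFact n := by
  rw [qFact, Finset.prod_range_succ, mul_comm, qFact]

theorem sum_star_altTensor_mul (J : Finset (Fin N)) (hJ : J.card = m) :
    ∑ w, star (P.altTensor m J w) * P.altTensor m J w = P.qFact m := by
  induction m generalizing J with
  | zero =>
    rw [Finset.card_eq_zero] at hJ
    subst hJ
    rw [Fintype.sum_unique]
    simp [altTensor, negQCol, qFact, Function.injective_of_subsingleton]
  | succ m ih =>
    rw [sum_word_snoc, qFact_succ]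
    have h : ∀ a, ∑ w : Word N m, star (P.altTensor (m + 1) J (Fin.snoc w a : Word N (m + 1))) *
        P.altTensor (m + 1) J (Fin.snoc w a : Word N (m + 1)) =
        if a ∈ J then (P.q ^ 2) ^ (J.filter fun b => a < b).card * P.qFact m else 0 := by
      intro a
      simp only [altTensor_snoc]
      split_ifs with ha
      · rw [← ih (J.erase a) (by rw [Finset.card_erase_of_mem ha, hJ, Nat.add_sub_cancel]),
          ← star_prod_mul_prod, Finset.mul_sum]
        refine Finset.sum_congr rfl fun w _ => ?_
        rw [star_mul']
        ring
      · simp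
    simp only [h]
    rw [← Finset.sum_filter, Finset.filter_mem_eq_inter, Finset.univ_inter, ← Finset.sum_mul,
      sum_pow_card_gt, hJ, qNum_eq]

theorem star_altTensor_mul_altTensor_of_ne {J K : Finset (Fin N)} (h : J ≠ K) (w : Word N m) :
    star (P.altTensor m J w) * P.altTensor m K w = 0 := by
  simp only [altTensor]
  split_ifs with h1 h2
  · exact absurd (h1.2.symm.trans h2.2) h
  all_goals simp

theorem altPair_altTensor_smul (J K : Sub N m) (x : M) :
    P.altPair J.1 (fun w => P.altTensor m K.1 w • x) = if J = K then P.qFact m • x else 0 := by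
  simp only [altPair_apply, smul_smul]
  split_ifs with h
  · subst h
    rw [← Finset.sum_smul, P.sum_star_altTensor_mul J.1 J.2]
  · refine Finset.sum_eq_zero fun w _ => ?_
    rw [P.star_altTensor_mul_altTensor_of_ne (fun h' => h (Subtype.ext h')), zero_smul]

variable {P} in
theorem IsAlt.altPair_eq (h2 : 1 + P.q ^ 2 ≠ 0) {f : Word N (m + 1) → M} (hf : P.IsAlt f)
    (J : Sub N (m + 1)) : P.altPair J.1 f = P.qFact (m + 1) • f J.enum := by
  have h : f = ∑ K : Sub N (m + 1), fun w => P.altTensor (m + 1) K.1 w • f K.enum := by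
    ext w
    rw [Finset.sum_apply]
    exact hf.eq_sum h2 w
  conv_lhs => rw [h]
  rw [map_sum]
  simp only [altPair_altTensor_smul]
  simp

/-! ### Contraction of the last letter -/

variable {B : Type*} [Ring B] [Algebra F B]

/-- The trace of an operator on antisymmetric tensors, up to a factor `[m]!`, weighted by
`q ^ (2 * j)` for each letter `j` (counted from `0`). -/
def altTrace (A : Module.End F (Word N m → B)) : B :=
  ∑ J : Finset (Fin N), (P.q ^ 2) ^ (∑ j ∈ J, (j : ℕ)) •
    P.altPair J (A fun w => algebraMap F B (P.altTensor m J w))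

theorem sum_sum_erase {X : Type*} [AddCommMonoid X] {α : Type*} [Fintype α] [DecidableEq α]
    (G : α → Finset α → X) :
    ∑ J : Finset α, ∑ a ∈ J, G a (J.erase a) = ∑ J : Finset α, ∑ a ∈ Jᶜ, G a J := by
  rw [Finset.sum_sigma', Finset.sum_sigma']
  refine Finset.sum_bij' (fun x _ => ⟨x.1.erase x.2, x.2⟩) (fun x _ => ⟨insert x.2 x.1, x.2⟩)
    ?_ ?_ ?_ ?_ ?_
  · simp
  · simp
  · rintro ⟨J, a⟩ h
    simp only [Finset.mem_sigma, Finset.mem_univ, true_and] at h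
    simp [Finset.insert_erase h]
  · rintro ⟨J, a⟩ h
    simp only [Finset.mem_sigma, Finset.mem_univ, true_and, Finset.mem_compl] at h
    simp [Finset.erase_insert h]
  · simp

/-- Contraction of the last letter of an antisymmetric tensor. -/
theorem altPair_snocOp (A : Module.End F (Word N m → B)) (J : Finset (Fin N)) :
    P.altPair J (snocOp A fun w => algebraMap F B (P.altTensor (m + 1) J w)) =
      ∑ a ∈ J, (P.q ^ 2) ^ (J.filter fun b => a < b).card •
        P.altPair (J.erase a) (A fun w => algebraMap F B (P.altTensor m (J.erase a) w)) := by
  rw [altPair_apply, sum_word_snoc, ← Finset.sum_subset (Finset.subset_univ J)]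
  · refine Finset.sum_congr rfl fun a ha => ?_
    simp only [snocOp_apply_snoc, altTensor_snoc, if_pos ha, map_mul, ← Algebra.smul_def]
    have h := map_smul A (∏ b ∈ J with a < b, -P.Q a b)
      (fun d => algebraMap F B (P.altTensor m (J.erase a) d))
    have h' : (∏ b ∈ J with a < b, -P.Q a b) •
        (fun d => algebraMap F B (P.altTensor m (J.erase a) d)) = fun d =>
        (∏ b ∈ J with a < b, -P.Q a b) • algebraMap F B (P.altTensor m (J.erase a) d) := rfl
    rw [← h', h, altPair_apply, Finset.smul_sum, ← star_prod_mul_prod]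
    refine Finset.sum_congr rfl fun w _ => ?_
    rw [Pi.smul_apply, smul_smul, smul_smul, star_mul']
    congr 1
    ring
  · intro a _ ha
    simp [altTensor_snoc, ha]

/-- An operator that does not involve the last letter may be traced in one degree less. -/
theorem altTrace_snocOp (A : Module.End F (Word N m → B)) :
    P.altTrace (snocOp A) = ((P.q ^ 2) ^ m * P.qNum (N - m)) • P.altTrace A := by
  rw [altTrace, altTrace, Finset.smul_sum]
  simp only [altPair_snocOp, Finset.smul_sum]
  have h1 := sum_sum_erase (α := Fin N) fun a J => (P.q ^ 2) ^ (∑ j ∈ insert a J, (j : ℕ)) •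
    (P.q ^ 2) ^ ((insert a J).filter fun b => a < b).card •
      P.altPair J (A fun w => algebraMap F B (P.altTensor m J w))
  refine Eq.trans (Finset.sum_congr rfl fun J _ => Finset.sum_congr rfl fun a ha => ?_)
    (h1.trans (Finset.sum_congr rfl fun J _ => ?_))
  · rw [Finset.insert_erase ha]
  · by_cases hJ : J.card = m
    · have h2 : ∀ a ∈ Jᶜ, (P.q ^ 2) ^ (∑ j ∈ insert a J, (j : ℕ)) *
          (P.q ^ 2) ^ ((insert a J).filter fun b => a < b).card =
          (P.q ^ 2) ^ (∑ j ∈ J, (j : ℕ)) * (P.q ^ 2) ^ m *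
            (P.q ^ 2) ^ (Jᶜ.filter fun b => b < a).card := by
        intro a ha
        have ha' := Finset.mem_compl.mp ha
        rw [← pow_add, ← pow_add, ← pow_add]
        congr 1
        have e1 : (J.filter fun b => b < a).card + (J.filter fun b => a < b).card = m := by
          rw [← hJ, ← Finset.card_filter_add_card_filter_not (s := J) fun b => b < a]
          congr 2
          refine Finset.filter_congr fun b hb => ?_
          have : b ≠ a := fun h => ha' (h ▸ hb)
          rw [not_lt]
          exact ⟨le_of_lt, fun h => lt_of_le_of_ne h this.symm⟩
        have e2 : (J.filter fun b => b < a).card + (Jᶜ.filter fun b => b < a).card = a := by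
          rw [← Finset.card_union_of_disjoint (Finset.disjoint_filter_filter disjoint_compl_right),
            ← Finset.filter_union, Finset.union_compl, Finset.filter_gt_eq_Iio, Fin.card_Iio]
        rw [Finset.sum_insert ha', Finset.filter_insert, if_neg (lt_irrefl a)]
        omega
      simp only [smul_smul]
      rw [← Finset.sum_smul, Finset.sum_congr rfl h2, ← Finset.mul_sum, sum_pow_card_lt,
        Finset.card_compl, hJ, Fintype.card_fin, qNum_eq]
      congr 1
      ring
    · have h0 : P.altPair J (A fun w => algebraMap F B (P.altTensor m J w)) = 0 := by
        rw [altPair_apply, P.altTensor_eq_zero hJ]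
        simp
      simp [h0]

end Expansion

/-! ### The power of `(X Y)₁ Rhat₁₂ ⋯` as an ordered product -/

section Monoid

variable {S : Type*} [Monoid S]

/-- The product `f 0 * f 1 * ⋯ * f (n - 1)`. -/
def prodUp (f : ℕ → S) : ℕ → S
  | 0 => 1
  | n + 1 => prodUp f n * f n

/-- The product `f (n - 1) * ⋯ * f 1 * f 0`. -/
def prodDown (f : ℕ → S) : ℕ → S
  | 0 => 1
  | n + 1 => f n * prodDown f n

theorem prodUp_succ (f : ℕ → S) (n : ℕ) : prodUp f (n + 1) = prodUp f n * f n := rfl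

theorem prodDown_succ (f : ℕ → S) (n : ℕ) : prodDown f (n + 1) = f n * prodDown f n := rfl

theorem prodUp_succ' (f : ℕ → S) (n : ℕ) :
    prodUp f (n + 1) = f 0 * prodUp (fun k => f (k + 1)) n := by
  induction n with
  | zero => simp [prodUp]
  | succ n ih => rw [prodUp_succ, ih, mul_assoc, prodUp_succ]

theorem prodUp_add (f : ℕ → S) (m n : ℕ) :
    prodUp f (m + n) = prodUp f m * prodUp (fun k => f (m + k)) n := by
  induction n with
  | zero => simp [prodUp]
  | succ n ih => rw [← add_assoc, prodUp_succ, ih, mul_assoc, prodUp_succ]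

theorem commute_prodUp {f : ℕ → S} {n : ℕ} {z : S} (h : ∀ k < n, Commute z (f k)) :
    Commute z (prodUp f n) := by
  induction n with
  | zero => exact Commute.one_right z
  | succ n ih =>
    exact (ih fun k hk => h k (hk.trans n.lt_succ_self)).mul_right (h n n.lt_succ_self)

theorem commute_prodDown {f : ℕ → S} {n : ℕ} {z : S} (h : ∀ k < n, Commute z (f k)) :
    Commute z (prodDown f n) := by
  induction n with
  | zero => exact Commute.one_right z
  | succ n ih =>
    exact (h n n.lt_succ_self).mul_right (ih fun k hk => h k (hk.trans n.lt_succ_self))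

variable {x y t : ℕ → S} {n : ℕ}

theorem commute_prodDown_of_lt
    (hty : ∀ j < n, ∀ k ≤ n, k ≠ j → k ≠ j + 1 → Commute (t j) (y k))
    (hyy : ∀ j < n, Commute (t j) (y (j + 1) * y j)) {j m : ℕ} (hj : j < m) (hm : m ≤ n) :
    Commute (t j) (prodDown y (m + 1)) := by
  induction m, hj using Nat.le_induction with
  | base =>
    rw [prodDown_succ, prodDown_succ, ← mul_assoc]
    refine (hyy j hm).mul_right (commute_prodDown fun k hk => ?_)
    exact hty j hm k (by omega) (by omega) (by omega)
  | succ m hjm ih =>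
    rw [prodDown_succ]
    exact (hty j (by omega) (m + 1) hm (by omega) (by omega)).mul_right (ih (by omega))

theorem mul_prodUp_mul_prodUp
    (htx : ∀ j < n, ∀ k ≤ n, k ≠ j → k ≠ j + 1 → Commute (t j) (x k))
    (hxy : ∀ j < n, x (j + 1) * t j * y (j + 1) = y j * t j * x j) {m : ℕ} (hm : m ≤ n) :
    y 0 * prodUp t m * prodUp x m = prodUp (fun k => x (k + 1)) m * prodUp t m * y m := by
  induction m with
  | zero => simp [prodUp]
  | succ m ih =>
    have h1 : Commute (t m) (prodUp x m) :=
      commute_prodUp fun k hk => htx m hm k (by omega) (by omega) (by omega)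
    have h2 : Commute (x (m + 1)) (prodUp t m) :=
      commute_prodUp fun k hk => (htx k (by omega) (m + 1) hm (by omega) (by omega)).symm
    calc y 0 * prodUp t (m + 1) * prodUp x (m + 1)
        = y 0 * prodUp t m * (t m * prodUp x m) * x m := by
          simp only [prodUp_succ, mul_assoc]
      _ = (y 0 * prodUp t m * prodUp x m) * (t m * x m) := by
          rw [h1.eq]; simp only [mul_assoc]
      _ = prodUp (fun k => x (k + 1)) m * prodUp t m * (y m * t m * x m) := by
          rw [ih (by omega)]; simp only [mul_assoc]
      _ = prodUp (fun k => x (k + 1)) m * (prodUp t m * x (m + 1)) * t m * y (m + 1) := by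
          rw [← hxy m hm]; simp only [mul_assoc]
      _ = _ := by rw [← h2.eq]; simp only [prodUp_succ, mul_assoc]

/-- Reordering a power: all `x` move to the left of all `y`, which in turn move to the left of
all braid generators. -/
theorem pow_eq_prodUp_mul_prodDown
    (htx : ∀ j < n, ∀ k ≤ n, k ≠ j → k ≠ j + 1 → Commute (t j) (x k))
    (hty : ∀ j < n, ∀ k ≤ n, k ≠ j → k ≠ j + 1 → Commute (t j) (y k))
    (hyy : ∀ j < n, Commute (t j) (y (j + 1) * y j))
    (hxy : ∀ j < n, x (j + 1) * t j * y (j + 1) = y j * t j * x j) {m : ℕ} (hm : m ≤ n + 1) :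
    (x 0 * y 0 * prodUp t n) ^ m = prodUp x m * prodDown y m * prodUp t n ^ m := by
  induction m with
  | zero => simp [prodUp, prodDown]
  | succ m ih =>
    obtain ⟨r, hr⟩ := Nat.exists_eq_add_of_le (Nat.le_of_succ_le_succ hm)
    have hsplit : prodUp t n = prodUp t m * prodUp (fun k => t (m + k)) r := by
      rw [hr, prodUp_add]
    have h1 : Commute (prodUp x m * prodDown y m) (prodUp (fun k => t (m + k)) r) := by
      refine commute_prodUp fun k hk => Commute.symm (Commute.mul_right ?_ ?_)
      · exact commute_prodUp fun l hl => htx _ (by omega) l (by omega) (by omega) (by omega)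
      · exact commute_prodDown fun l hl => hty _ (by omega) l (by omega) (by omega) (by omega)
    have h2 : Commute (prodDown y (m + 1)) (prodUp t m) :=
      commute_prodUp fun k hk => (commute_prodDown_of_lt hty hyy hk (by omega)).symm
    calc (x 0 * y 0 * prodUp t n) ^ (m + 1)
        = x 0 * y 0 * prodUp t m * (prodUp (fun k => t (m + k)) r *
            (prodUp x m * prodDown y m)) * prodUp t n ^ m := by
          rw [pow_succ', ih (by omega)]
          nth_rewrite 1 [hsplit]
          simp only [mul_assoc]
      _ = x 0 * (y 0 * prodUp t m * prodUp x m) * prodDown y m *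
            (prodUp (fun k => t (m + k)) r * prodUp t n ^ m) := by
          rw [← h1.eq]; simp only [mul_assoc]
      _ = (x 0 * prodUp (fun k => x (k + 1)) m) * (prodUp t m * prodDown y (m + 1)) *
            (prodUp (fun k => t (m + k)) r * prodUp t n ^ m) := by
          rw [mul_prodUp_mul_prodUp htx hxy (by omega), prodDown_succ]; simp only [mul_assoc]
      _ = prodUp x (m + 1) * prodDown y (m + 1) * (prodUp t n * prodUp t n ^ m) := by
          rw [← h2.eq, ← prodUp_succ', hsplit]; simp only [mul_assoc]
      _ = _ := by rw [← pow_succ']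

end Monoid

/-! ### The defining relations on arbitrary letters -/

section Letters

variable {N : ℕ} {F : Type*} [Field F] [StarRing F] (P : QParam N F) {m : ℕ}
  {B : Type*} [Ring B] [Algebra F B]

theorem commute_braid_leg (A : Matrix (Fin N) (Fin N) B) (j : Fin m) (k : Fin (m + 1))
    (h1 : k ≠ j.castSucc) (h2 : k ≠ j.succ) :
    Commute (P.braid (M := B) j) (leg A k) := by
  refine LinearMap.ext fun f => funext fun w => ?_
  have hs : ∀ e, Function.update (w ∘ Equiv.swap j.castSucc j.succ) k e =
      Function.update w k e ∘ Equiv.swap j.castSucc j.succ := by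
    intro e
    have := Function.update_comp_equiv w (Equiv.swap j.castSucc j.succ) k e
    rw [Equiv.symm_swap, Equiv.swap_apply_of_ne_of_ne h1 h2] at this
    exact this.symm
  simp only [Module.End.mul_apply, braid_apply, leg_apply, Function.comp_apply,
    Equiv.swap_apply_of_ne_of_ne h1 h2, hs, Function.update_of_ne h1.symm,
    Function.update_of_ne h2.symm]
  split_ifs <;> simp [mul_add, Finset.sum_add_distrib, Finset.smul_sum]

theorem commute_braid_leg_Y_mul_leg_Y (k : Fin m) :
    Commute (P.braid k) (leg P.Y k.succ * leg P.Y k.castSucc) := by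
  induction m with
  | zero => exact k.elim0
  | succ m ih =>
    refine Fin.cases ?_ (fun k => ?_) k
    · exact P.braid_zero_mul_leg_Y
    · have h := congrArg consOp (ih k).eq
      simp only [consOp_mul, consOp_leg, consOp_braid] at h
      exact h

theorem leg_X_mul_braid_mul_leg_Y (k : Fin m) :
    leg P.X k.succ * P.braid k * leg P.Y k.succ =
      leg P.Y k.castSucc * P.braid k * leg P.X k.castSucc := by
  induction m with
  | zero => exact k.elim0
  | succ m ih =>
    refine Fin.cases ?_ (fun k => ?_) k
    · exact P.leg_X_mul_braid_zero_mul_leg_Y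
    · have h := congrArg consOp (ih k)
      simp only [consOp_mul, consOp_leg, consOp_braid] at h
      exact h

/-- `leg` with a natural number as position; it is `1` beyond the length of the words. -/
def legNat (A : Matrix (Fin N) (Fin N) B) (k : ℕ) : Module.End F (Word N m → B) :=
  if h : k < m then leg A ⟨k, h⟩ else 1

/-- `braid` with a natural number as position; it is `1` beyond the length of the words. -/
def braidNat (M : Type*) [AddCommGroup M] [Module F M] (k : ℕ) :
    Module.End F (Word N (m + 1) → M) :=
  if h : k < m then P.braid ⟨k, h⟩ else 1

omit [StarRing F] in
theorem legNat_of_lt (A : Matrix (Fin N) (Fin N) B) {k : ℕ} (h : k < m) :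
    legNat (F := F) (m := m) A k = leg A ⟨k, h⟩ := dif_pos h

theorem braidNat_of_lt {M : Type*} [AddCommGroup M] [Module F M] {k : ℕ} (h : k < m) :
    P.braidNat (m := m) M k = P.braid ⟨k, h⟩ := dif_pos h

theorem pow_legNat_mul_prodUp {n k : ℕ} (hn : n ≤ m) (hk : k ≤ n + 1) :
    (legNat (F := F) (m := m + 1) P.X 0 * legNat P.Y 0 * prodUp (P.braidNat P.OqR) n) ^ k =
      prodUp (legNat P.X) k * prodDown (legNat P.Y) k * prodUp (P.braidNat P.OqR) n ^ k := by
  have hc : ∀ (A : Matrix (Fin N) (Fin N) P.OqR), ∀ j < n, ∀ k ≤ n, k ≠ j → k ≠ j + 1 →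
      Commute (P.braidNat (m := m) P.OqR j) (legNat (F := F) (m := m + 1) A k) := by
    intro A j hj k hk h1 h2
    rw [P.braidNat_of_lt (by omega : j < m), legNat_of_lt A (by omega : k < m + 1)]
    exact P.commute_braid_leg A _ _ (fun h => h1 (congrArg Fin.val h))
      fun h => h2 (congrArg Fin.val h)
  refine pow_eq_prodUp_mul_prodDown (hc P.X) (hc P.Y) (fun j hj => ?_) (fun j hj => ?_) hk
  · rw [P.braidNat_of_lt (by omega : j < m), legNat_of_lt _ (by omega : j + 1 < m + 1),
      legNat_of_lt _ (by omega : j < m + 1)]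
    exact P.commute_braid_leg_Y_mul_leg_Y ⟨j, _⟩
  · rw [P.braidNat_of_lt (by omega : j < m), legNat_of_lt _ (by omega : j + 1 < m + 1),
      legNat_of_lt _ (by omega : j + 1 < m + 1),
      legNat_of_lt _ (by omega : j < m + 1), legNat_of_lt _ (by omega : j < m + 1)]
    exact P.leg_X_mul_braid_mul_leg_Y ⟨j, _⟩

omit [StarRing F] in
theorem snocOp_legNat (A : Matrix (Fin N) (Fin N) B) {k : ℕ} (h : k < m) :
    snocOp (legNat (F := F) (m := m) A k) = legNat A k := by
  rw [legNat_of_lt A h, legNat_of_lt A (h.trans m.lt_succ_self), snocOp_leg]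
  rfl

omit [StarRing F] in
theorem snocOp_prodUp_legNat (A : Matrix (Fin N) (Fin N) B) {k : ℕ} (h : k ≤ m) :
    snocOp (prodUp (legNat (F := F) (m := m) A) k) = prodUp (legNat A) k := by
  induction k with
  | zero => exact snocOp_one
  | succ k ih => rw [prodUp_succ, snocOp_mul, ih (by omega), snocOp_legNat A h, prodUp_succ]

omit [StarRing F] in
theorem snocOp_prodDown_legNat (A : Matrix (Fin N) (Fin N) B) {k : ℕ} (h : k ≤ m) :
    snocOp (prodDown (legNat (F := F) (m := m) A) k) = prodDown (legNat A) k := by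
  induction k with
  | zero => exact snocOp_one
  | succ k ih => rw [prodDown_succ, snocOp_mul, ih (by omega), snocOp_legNat A h, prodDown_succ]

theorem prodUp_legNat_self (m : ℕ) : prodUp (legNat (F := F) P.X) m = P.prodX m := by
  induction m with
  | zero => rfl
  | succ m ih =>
    rw [prodUp_succ, ← snocOp_prodUp_legNat P.X le_rfl, ih, prodX_succ,
      legNat_of_lt _ m.lt_succ_self]
    rfl

theorem prodDown_legNat_self (m : ℕ) : prodDown (legNat (F := F) P.Y) m = P.prodY m := by
  induction m with
  | zero => rfl
  | succ m ih =>
    rw [prodDown_succ, ← snocOp_prodDown_legNat P.Y le_rfl, ih, prodY_succ,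
      legNat_of_lt _ m.lt_succ_self]
    rfl

theorem isAlt_algebraMap (J : Finset (Fin N)) :
    P.IsAlt fun w => algebraMap F B (P.altTensor (m + 1) J w) := by
  simp only [Algebra.algebraMap_eq_smul_one]
  exact P.isAlt_altTensor_smul J 1

variable {P} in
theorem IsAlt.prodUp_braidNat {M : Type*} [AddCommGroup M] [Module F M]
    {f : Word N (m + 1) → M} (hf : P.IsAlt f) {n : ℕ} (hn : n ≤ m) (k : ℕ) :
    (prodUp (P.braidNat M) n ^ k) f = ((-P.q ^ 2) ^ n) ^ k • f := by
  have h : ∀ n ≤ m, prodUp (P.braidNat M) n f = (-P.q ^ 2) ^ n • f := by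
    intro n hn
    induction n with
    | zero => simp [prodUp]
    | succ n ih =>
      rw [prodUp_succ, Module.End.mul_apply, P.braidNat_of_lt (by omega : n < m), hf, map_smul,
        ih (by omega), smul_smul, ← pow_succ']
  induction k with
  | zero => simp
  | succ k ih => rw [pow_succ, Module.End.mul_apply, h n hn, map_smul, ih, smul_smul, ← pow_succ']

/-- The sum `0 + 1 + ⋯ + (n - 1)` is the exponent that collects the weights of `altTrace`. -/
theorem altTrace_prodUp_mul_prodDown {i n : ℕ} (hin : i ≤ n) (hn : n ≤ N) :
    ((P.q ^ 2) ^ (∑ k ∈ Finset.range i, k) * P.qFact (N - n)) •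
        P.altTrace (prodUp (legNat (F := F) (m := n) P.X) i * prodDown (legNat P.Y) i) =
      ((P.q ^ 2) ^ (∑ k ∈ Finset.range n, k) * P.qFact (N - i)) •
        P.altTrace (P.prodX i * P.prodY i) := by
  induction n, hin using Nat.le_induction with
  | base => rw [prodUp_legNat_self, prodDown_legNat_self]
  | succ n hin ih =>
    rw [← snocOp_prodUp_legNat P.X hin, ← snocOp_prodDown_legNat P.Y hin, ← snocOp_mul,
      altTrace_snocOp, smul_smul]
    have h1 : N - n = N - (n + 1) + 1 := by omega
    have h2 := congrArg (((P.q ^ 2) ^ n) • ·) (ih (by omega))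
    simp only [smul_smul] at h2
    rw [h1, qFact_succ] at h2
    rw [h1, Finset.sum_range_succ _ n, pow_add]
    convert h2 using 2 <;> ring

end Letters

/-! ### The coefficients as traces over antisymmetric tensors -/

section Sigma

variable {N : ℕ} {F : Type*} [Field F] {B : Type*} [Ring B] [Algebra F B]

/-- A matrix with rows and columns indexed by words, as an operator. -/
def matOp (F : Type*) [Field F] [Algebra F B] :
    Matrix (Fin N → Fin N) (Fin N → Fin N) B →* Module.End F (Word N N → B) where
  toFun A :=
    { toFun := A.mulVec
      map_add' := A.mulVec_add
      map_smul' := fun r f => A.mulVec_smul r f }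
  map_one' := LinearMap.ext Matrix.one_mulVec
  map_mul' A A' := LinearMap.ext fun f => (Matrix.mulVec_mulVec f A A').symm

theorem matOp_legAt (k : Fin N) (A : Matrix (Fin N) (Fin N) B) :
    matOp F (legAt k A) = leg A k := by
  refine LinearMap.ext fun f => funext fun a => ?_
  change ∑ b, (if ∀ l, l ≠ k → a l = b l then A (a k) (b k) else 0) * f b = _
  simp only [ite_mul, zero_mul]
  rw [← Finset.sum_filter, leg_apply]
  refine Finset.sum_nbij' (fun b => b k) (fun e => Function.update a k e) (by simp) ?_ ?_
    (by simp) ?_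
  · intro e _
    simp +contextual
  · intro b hb
    rw [Finset.mem_filter] at hb
    ext l : 1
    by_cases h : l = k
    · subst h; simp
    · rw [Function.update_of_ne h, hb.2 l h]
  · intro b hb
    rw [Finset.mem_filter] at hb
    have : Function.update a k (b k) = b := by
      ext l : 1
      by_cases h : l = k
      · subst h; simp
      · rw [Function.update_of_ne h, hb.2 l h]
    simp only [this]

theorem matOp_legsAt_apply {k l : Fin N} (hkl : k ≠ l)
    (A : Matrix (Fin N × Fin N) (Fin N × Fin N) B) (f : Word N N → B) (a : Word N N) :
    matOp F (legsAt k l A) f a = ∑ c, ∑ d, A (a k, a l) (c, d) *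
      f (Function.update (Function.update a k c) l d) := by
  change ∑ b, (if ∀ m, m ≠ k → m ≠ l → a m = b m then A (a k, a l) (b k, b l) else 0) * f b = _
  have hb' : ∀ b : Word N N, (∀ m, m ≠ k → m ≠ l → a m = b m) →
      Function.update (Function.update a k (b k)) l (b l) = b := by
    intro b hb
    ext m : 1
    by_cases h : m = l
    · subst h; simp
    · rw [Function.update_of_ne h]
      by_cases h' : m = k
      · subst h'; simp
      · rw [Function.update_of_ne h', hb m h' h]
  simp only [ite_mul, zero_mul]
  rw [← Finset.sum_filter, ← Fintype.sum_prod_type' (f := fun c d => A (a k, a l) (c, d) *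
      f (Function.update (Function.update a k c) l d))]
  refine Finset.sum_nbij' (fun b => (b k, b l))
    (fun e => Function.update (Function.update a k e.1) l e.2) (by simp) ?_ ?_ ?_ ?_
  · intro e _
    simp +contextual
  · intro b hb
    exact hb' b (Finset.mem_filter.mp hb).2
  · rintro ⟨c, d⟩ _
    simp [Function.update_of_ne hkl]
  · intro b hb
    simp only [hb' b (Finset.mem_filter.mp hb).2]

theorem flip_apply (a b c d : Fin N) :
    flip N F (a, b) (c, d) = if a = d ∧ b = c then 1 else 0 := by
  simp only [flip, Matrix.sum_apply, Matrix.kroneckerMap_apply, Matrix.single_apply]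
  rw [Finset.sum_eq_single a, Finset.sum_eq_single b]
  · by_cases h : a = d <;> by_cases h' : b = c <;> simp [h, h']
  · intro y _ hy; simp [hy]
  · simp
  · intro x _ hx; simp [hx]
  · simp

variable [StarRing F] (P : QParam N F)

theorem Rhat_apply (a b c d : Fin N) : P.Rhat (a, b) (c, d) =
    (if c = b ∧ d = a then P.Q b a else 0) +
      (if c = a ∧ d = b ∧ b < a then 1 - P.q ^ 2 else 0) := by
  rw [Rhat, Matrix.mul_apply, Finset.sum_eq_single (b, a)]
  · rw [flip_apply, R_apply]
    simp only [and_self, if_true, one_mul]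
    congr 1
    · simp only [eq_comm]
    · refine if_congr ?_ rfl rfl
      constructor
      · rintro ⟨h1, h2, h3⟩; exact ⟨h2.symm, h1.symm, h3⟩
      · rintro ⟨h1, h2, h3⟩; exact ⟨h2.symm, h1.symm, h3⟩
  · rintro ⟨x, y⟩ _ h
    rw [flip_apply, if_neg, zero_mul]
    rintro ⟨rfl, rfl⟩
    exact h rfl
  · simp

/-- The index of the basis is always a word of the same length as the size of the matrices, so a
generator on the letters `k` and `k + 1` needs a size of the form `m + 1`. -/
theorem matOp_RhatAt {m : ℕ} (P : QParam (m + 1) F) (k : Fin m) :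
    matOp F (P.RhatAt k.castSucc k.succ) = P.braid k := by
  refine LinearMap.ext fun f => funext fun a => ?_
  have hne : k.castSucc ≠ k.succ := Fin.castSucc_lt_succ.ne
  have h1 : Function.update (Function.update a k.castSucc (a k.succ)) k.succ (a k.castSucc) =
      a ∘ Equiv.swap k.castSucc k.succ := by
    rw [Equiv.comp_swap_eq_update, Function.update_comm hne]
  have h2 : Function.update (Function.update a k.castSucc (a k.castSucc)) k.succ (a k.succ) =
      a := by simp
  rw [RhatAt, matOp_legsAt_apply hne, braid_apply]
  simp only [Matrix.map_apply, Rhat_apply, map_add, add_mul, Finset.sum_add_distrib,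
    apply_ite (algebraMap F P.OqR), map_zero, ite_mul, zero_mul, ite_and,
    Finset.sum_ite_irrel, Finset.sum_const_zero, Finset.sum_ite_eq', Finset.mem_univ, if_true,
    h1, h2, Algebra.smul_def]

theorem matOp_sigmaMat {m : ℕ} (P : QParam (m + 1) F) (n : ℕ) (hn : n < m + 1) :
    matOp F (P.sigmaMat n hn) =
      legNat P.X 0 * legNat P.Y 0 * prodUp (P.braidNat P.OqR) n := by
  have hl : leg (F := F) (m := m + 1) (P.X * P.Y) 0 = leg P.X 0 * leg P.Y 0 := by
    refine end_ext_cons fun f a w => ?_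
    simp only [Module.End.mul_apply, leg_zero_apply, Matrix.mul_apply, Finset.sum_mul,
      Finset.mul_sum, mul_assoc]
    rw [Finset.sum_comm]
  have hp : ∀ n (hn : n < m + 1), (List.ofFn fun k : Fin n => matOp F
      (P.RhatAt ⟨(k : ℕ), k.2.trans hn⟩ ⟨(k : ℕ) + 1, (Nat.succ_le_of_lt k.2).trans_lt hn⟩)).prod =
      prodUp (P.braidNat P.OqR) n := by
    intro n hn
    induction n with
    | zero => rfl
    | succ n ih =>
      rw [List.ofFn_succ', List.prod_concat, prodUp_succ, P.braidNat_of_lt (by omega : n < m),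
        ← ih (by omega)]
      congr 1
      exact matOp_RhatAt P ⟨n, by omega⟩
  rw [sigmaMat, map_mul, matOp_legAt, map_list_prod, List.map_ofFn, legNat_of_lt _ m.succ_pos,
    legNat_of_lt _ m.succ_pos]
  exact congrArg₂ _ hl (hp n hn)

theorem leviCivita_eq : P.leviCivita = P.altTensor N Finset.univ := by
  ext a
  rw [leviCivita, Finset.sum_apply, altTensor]
  by_cases ha : Function.Injective a
  · have hb : Function.Bijective a := Finite.injective_iff_bijective.mp ha
    rw [if_pos ⟨ha, Finset.image_univ_of_surjective hb.2⟩,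
      Finset.sum_eq_single (Equiv.ofBijective a hb)]
    · simp
    · intro s _ hs
      refine Pi.single_eq_of_ne (fun h => hs ?_) _
      ext x
      simp [h]
    · simp
  · rw [if_neg fun h => ha h.1]
    refine Finset.sum_eq_zero fun s _ => Pi.single_eq_of_ne (fun h => ha ?_) _
    rw [h]
    exact s.injective

theorem altTrace_eq_altPair_univ (A : Module.End F (Word N N → B)) :
    P.altTrace A = (P.q ^ 2) ^ (∑ k ∈ Finset.range N, k) •
      P.altPair Finset.univ (A fun w => algebraMap F B (P.altTensor N Finset.univ w)) := by
  rw [altTrace, Finset.sum_eq_single Finset.univ, Fin.sum_univ_eq_sum_range (fun k => k)]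
  · intro J _ hJ
    have hJ' : J.card ≠ N := fun h => hJ (by
      rw [← Finset.card_eq_iff_eq_univ, h, Fintype.card_fin])
    rw [altPair_apply, P.altTensor_eq_zero hJ']
    simp
  · simp

theorem qFact_ne_zero (hq : ∀ n, 1 ≤ n → n ≤ N → P.qNum n ≠ 0) {n : ℕ} (hn : n ≤ N) :
    P.qFact n ≠ 0 :=
  Finset.prod_ne_zero_iff.mpr fun k hk => hq _ (by omega) (by
    have := Finset.mem_range.mp hk
    omega)

/-- The coefficient `σ(i)` is the weighted trace of `X₁ ⋯ X_i Y_i ⋯ Y₁` over the antisymmetric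
tensors of degree `i`. -/
theorem qFact_smul_sigma {m n : ℕ} (P : QParam (m + 1) F)
    (hq : ∀ n, 1 ≤ n → n ≤ m + 1 → P.qNum n ≠ 0) (hn : n + 1 ≤ m + 1) :
    P.qFact (n + 1) • P.sigma (n + 1) hn = P.altTrace (P.prodX (n + 1) * P.prodY (n + 1)) := by
  have hu : star P.leviCivita ⬝ᵥ P.leviCivita = P.qFact (m + 1) := by
    rw [leviCivita_eq, ← P.sum_star_altTensor_mul Finset.univ (Finset.card_fin _)]
    rfl
  set v : Word (m + 1) (m + 1) → P.OqR :=
    fun w => algebraMap F P.OqR (P.altTensor (m + 1) Finset.univ w) with hv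
  set A : Module.End F (Word (m + 1) (m + 1) → P.OqR) :=
    prodUp (legNat P.X) (n + 1) * prodDown (legNat P.Y) (n + 1) with hA
  have hpair : (fun a => algebraMap F P.OqR (star P.leviCivita a)) ⬝ᵥ
      (P.sigmaMat n hn ^ (n + 1)).mulVec (fun a => algebraMap F P.OqR (P.leviCivita a)) =
      ((P.q ^ 2) ^ (n * (n + 1))) • P.altPair Finset.univ
        (A v) := by
    have h1 : (P.sigmaMat n hn ^ (n + 1)).mulVec (fun a => algebraMap F P.OqR (P.leviCivita a)) =
        ((-P.q ^ 2) ^ n) ^ (n + 1) •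
          A v := by
      rw [leviCivita_eq]
      change matOp F (P.sigmaMat n hn ^ (n + 1)) v = _
      rw [map_pow, matOp_sigmaMat, P.pow_legNat_mul_prodUp (by omega) le_rfl,
        Module.End.mul_apply,
        (P.isAlt_algebraMap Finset.univ).prodUp_braidNat (by omega), map_smul]
    have h2 : ((-P.q ^ 2) ^ n) ^ (n + 1) = (P.q ^ 2) ^ (n * (n + 1)) := by
      rw [← pow_mul, (Nat.even_mul_succ_self n).neg_pow]
    rw [h1, h2, leviCivita_eq, ← map_smul (P.altPair Finset.univ), altPair_apply]
    exact Finset.sum_congr rfl fun w _ => (Algebra.smul_def _ _).symm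
  have hsum : (P.q ^ 2) ^ (∑ k ∈ Finset.range (n + 1), k) = P.q ^ (n * (n + 1)) := by
    rw [← pow_mul, mul_comm 2, Finset.sum_range_id_mul_two, Nat.add_sub_cancel, mul_comm]
  have htr := P.altTrace_prodUp_mul_prodDown hn le_rfl
  rw [altTrace_eq_altPair_univ, smul_smul, hsum, Nat.sub_self] at htr
  have hq0 := pow_ne_zero (∑ k ∈ Finset.range (m + 1), k) (pow_ne_zero 2 P.q_ne_zero)
  have htr' : P.q ^ (n * (n + 1)) • P.altPair Finset.univ
        (A v) =
      P.qFact (m + 1 - (n + 1)) • P.altTrace (P.prodX (n + 1) * P.prodY (n + 1)) := by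
    apply (smul_right_injective _ hq0).eq_iff.mp
    simp only [smul_smul]
    rw [← htr, qFact, Finset.range_zero, Finset.prod_empty, mul_one, mul_comm]
  rw [sigma, hpair, alpha, hu, qBinom, ← Algebra.smul_def, smul_smul,
    smul_smul]
  have h1 := P.qFact_ne_zero hq le_rfl
  have h2 := P.qFact_ne_zero hq hn
  have h3 := P.qFact_ne_zero hq (Nat.sub_le (m + 1) (n + 1))
  have hq1 := pow_ne_zero (n * (n + 1)) P.q_ne_zero
  have hc : P.qFact (n + 1) * ((P.q ^ (n * (n + 1)))⁻¹ * ((P.qFact (m + 1))⁻¹ *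
      (P.qFact (m + 1) / (P.qFact (n + 1) * P.qFact (m + 1 - (n + 1)))))) *
      (P.q ^ 2) ^ (n * (n + 1)) =
      (P.qFact (m + 1 - (n + 1)))⁻¹ * P.q ^ (n * (n + 1)) := by
    rw [← pow_mul, mul_comm 2, pow_mul _ _ 2, pow_two]
    field_simp
  rw [hc, mul_smul, htr', smul_smul, inv_mul_cancel₀ h3, one_smul]

end Sigma

/-! ### Quantum minors as coefficients on antisymmetric tensors -/

section Minors

variable {N : ℕ} {F : Type*} [Field F] [StarRing F] (P : QParam N F) {m : ℕ}

theorem prodX_apply (f : Word N m → P.OqR) (w : Word N m) :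
    P.prodX m f w = ∑ e : Word N m, (List.ofFn fun n => P.X (w n) (e n)).prod * f e := by
  induction m with
  | zero =>
    rw [Fintype.sum_unique, List.ofFn_zero, List.prod_nil, one_mul]
    exact congrArg f (Subsingleton.elim _ _)
  | succ m ih =>
    rw [prodX_succ_eq_cons, ← Fin.cons_self_tail w, Module.End.mul_apply, leg_zero_apply,
      sum_word_cons]
    refine Finset.sum_congr rfl fun e _ => ?_
    rw [consOp_apply_cons, ih, Finset.mul_sum]
    refine Finset.sum_congr rfl fun d _ => ?_
    simp only [List.ofFn_succ, List.prod_cons, Fin.cons_zero, Fin.cons_succ, mul_assoc]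

theorem prodY_apply (f : Word N m → P.OqR) (w : Word N m) :
    P.prodY m f w =
      ∑ e : Word N m, (List.ofFn fun n : Fin m => P.Y (w n.rev) (e n.rev)).prod * f e := by
  induction m with
  | zero =>
    rw [Fintype.sum_unique, List.ofFn_zero, List.prod_nil, one_mul]
    exact congrArg f (Subsingleton.elim _ _)
  | succ m ih =>
    rw [prodY_succ, ← Fin.snoc_init_self w, Module.End.mul_apply, leg_last_apply,
      sum_word_snoc]
    refine Finset.sum_congr rfl fun e _ => ?_
    rw [snocOp_apply_snoc, ih, Finset.mul_sum]
    refine Finset.sum_congr rfl fun d _ => ?_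
    simp only [List.ofFn_succ, List.prod_cons, Fin.rev_zero, Fin.rev_succ, Fin.snoc_last,
      Fin.snoc_castSucc, mul_assoc]

theorem prodX_mul_right (f : Word N m → P.OqR) (y : P.OqR) :
    P.prodX m (fun w => f w * y) = fun w => P.prodX m f w * y := by
  ext w
  simp only [prodX_apply, Finset.sum_mul, mul_assoc]

theorem prodY_mul_right (f : Word N m → P.OqR) (y : P.OqR) :
    P.prodY m (fun w => f w * y) = fun w => P.prodY m f w * y := by
  ext w
  simp only [prodY_apply, Finset.sum_mul, mul_assoc]

theorem star_prod_ofFn {S : Type*} [Monoid S] [StarMul S] (f : Fin m → S) :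
    star (List.ofFn f).prod = (List.ofFn fun n : Fin m => star (f n.rev)).prod := by
  induction m with
  | zero => simp
  | succ m ih =>
    rw [List.ofFn_succ, List.prod_cons, star_mul, ih, List.ofFn_succ', List.prod_concat]
    simp only [Fin.rev_last, Fin.rev_castSucc]

/-- Matrix coefficients of `X₁ ⋯ X_m` and of `Y_m ⋯ Y₁` are exchanged by the involution. -/
theorem star_altPair_prodX (J K : Finset (Fin N)) :
    star (P.altPair J (P.prodX m fun w => algebraMap F P.OqR (P.altTensor m K w))) =
      P.altPair K (P.prodY m fun w => algebraMap F P.OqR (P.altTensor m J w)) := by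
  simp only [altPair_apply, prodX_apply, prodY_apply, Finset.smul_sum, star_sum]
  rw [Finset.sum_comm]
  refine Finset.sum_congr rfl fun w _ => Finset.sum_congr rfl fun e _ => ?_
  rw [Algebra.smul_def, Algebra.smul_def, star_mul, star_mul, star_algebraMap, star_algebraMap,
    star_star, star_prod_ofFn, mul_assoc]
  simp only [star_X]

/-- Sums against `altTensor` are sums over the permutations of the set. -/
theorem sum_altTensor_smul {M : Type*} [AddCommGroup M] [Module F M] (K : Sub N m)
    (G : Word N m → M) :
    ∑ w, P.altTensor m K.1 w • G w =
      ∑ s : Equiv.Perm (Fin m), P.negQCol (fun n => K.enum (s n)) • G fun n => K.enum (s n) := by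
  refine (Fintype.sum_of_injective (fun (s : Equiv.Perm (Fin m)) n => K.enum (s n))
    (fun s t h => Equiv.ext fun n => K.enum_strictMono.injective (congrFun h n)) _ _
    (fun w hw => ?_) fun s => ?_).symm
  · rw [altTensor, if_neg, zero_smul]
    rintro ⟨h1, h2⟩
    have h3 : ∀ n, ∃ k, K.enum k = w n := by
      intro n
      have : w n ∈ Finset.univ.image K.enum := by
        rw [K.image_enum, ← h2]
        exact Finset.mem_image_of_mem w (Finset.mem_univ n)
      simpa using this
    choose s hs using h3
    have hinj : Function.Injective s := fun a b h => h1 (by rw [← hs, ← hs, h])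
    exact hw ⟨Equiv.ofBijective s (Finite.injective_iff_bijective.mp hinj), funext hs⟩
  · rw [altTensor, if_pos]
    refine ⟨K.enum_strictMono.injective.comp s.injective, ?_⟩
    have h : (fun n => K.enum (s n)) = K.enum ∘ s := rfl
    rw [h, ← Finset.image_image, Finset.image_univ_equiv, K.image_enum]

theorem minorX_eq_prodX (J K : Sub N m) :
    P.minorX P.X J K =
      P.prodX m (fun w => algebraMap F P.OqR (P.altTensor m K.1 w)) J.enum := by
  rw [prodX_apply, minorX]
  simp only [← Algebra.commutes, ← Algebra.smul_def]
  exact (P.sum_altTensor_smul K fun e => (List.ofFn fun n => P.X (J.enum n) (e n)).prod).symm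

theorem isAlt_prodX {f : Word N (m + 1) → P.OqR} (hf : P.IsAlt f) :
    P.IsAlt (P.prodX (m + 1) f) :=
  hf.map fun k f => LinearMap.congr_fun (P.braid_mul_prodX k) f

theorem isAlt_prodY {f : Word N (m + 1) → P.OqR} (hf : P.IsAlt f) :
    P.IsAlt (P.prodY (m + 1) f) :=
  hf.map fun k f => LinearMap.congr_fun (P.braid_mul_prodY k) f

theorem star_qNum (n : ℕ) : star (P.qNum n) = P.qNum n := by
  simp [qNum, P.star_q]

theorem star_qFact (n : ℕ) : star (P.qFact n) = P.qFact n := by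
  simp [qFact, star_qNum]

theorem star_smul_OqR (r : F) (x : P.OqR) : star (r • x) = star r • star x := by
  rw [Algebra.smul_def, star_mul, star_algebraMap, ← Algebra.commutes, ← Algebra.smul_def]

theorem altPair_prodX (h2 : 1 + P.q ^ 2 ≠ 0) (J K : Sub N (m + 1)) :
    P.altPair J.1 (P.prodX (m + 1) fun w => algebraMap F P.OqR (P.altTensor (m + 1) K.1 w)) =
      P.qFact (m + 1) • P.minorX P.X J K := by
  rw [(P.isAlt_prodX (P.isAlt_algebraMap K.1)).altPair_eq h2 J, minorX_eq_prodX]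

/-- The row expansion of a quantum minor agrees with its column expansion. -/
theorem prodY_altTensor_enum (h2 : 1 + P.q ^ 2 ≠ 0) (hm : P.qFact (m + 1) ≠ 0)
    (J K : Sub N (m + 1)) :
    P.prodY (m + 1) (fun w => algebraMap F P.OqR (P.altTensor (m + 1) J.1 w)) K.enum =
      star (P.minorX P.X J K) := by
  apply (smul_right_injective _ hm).eq_iff.mp
  rw [← (P.isAlt_prodY (P.isAlt_algebraMap J.1)).altPair_eq h2 K, ← star_altPair_prodX,
    P.altPair_prodX h2, star_smul_OqR, star_qFact]

/-- The operator `Y_m ⋯ Y₁` acts on antisymmetric tensors through the starred minors of `X`. -/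
theorem prodY_altTensor (h2 : 1 + P.q ^ 2 ≠ 0) (hm : P.qFact (m + 1) ≠ 0) (J : Sub N (m + 1)) :
    P.prodY (m + 1) (fun w => algebraMap F P.OqR (P.altTensor (m + 1) J.1 w)) =
      ∑ K : Sub N (m + 1), fun w => algebraMap F P.OqR (P.altTensor (m + 1) K.1 w) *
        star (P.minorX P.X J K) := by
  ext w
  rw [(P.isAlt_prodY (P.isAlt_algebraMap J.1)).eq_sum h2 w, Finset.sum_apply]
  refine Finset.sum_congr rfl fun K _ => ?_
  rw [P.prodY_altTensor_enum h2 hm, Algebra.smul_def]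

theorem altPair_prodX_prodY (h2 : 1 + P.q ^ 2 ≠ 0) (hm : P.qFact (m + 1) ≠ 0)
    (J : Sub N (m + 1)) :
    P.altPair J.1 (P.prodX (m + 1) (P.prodY (m + 1)
        fun w => algebraMap F P.OqR (P.altTensor (m + 1) J.1 w))) =
      P.qFact (m + 1) • ∑ K : Sub N (m + 1), P.minorX P.X J K * star (P.minorX P.X J K) := by
  rw [P.prodY_altTensor h2 hm, map_sum, map_sum, Finset.smul_sum]
  refine Finset.sum_congr rfl fun K _ => ?_
  rw [prodX_mul_right, ← smul_mul_assoc, ← P.altPair_prodX h2, altPair_apply, altPair_apply,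
    Finset.sum_mul]
  simp only [smul_mul_assoc]

theorem altTrace_eq_sum_sub {B : Type*} [Ring B] [Algebra F B]
    (A : Module.End F (Word N m → B)) :
    P.altTrace A = ∑ J : Sub N m, (P.q ^ 2) ^ (∑ j ∈ J.1, (j : ℕ)) •
      P.altPair J.1 (A fun w => algebraMap F B (P.altTensor m J.1 w)) := by
  rw [altTrace, ← Finset.sum_subtype (Finset.univ.filter fun J : Finset (Fin N) => J.card = m)
    (fun J => by simp) fun J => (P.q ^ 2) ^ (∑ j ∈ J, (j : ℕ)) •
      P.altPair J (A fun w => algebraMap F B (P.altTensor m J w))]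
  refine (Finset.sum_filter_of_ne fun J _ h => ?_).symm
  by_contra hJ
  apply h
  rw [altPair_apply, P.altTensor_eq_zero hJ]
  simp

/-! ### Minors of diagonal multiples of the generating matrices -/

omit [StarRing F] in
theorem prod_ofFn_smul {B : Type*} [Ring B] [Algebra F B] (c : Fin m → F) (f : Fin m → B) :
    (List.ofFn fun n => c n • f n).prod = (∏ n, c n) • (List.ofFn f).prod := by
  induction m with
  | zero => simp
  | succ m ih =>
    rw [List.ofFn_succ, List.prod_cons, ih, List.ofFn_succ, List.prod_cons, Fin.prod_univ_succ,
      smul_mul_smul_comm]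

theorem prod_enum {R : Type*} [CommMonoid R] (J : Sub N m) (c : Fin N → R) :
    ∏ n, c (J.enum n) = ∏ j ∈ J.1, c j := by
  rw [← J.image_enum, Finset.prod_image J.enum_strictMono.injective.injOn]

theorem conjTranspose_Y : P.Y.conjTranspose = P.X := by
  ext i j
  rw [Matrix.conjTranspose_apply, star_Y]

theorem minorX_smul_left {A : Matrix (Fin N) (Fin N) P.OqR} (c : Fin N → F)
    (hA : ∀ a b, A a b = c a • P.X a b) (J K : Sub N m) :
    P.minorX A J K = (∏ j ∈ J.1, c j) • P.minorX P.X J K := by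
  rw [minorX, minorX, Finset.smul_sum]
  refine Finset.sum_congr rfl fun s _ => ?_
  simp only [hA]
  rw [prod_ofFn_smul (fun n => c (J.enum n)), prod_enum, mul_smul_comm]

theorem minorX_smul_right {A : Matrix (Fin N) (Fin N) P.OqR} (c : Fin N → F)
    (hA : ∀ a b, A a b = c b • P.X a b) (J K : Sub N m) :
    P.minorX A J K = (∏ k ∈ K.1, c k) • P.minorX P.X J K := by
  rw [minorX, minorX, Finset.smul_sum]
  refine Finset.sum_congr rfl fun s _ => ?_
  simp only [hA]
  rw [prod_ofFn_smul (fun n => c (K.enum (s n))), Equiv.prod_comp s (fun n => c (K.enum n)),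
    prod_enum, mul_smul_comm]

theorem minorX_D_mul_X (J K : Sub N m) :
    P.minorX (P.D * P.X) J K = P.q ^ (∑ j ∈ J.1, (j : ℕ)) • P.minorX P.X J K := by
  rw [P.minorX_smul_left (fun a => P.q ^ (a : ℕ)) (fun a b => ?_), Finset.prod_pow_eq_pow_sum]
  rw [D, Matrix.diagonal_mul, Algebra.smul_def]

theorem minorX_X_mul_D' (J K : Sub N m) :
    P.minorX (P.X * P.D') J K = P.q ^ (∑ k ∈ K.1, (N - 1 - (k : ℕ))) • P.minorX P.X J K := by
  rw [P.minorX_smul_right (fun a => P.q ^ (N - 1 - (a : ℕ))) (fun a b => ?_),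
    Finset.prod_pow_eq_pow_sum]
  rw [D', Matrix.mul_diagonal, Algebra.smul_def, Algebra.commutes]

theorem minorY_Y_mul_D (J K : Sub N m) :
    P.minorY (P.Y * P.D) K J = P.q ^ (∑ j ∈ J.1, (j : ℕ)) • star (P.minorX P.X J K) := by
  have h : (P.Y * P.D).conjTranspose = P.D * P.X := by
    rw [Matrix.conjTranspose_mul, conjTranspose_Y, D, Matrix.diagonal_conjTranspose]
    congr 2
    ext k
    simp [star_algebraMap, P.star_q]
  rw [minorY, h, minorX_D_mul_X, star_smul_OqR, star_pow, P.star_q]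

theorem minorY_D'_mul_Y (J K : Sub N m) :
    P.minorY (P.D' * P.Y) J K =
      P.q ^ (∑ j ∈ J.1, (N - 1 - (j : ℕ))) • star (P.minorX P.X K J) := by
  have h : (P.D' * P.Y).conjTranspose = P.X * P.D' := by
    rw [Matrix.conjTranspose_mul, conjTranspose_Y, D', Matrix.diagonal_conjTranspose]
    congr 2
    ext k
    simp [star_algebraMap, P.star_q]
  rw [minorY, h, minorX_X_mul_D', star_smul_OqR, star_pow, P.star_q]

end Minors

/-! ### Entries of the crossing -/

section CrossingEntry

variable {N : ℕ} {F : Type*} [Field F] [StarRing F] (P : QParam N F) {m : ℕ}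
  {M : Type*} [AddCommGroup M] [Module F M] {M' : Type*} [AddCommGroup M'] [Module F M']

theorem braid_map (φ : M →ₗ[F] M') (k : Fin m) (f : Word N (m + 1) → M) :
    P.braid k (fun w => φ (f w)) = fun w => φ (P.braid k f w) := by
  ext w
  simp only [braid_apply, map_add, map_smul]
  split_ifs <;> simp

theorem crossing_map (φ : M →ₗ[F] M') (f : Word N (m + 1) → M) :
    P.crossing M' m (fun w => φ (f w)) = fun w => φ (P.crossing M m f w) := by
  induction m with
  | zero => rfl
  | succ m ih =>
    refine word_ext_cons fun a w => ?_
    rw [crossing_succ, crossing_succ, Module.End.mul_apply, Module.End.mul_apply, braid_map,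
      consOp_apply_cons, consOp_apply_cons, ih]

/-- The crossing of `m + 1` strands is a product of `m` braid generators. -/
theorem exists_crossing_eq_prod (M : Type*) [AddCommGroup M] [Module F M] (m : ℕ) :
    ∃ l : List (Fin m), l.length = m ∧
      P.crossing M m = (l.map fun k => P.braid (M := M) k).prod := by
  induction m with
  | zero => exact ⟨[], rfl, rfl⟩
  | succ m ih =>
    obtain ⟨l, hl, h⟩ := ih
    refine ⟨l.map Fin.succ ++ [0], by simp [hl], ?_⟩
    have h' : ∀ l : List (Fin m), consOp (l.map fun k => P.braid (M := M) k).prod =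
        ((l.map Fin.succ).map fun k => P.braid (M := M) k).prod := by
      intro l
      induction l with
      | nil => simp
      | cons k l ih => simp only [List.map_cons, List.prod_cons, consOp_mul, ih, consOp_braid]
    rw [crossing_succ, h, h', List.map_append, List.prod_append]
    simp

theorem IsAlt.crossing_eq {P : QParam N F} {f : Word N (m + 1) → M} (hf : P.IsAlt f) :
    P.crossing M m f = (-P.q ^ 2) ^ m • f := by
  obtain ⟨l, hl, h⟩ := P.exists_crossing_eq_prod M m
  rw [h, show (-P.q ^ 2) ^ m = (-P.q ^ 2) ^ l.length by rw [hl]]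
  clear h hl
  induction l with
  | nil => simp
  | cons k l ih =>
    rw [List.map_cons, List.prod_cons, Module.End.mul_apply, ih, map_smul, hf k, smul_smul,
      List.length_cons, pow_succ (-P.q ^ 2)]

/-- A functional on tensors is `q`-antisymmetric if composition with every braid generator
multiplies it by `-q ^ 2`. -/
def IsAltFunctional (η : (Word N (m + 1) → F) →ₗ[F] F) : Prop :=
  ∀ (k : Fin m) f, η (P.braid k f) = -P.q ^ 2 * η f

variable {P} in
theorem IsAltFunctional.apply_crossing {η : (Word N (m + 1) → F) →ₗ[F] F}
    (hη : P.IsAltFunctional η) (f : Word N (m + 1) → F) :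
    η (P.crossing F m f) = (-P.q ^ 2) ^ m * η f := by
  obtain ⟨l, hl, h⟩ := P.exists_crossing_eq_prod F m
  rw [h, show (-P.q ^ 2) ^ m = (-P.q ^ 2) ^ l.length by rw [hl]]
  clear h hl
  induction l with
  | nil => simp
  | cons k l ih =>
    rw [List.map_cons, List.prod_cons, Module.End.mul_apply, hη, ih, List.length_cons,
      pow_succ (-P.q ^ 2)]
    ring

/-- The tensor `e_x ⊗ f`. -/
def consTensor (x : Fin N) : (Word N m → M) →ₗ[F] (Word N (m + 1) → M) where
  toFun f w := if w 0 = x then f (Fin.tail w) else 0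
  map_add' f g := by ext w; simp only [Pi.add_apply]; split_ifs <;> simp
  map_smul' r f := by ext w; simp

/-- The tensor `f ⊗ e_a`. -/
def snocTensor (a : Fin N) : (Word N m → M) →ₗ[F] (Word N (m + 1) → M) where
  toFun f w := if w (Fin.last m) = a then f (Fin.init w) else 0
  map_add' f g := by ext w; simp only [Pi.add_apply]; split_ifs <;> simp
  map_smul' r f := by ext w; simp

omit [StarRing F] in
theorem consTensor_cons (x a : Fin N) (f : Word N m → M) (w : Word N m) :
    consTensor (F := F) x f (Fin.cons a w) = if a = x then f w else 0 := by
  simp [consTensor]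

omit [StarRing F] in
theorem snocTensor_snoc (x a : Fin N) (f : Word N m → M) (w : Word N m) :
    snocTensor (F := F) x f (Fin.snoc w a) = if a = x then f w else 0 := by
  simp [snocTensor]

omit [StarRing F] in
theorem consOp_consTensor (A : Module.End F (Word N m → M)) (x : Fin N) (f : Word N m → M) :
    consOp A (consTensor (F := F) x f) = consTensor (F := F) x (A f) := by
  refine word_ext_cons fun a w => ?_
  rw [consOp_apply_cons, consTensor_cons]
  simp only [consTensor_cons]
  split_ifs
  · rfl
  · exact congrFun (map_zero A) w

omit [StarRing F] in
theorem snocOp_snocTensor (A : Module.End F (Word N m → M)) (x : Fin N) (f : Word N m → M) :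
    snocOp A (snocTensor (F := F) x f) = snocTensor (F := F) x (A f) := by
  refine word_ext_snoc fun w a => ?_
  rw [snocOp_apply_snoc, snocTensor_snoc]
  simp only [snocTensor_snoc]
  split_ifs
  · rfl
  · exact congrFun (map_zero A) w

/-- The entries of the crossing with respect to the strand that crosses all the others:
the crossing maps `e_x ⊗ f` to `∑ a, crossingEntry a x f ⊗ e_a`. -/
noncomputable def crossingEntry (a x : Fin N) : Module.End F (Word N m → F) where
  toFun f g := P.crossing F m (consTensor (F := F) x f) (Fin.snoc g a)
  map_add' f g := by ext; simp
  map_smul' r f := by ext; simp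

theorem crossingEntry_apply (a x : Fin N) (f : Word N m → F) (g : Word N m) :
    P.crossingEntry a x f g = P.crossing F m (consTensor (F := F) x f) (Fin.snoc g a) := rfl

theorem braid_crossingEntry (a x : Fin N) (k : Fin m) (f : Word N (m + 1) → F) :
    P.braid k (P.crossingEntry a x f) = P.crossingEntry a x (P.braid k f) := by
  ext g
  have h := LinearMap.congr_fun (P.braid_castSucc_mul_crossing (M := F) k)
    (consTensor (F := F) x f)
  rw [Module.End.mul_apply, Module.End.mul_apply, ← consOp_braid, consOp_consTensor,
    ← snocOp_braid] at h
  have h' := congrFun h (Fin.snoc g a)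
  rw [snocOp_apply_snoc] at h'
  exact h'

/-- The letters above `x` are numbered from the top by `N - 1 - c`, so the sum is geometric. -/
theorem qpow_add_sum_gt (x : Fin N) :
    (P.q ^ 2) ^ (N - 1 - (x : ℕ)) +
      (1 - P.q ^ 2) * ∑ c ∈ Finset.Ioi x, (P.q ^ 2) ^ (N - 1 - (c : ℕ)) = 1 := by
  have h := sum_pow_card_gt (P.q ^ 2) (Finset.Ioi x)
  rw [Fin.card_Ioi] at h
  have h' : ∀ c ∈ Finset.Ioi x, ((Finset.Ioi x).filter fun b => c < b).card = N - 1 - c := by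
    intro c hc
    rw [← Fin.card_Ioi]
    congr 1
    ext b
    simp only [Finset.mem_filter, Finset.mem_Ioi] at hc ⊢
    exact ⟨fun h => h.2, fun h => ⟨hc.trans h, h⟩⟩
  rw [Finset.sum_congr rfl fun c hc => by rw [h' c hc]] at h
  rw [h, mul_neg_geom_sum, add_sub_cancel]

theorem qpow_add_sum_lt (x : Fin N) :
    (P.q ^ 2) ^ (x : ℕ) + (1 - P.q ^ 2) * ∑ c ∈ Finset.Iio x, (P.q ^ 2) ^ (c : ℕ) = 1 := by
  have h := sum_pow_card_lt (P.q ^ 2) (Finset.Iio x)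
  rw [Fin.card_Iio] at h
  have h' : ∀ c ∈ Finset.Iio x, ((Finset.Iio x).filter fun b => b < c).card = c := by
    intro c hc
    rw [← Fin.card_Iio c]
    congr 1
    ext b
    simp only [Finset.mem_filter, Finset.mem_Iio] at hc ⊢
    exact ⟨fun h => h.2, fun h => ⟨h.trans hc, h⟩⟩
  rw [Finset.sum_congr rfl fun c hc => by rw [h' c hc]] at h
  rw [h, mul_neg_geom_sum, add_sub_cancel]

/-- The twisted partial trace of `Rhat` over the first leg is the identity. -/
theorem sum_smul_braid_consTensor (h : Word N (m + 1) → M) (d : Word N (m + 1)) :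
    ∑ c : Fin N, (P.q ^ 2) ^ (N - 1 - (c : ℕ)) •
      P.braid 0 (consTensor (F := F) c h) (Fin.cons c d) = h d := by
  rw [← Fin.cons_self_tail d]
  generalize d 0 = x
  generalize Fin.tail d = d
  simp only [braid_zero_apply, consTensor_cons, if_true, smul_add, Finset.sum_add_distrib]
  rw [Finset.sum_eq_single x (fun c _ hc => by rw [if_neg hc.symm]; simp) (by simp), if_pos rfl,
    P.Q_diag, one_smul]
  simp only [smul_ite, smul_zero]
  rw [← Finset.sum_filter, Finset.filter_lt_eq_Ioi]
  simp only [smul_smul]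
  rw [← Finset.sum_smul, ← add_smul, ← Finset.sum_mul, mul_comm (Finset.sum _ _),
    qpow_add_sum_gt, one_smul]

/-- The twisted partial trace of `Rhat` over the second leg is the identity. -/
theorem sum_smul_braid_snocTensor (h : Word N (m + 1) → M) (d : Word N (m + 1)) :
    ∑ c : Fin N, (P.q ^ 2) ^ (c : ℕ) •
      P.braid (Fin.last m) (snocTensor (F := F) c h) (Fin.snoc d c) = h d := by
  rw [← Fin.snoc_init_self d]
  generalize d (Fin.last m) = x
  generalize Fin.init d = d
  simp only [braid_last_apply, snocTensor_snoc, if_true, smul_add, Finset.sum_add_distrib]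
  rw [Finset.sum_eq_single x (fun c _ hc => by rw [if_neg hc.symm]; simp) (by simp), if_pos rfl,
    P.Q_diag, one_smul]
  simp only [smul_ite, smul_zero]
  rw [← Finset.sum_filter, Finset.filter_gt_eq_Iio]
  simp only [smul_smul]
  rw [← Finset.sum_smul, ← add_smul, ← Finset.sum_mul, mul_comm (Finset.sum _ _),
    qpow_add_sum_lt, one_smul]

omit [StarRing F] in
theorem consTensor_single (x : Fin N) (d : Word N m) :
    consTensor (F := F) x (Pi.single d (1 : F)) = Pi.single (Fin.cons x d) 1 := by
  refine word_ext_cons fun a w => ?_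
  rw [consTensor_cons]
  simp only [Pi.single_apply, Fin.cons_inj]
  by_cases h : a = x <;> simp [h]

omit [StarRing F] in
theorem snocTensor_single (x : Fin N) (d : Word N m) :
    snocTensor (F := F) x (Pi.single d (1 : F)) = Pi.single (Fin.snoc d x) 1 := by
  refine word_ext_snoc fun w a => ?_
  rw [snocTensor_snoc]
  simp only [Pi.single_apply, Fin.snoc_inj]
  by_cases h : a = x <;> simp [h]

/-- Contracting the strand of a crossing with the last letter of a tensor leaves the crossing of one
strand less. -/
theorem sum_smul_crossingEntry_single (x : Fin N) (d : Word N m) :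
    ∑ a : Fin N, (P.q ^ 2) ^ (a : ℕ) • P.crossingEntry a x (Pi.single (Fin.snoc d a) (1 : F)) =
      P.crossing F m (Pi.single (Fin.cons x d) 1) := by
  ext g
  rw [Finset.sum_apply,
    ← P.sum_smul_braid_snocTensor (P.crossing F m (Pi.single (Fin.cons x d) 1)) g]
  refine Finset.sum_congr rfl fun a _ => ?_
  rw [Pi.smul_apply, crossingEntry_apply, consTensor_single, Fin.cons_snoc_eq_snoc_cons,
    ← snocTensor_single, crossing_succ_eq_snoc, Module.End.mul_apply, snocOp_snocTensor]

/-- The relation between `X` and `Y`, contracted so that `X` moves from the left of `Y` to the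
right of `Y`. -/
theorem smul_sum_X_mul_prodY {v : Word N (m + 1) → F} (hv : P.IsAlt v) (a : Fin N)
    (b : Word N m) :
    (-P.q ^ 2) ^ m • ∑ e, P.X a e *
        P.prodY (m + 1) (fun w => algebraMap F P.OqR (v w)) (Fin.snoc b e) =
      ∑ c : Fin N, ∑ x : Fin N, (P.q ^ 2) ^ (N - 1 - (c : ℕ)) •
        (P.prodY (m + 1) (fun w => algebraMap F P.OqR (P.crossingEntry a x v w))
          (Fin.cons c b) * P.X x c) := by
  set y := P.prodY (m + 1) fun w => algebraMap F P.OqR (v w) with hy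
  have hyalt : P.IsAlt y := by
    refine P.isAlt_prodY fun k => ?_
    have h := P.braid_map (Algebra.linearMap F P.OqR) k v
    rw [hv k] at h
    refine h.trans ?_
    ext w
    simp [Algebra.smul_def]
  have hleg : ∀ c, leg (F := F) P.X 0
      (consTensor (F := F) c fun w : Word N (m + 1) => algebraMap F P.OqR (v w)) =
      ∑ x, fun w => algebraMap F P.OqR (consTensor (F := F) x v w) * P.X x c := by
    intro c
    refine word_ext_cons fun x w => ?_
    rw [leg_zero_apply, Finset.sum_apply]
    simp only [consTensor_cons]
    rw [Finset.sum_eq_single c (fun e _ he => by rw [if_neg he, mul_zero]) (by simp),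
      Finset.sum_eq_single x (fun e _ he => by rw [if_neg he.symm, map_zero, zero_mul]) (by simp),
      if_pos rfl, if_pos rfl, Algebra.commutes]
  have hL : ∀ c, (P.crossing P.OqR (m + 1) (leg (F := F) P.X 0
      (consTensor (F := F) c fun w : Word N (m + 1) => algebraMap F P.OqR (v w)))) =
      ∑ x, fun w => algebraMap F P.OqR (P.crossing F (m + 1) (consTensor (F := F) x v) w) *
        P.X x c := by
    intro c
    rw [hleg, map_sum]
    refine Finset.sum_congr rfl fun x _ => ?_
    exact P.crossing_map ((LinearMap.mulRight F (P.X x c)).comp (Algebra.linearMap F P.OqR)) _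
  -- the relation between `X` and `Y`, applied to `e_c ⊗ v` and read off at the word `c b a`
  have hmain : ∀ c, ∑ x, P.prodY (m + 1)
        (fun w => algebraMap F P.OqR (P.crossingEntry a x v w)) (Fin.cons c b) * P.X x c =
      ∑ e, P.X a e * P.crossing P.OqR m
        (fun d => P.braid 0 (consTensor (F := F) c y) (Fin.cons c d)) (Fin.snoc b e) := by
    intro c
    have h := congrFun (LinearMap.congr_fun (P.prodY_mul_crossing_mul_leg_X (m + 1))
      (consTensor (F := F) c fun w => algebraMap F P.OqR (v w))) (Fin.snoc (Fin.cons c b) a)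
    simp only [Module.End.mul_apply] at h
    rw [snocOp_apply_snoc, hL, leg_last_apply, consOp_consTensor] at h
    have h1 : (fun d : Word N (m + 1) => (∑ x, fun w => algebraMap F P.OqR
        (P.crossing F (m + 1) (consTensor (F := F) x v) w) * P.X x c)
        (Fin.snoc d a : Word N (m + 2))) =
        ∑ x, fun d => algebraMap F P.OqR (P.crossingEntry a x v d) * P.X x c := by
      ext d
      simp only [Finset.sum_apply]
      rfl
    rw [h1, map_sum, Finset.sum_apply] at h
    simp only [prodY_mul_right] at h
    rw [h]
    refine Finset.sum_congr rfl fun e _ => ?_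
    rw [← Fin.cons_snoc_eq_snoc_cons, crossing_succ, Module.End.mul_apply, consOp_apply_cons]
  -- the contraction over `c` removes one braid generator from the crossing on the side of `X Y`
  have hcross : ∑ c : Fin N, (P.q ^ 2) ^ (N - 1 - (c : ℕ)) • P.crossing P.OqR m
      (fun d => P.braid 0 (consTensor (F := F) c y) (Fin.cons c d)) = (-P.q ^ 2) ^ m • y := by
    rw [← hyalt.crossing_eq]
    simp only [← map_smul]
    rw [← map_sum]
    congr 1
    ext d
    rw [Finset.sum_apply]
    exact P.sum_smul_braid_consTensor y d
  simp only [← Finset.smul_sum, hmain]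
  simp only [Finset.smul_sum]
  rw [Finset.sum_comm]
  refine Finset.sum_congr rfl fun e _ => ?_
  have h := congrFun hcross (Fin.snoc b e)
  rw [Finset.sum_apply, Pi.smul_apply] at h
  rw [← mul_smul_comm, ← h, Finset.mul_sum]
  simp only [Pi.smul_apply, mul_smul_comm]

end CrossingEntry

/-! ### Moving all letters of `X` across `Y` -/

section Lists

variable {N : ℕ} {F : Type*} [Field F] [StarRing F] (P : QParam N F) {m : ℕ}
  {M : Type*} [AddCommGroup M] [Module F M]

/-- A function of words of length `m`, extended by `0` to all lists of letters. -/
def onList (f : Word N m → M) (l : List (Fin N)) : M := ∑ w, if List.ofFn w = l then f w else 0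

theorem onList_ofFn (f : Word N m → M) (w : Word N m) : onList f (List.ofFn w) = f w := by
  rw [onList, Finset.sum_eq_single w]
  · simp
  · exact fun v _ hv => if_neg fun h => hv (List.ofFn_injective h)
  · simp

theorem onList_eq_zero (f : Word N m → M) {l : List (Fin N)} (hl : l.length ≠ m) :
    onList f l = 0 :=
  Finset.sum_eq_zero fun w _ => if_neg fun h => hl (by rw [← h, List.length_ofFn])

theorem exists_ofFn_eq {l : List (Fin N)} (hl : l.length = m) :
    ∃ w : Word N m, List.ofFn w = l := by
  subst hl
  exact ⟨l.get, List.ofFn_get l⟩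

theorem ofFn_snoc (b : Word N m) (a : Fin N) :
    List.ofFn (Fin.snoc b a : Word N (m + 1)) = List.ofFn b ++ [a] := by
  rw [List.ofFn_succ', List.concat_eq_append]
  simp

theorem ofFn_cons (b : Word N m) (a : Fin N) :
    List.ofFn (Fin.cons a b : Word N (m + 1)) = a :: List.ofFn b := by
  rw [List.ofFn_succ]
  simp

/-- The composite of the entries of the crossings indexed by two words. -/
noncomputable def wordEntry (j : ℕ) (a x : Word N j) : Module.End F (Word N m → F) :=
  (List.ofFn fun n => P.crossingEntry (a n) (x n)).prod

theorem wordEntry_cons {j : ℕ} (a x : Word N j) (a' x' : Fin N) :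
    P.wordEntry (m := m) (j + 1) (Fin.cons a' a) (Fin.cons x' x) =
      P.crossingEntry a' x' * P.wordEntry j a x := by
  simp [wordEntry, List.ofFn_succ]

theorem braid_wordEntry {j : ℕ} (a x : Word N j) (k : Fin m) (f : Word N (m + 1) → F) :
    P.braid k (P.wordEntry j a x f) = P.wordEntry j a x (P.braid k f) := by
  induction j with
  | zero => rfl
  | succ j ih =>
    rw [← Fin.cons_self_tail a, ← Fin.cons_self_tail x, wordEntry_cons, Module.End.mul_apply,
      braid_crossingEntry, ih]
    rfl

theorem smul_sum_X_mul_onList_prodY {v : Word N (m + 1) → F} (hv : P.IsAlt v) (a : Fin N)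
    (b : List (Fin N)) :
    (-P.q ^ 2) ^ m • ∑ e, P.X a e *
        onList (P.prodY (m + 1) fun w => algebraMap F P.OqR (v w)) (b ++ [e]) =
      ∑ c : Fin N, ∑ x : Fin N, (P.q ^ 2) ^ (N - 1 - (c : ℕ)) •
        (onList (P.prodY (m + 1) fun w => algebraMap F P.OqR (P.crossingEntry a x v w))
          (c :: b) * P.X x c) := by
  by_cases hb : b.length = m
  · obtain ⟨b, rfl⟩ := exists_ofFn_eq hb
    simp only [← ofFn_snoc, ← ofFn_cons, onList_ofFn]
    exact P.smul_sum_X_mul_prodY hv a b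
  · have h1 : ∀ e, (b ++ [e]).length ≠ m + 1 := fun _ => by simpa using hb
    have h2 : ∀ c, (c :: b).length ≠ m + 1 := fun _ => by simpa using hb
    simp [onList_eq_zero _ (h1 _), onList_eq_zero _ (h2 _)]

/-- The product of the entries of `X` in the rows `a` and the columns `e`. -/
noncomputable def wordX {j : ℕ} (a e : Word N j) : P.OqR :=
  (List.ofFn fun n => P.X (a n) (e n)).prod

theorem wordX_cons {j : ℕ} (a e : Word N j) (a' e' : Fin N) :
    P.wordX (Fin.cons a' a : Word N (j + 1)) (Fin.cons e' e : Word N (j + 1)) =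
      P.X a' e' * P.wordX a e := by
  simp [wordX, List.ofFn_succ]

theorem isAlt_wordEntry {v : Word N (m + 1) → F} (hv : P.IsAlt v) {j : ℕ} (a x : Word N j) :
    P.IsAlt (P.wordEntry j a x v) :=
  hv.map (P.braid_wordEntry a x)

/-- Several letters of `X` move from the left of `Y` to the right of `Y`, one by one.  The word `b`
consists of the letters that `X` does not reach; it is shifted from the beginning to the end. -/
theorem smul_sum_wordX_mul_onList_prodY {v : Word N (m + 1) → F} (hv : P.IsAlt v) {j : ℕ}
    (a : Word N j) (b : List (Fin N)) :
    ((-P.q ^ 2) ^ m) ^ j • ∑ e : Word N j, P.wordX a e *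
        onList (P.prodY (m + 1) fun w => algebraMap F P.OqR (v w)) (b ++ List.ofFn e) =
      ∑ c : Word N j, ∑ x : Word N j, (∏ n, (P.q ^ 2) ^ (N - 1 - (c n : ℕ))) •
        (onList (P.prodY (m + 1) fun w => algebraMap F P.OqR (P.wordEntry j a x v w))
          (List.ofFn c ++ b) * P.wordX x c) := by
  induction j generalizing b with
  | zero =>
    simp only [Fintype.sum_unique]
    simp [wordEntry, wordX]
  | succ j ih =>
    rw [← Fin.cons_self_tail a]
    generalize a 0 = a'
    generalize Fin.tail a = a
    simp only [sum_word_cons, wordX_cons, ofFn_cons, wordEntry_cons, Module.End.mul_apply,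
      Fin.prod_univ_succ, Fin.cons_zero, Fin.cons_succ]
    have h1 : ∀ e : Fin N, ((-P.q ^ 2) ^ m) ^ j • ∑ es : Word N j, P.X a' e * P.wordX a es *
        onList (P.prodY (m + 1) fun w => algebraMap F P.OqR (v w)) (b ++ e :: List.ofFn es) =
        ∑ cs : Word N j, ∑ xs : Word N j, (∏ n, (P.q ^ 2) ^ (N - 1 - (cs n : ℕ))) •
          (P.X a' e * onList (P.prodY (m + 1) fun w =>
            algebraMap F P.OqR (P.wordEntry j a xs v w)) ((List.ofFn cs ++ b) ++ [e]) *
            P.wordX xs cs) := by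
      intro e
      have h := congrArg (P.X a' e * ·) (ih a (b ++ [e]))
      simp only [mul_smul_comm, Finset.mul_sum, ← mul_assoc, ← List.append_assoc] at h
      rw [← h]
      simp only [List.append_assoc, List.singleton_append]
    rw [pow_succ', mul_smul, Finset.smul_sum, Finset.sum_congr rfl fun e _ => h1 e]
    rw [Finset.sum_comm, Finset.smul_sum]
    have h2 : ∀ cs : Word N j, (-P.q ^ 2) ^ m • ∑ e : Fin N, ∑ xs : Word N j,
        (∏ n, (P.q ^ 2) ^ (N - 1 - (cs n : ℕ))) •
          (P.X a' e * onList (P.prodY (m + 1) fun w =>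
            algebraMap F P.OqR (P.wordEntry j a xs v w)) ((List.ofFn cs ++ b) ++ [e]) *
            P.wordX xs cs) =
        ∑ xs : Word N j, ∑ c : Fin N, ∑ x : Fin N,
          ((P.q ^ 2) ^ (N - 1 - (c : ℕ)) * ∏ n, (P.q ^ 2) ^ (N - 1 - (cs n : ℕ))) •
          (onList (P.prodY (m + 1) fun w => algebraMap F P.OqR
            (P.crossingEntry a' x (P.wordEntry j a xs v) w)) (c :: (List.ofFn cs ++ b)) *
            (P.X x c * P.wordX xs cs)) := by
      intro cs
      rw [Finset.sum_comm, Finset.smul_sum]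
      refine Finset.sum_congr rfl fun xs _ => ?_
      have h := congrArg (fun t => (∏ n, (P.q ^ 2) ^ (N - 1 - (cs n : ℕ))) • (t * P.wordX xs cs))
        (P.smul_sum_X_mul_onList_prodY (P.isAlt_wordEntry hv a xs) a' (List.ofFn cs ++ b))
      simp only [smul_mul_assoc, Finset.sum_mul, Finset.smul_sum, smul_smul] at h
      simp only [Finset.smul_sum, smul_smul]
      simp only [mul_assoc, mul_comm ((-P.q ^ 2) ^ m), mul_comm ((P.q ^ 2) ^ _)] at h ⊢
      exact h
    rw [Finset.sum_congr rfl fun cs _ => h2 cs]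
    conv_rhs => rw [Finset.sum_comm]
    refine Finset.sum_congr rfl fun cs _ => ?_
    rw [Finset.sum_comm]
    refine Finset.sum_congr rfl fun c _ => ?_
    rw [Finset.sum_comm]
    rfl

/-! ### Twisted traces of products of entries of the crossing -/

theorem sum_mul_crossingEntry_single {η : (Word N (m + 1) → F) →ₗ[F] F}
    (hη : P.IsAltFunctional η) (x : Fin N) (d : List (Fin N)) :
    ∑ a : Fin N, (P.q ^ 2) ^ (a : ℕ) * η (P.crossingEntry a x
        fun w => if List.ofFn w = d ++ [a] then 1 else 0) =
      (-P.q ^ 2) ^ m * η fun w => if List.ofFn w = x :: d then 1 else 0 := by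
  by_cases hd : d.length = m
  · obtain ⟨d, rfl⟩ := exists_ofFn_eq hd
    simp only [← ofFn_snoc, ← ofFn_cons, List.ofFn_inj]
    have h (d : Word N (m + 1)) : (fun w => if w = d then (1 : F) else 0) = Pi.single d 1 := by
      ext w; rw [Pi.single_apply]
    simp only [h]
    rw [← hη.apply_crossing, ← sum_smul_crossingEntry_single, map_sum]
    simp only [map_smul, smul_eq_mul]
  · have h (l : List (Fin N)) (hl : l.length ≠ m + 1) :
        (fun w : Word N (m + 1) => if List.ofFn w = l then (1 : F) else 0) = 0 := by
      ext w
      exact if_neg fun h => hl (by rw [← h, List.length_ofFn])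
    have h1 : ∀ e, (d ++ [e]).length ≠ m + 1 := fun e => by simpa using hd
    have h2 : ∀ c, (c :: d).length ≠ m + 1 := fun c => by simpa using hd
    simp only [h _ (h1 _), h _ (h2 _), map_zero, mul_zero, Finset.sum_const_zero]

/-- The twisted trace of a product of entries of crossings, on a basis tensor: each contraction
undoes one crossing. -/
theorem sum_mul_wordEntry_single {η : (Word N (m + 1) → F) →ₗ[F] F}
    (hη : P.IsAltFunctional η) {j : ℕ} (x : Word N j) (b : List (Fin N)) :
    ∑ a : Word N j, (∏ n, (P.q ^ 2) ^ (a n : ℕ)) * η (P.wordEntry j a x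
        fun w => if List.ofFn w = b ++ List.ofFn a then 1 else 0) =
      ((-P.q ^ 2) ^ m) ^ j * η fun w => if List.ofFn w = List.ofFn x ++ b then 1 else 0 := by
  induction j generalizing η b with
  | zero =>
    simp only [Fintype.sum_unique]
    simp [wordEntry]
  | succ j ih =>
    rw [← Fin.cons_self_tail x]
    generalize x 0 = x'
    generalize Fin.tail x = x
    simp only [sum_word_cons, ofFn_cons, wordEntry_cons, Module.End.mul_apply,
      Fin.prod_univ_succ, Fin.cons_zero, Fin.cons_succ]
    have h1 : ∀ a' : Fin N, ∑ a : Word N j, (P.q ^ 2) ^ (a' : ℕ) *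
        (∏ n, (P.q ^ 2) ^ (a n : ℕ)) * η (P.crossingEntry a' x' (P.wordEntry j a x
          fun w => if List.ofFn w = b ++ a' :: List.ofFn a then 1 else 0)) =
        ((-P.q ^ 2) ^ m) ^ j * ((P.q ^ 2) ^ (a' : ℕ) * η (P.crossingEntry a' x'
          fun w => if List.ofFn w = (List.ofFn x ++ b) ++ [a'] then 1 else 0)) := by
      intro a'
      have h := ih (η := η ∘ₗ P.crossingEntry a' x') (fun k f => by
        rw [LinearMap.comp_apply, ← braid_crossingEntry, hη]; rfl) x (b ++ [a'])
      simp only [LinearMap.comp_apply, List.append_assoc, List.singleton_append] at h ⊢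
      rw [mul_left_comm, ← h, Finset.mul_sum]
      simp only [mul_assoc]
    rw [Finset.sum_congr rfl fun a' _ => h1 a', ← Finset.mul_sum,
      P.sum_mul_crossingEntry_single hη, pow_succ ((-P.q ^ 2) ^ m), mul_assoc]
    rfl

end Lists

/-! ### The trace formula with the factors interchanged -/

section Interchange

variable {N : ℕ} {F : Type*} [Field F] [StarRing F] (P : QParam N F) {m : ℕ}

omit [StarRing F] in
theorem functional_eq_sum (η : (Word N m → F) →ₗ[F] F) (f : Word N m → F) :
    η f = ∑ w, f w * η (Pi.single w 1) := by
  have h : f = ∑ w, f w • Pi.single w 1 := by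
    ext v
    simp [Finset.sum_apply, Pi.single_apply]
  conv_lhs => rw [h]
  simp

/-- The tensors attached to subsets and their pairings form dual bases, up to the factor `[m]!`. -/
theorem sum_star_altTensor_mul_functional (h2 : 1 + P.q ^ 2 ≠ 0)
    {η : (Word N (m + 1) → F) →ₗ[F] F} (hη : P.IsAltFunctional η) (a : Word N (m + 1)) :
    ∑ K : Sub N (m + 1), star (P.altTensor (m + 1) K.1 a) * η (P.altTensor (m + 1) K.1) =
      P.qFact (m + 1) * η (Pi.single a 1) := by
  set g : Word N (m + 1) → F := fun w => star (η (Pi.single w 1)) with hg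
  have hg' : ∀ f : Word N (m + 1) → F, η f = ∑ w, star (g w) • f w := by
    intro f
    rw [functional_eq_sum η f]
    simp [hg, mul_comm]
  have hgalt : P.IsAlt g := by
    intro k
    ext w
    have h := hη k (Pi.single w 1)
    rw [hg', hg', sum_star_smul_braid] at h
    simp only [smul_eq_mul, Pi.single_apply, mul_ite, mul_one, mul_zero, Finset.sum_ite_eq',
      Finset.mem_univ, if_true] at h
    have h' := congrArg star h
    simpa [P.star_q] using h'
  have hK : ∀ K : Sub N (m + 1),
      η (P.altTensor (m + 1) K.1) = P.qFact (m + 1) * star (g K.enum) := by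
    intro K
    have h := congrArg star (hgalt.altPair_eq h2 K)
    rw [smul_eq_mul, star_mul', star_qFact, altPair_apply, star_sum] at h
    rw [hg', ← h]
    refine Finset.sum_congr rfl fun w _ => ?_
    simp [mul_comm]
  have ha : η (Pi.single a 1) = ∑ K : Sub N (m + 1),
      star (P.altTensor (m + 1) K.1 a) * star (g K.enum) := by
    have h := congrArg star (hgalt.eq_sum h2 a)
    rw [star_sum] at h
    simpa [hg, mul_comm] using h
  rw [ha, Finset.mul_sum]
  refine Finset.sum_congr rfl fun K _ => ?_
  rw [hK]
  ring

theorem isAltFunctional_altPair (J : Finset (Fin N)) :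
    P.IsAltFunctional (P.altPair (m := m + 1) (M := F) J) :=
  fun k f => P.altPair_braid J k f

/-- The twisted trace of the crossing of two antisymmetric tensors. -/
theorem sum_wordEntry_altTensor (h2 : 1 + P.q ^ 2 ≠ 0) (hm : P.qFact (m + 1) ≠ 0)
    (x : Word N (m + 1)) :
    ∑ K : Sub N (m + 1), ∑ a : Word N (m + 1),
        ((∏ n, (P.q ^ 2) ^ (a n : ℕ)) * star (P.altTensor (m + 1) K.1 a)) •
          P.wordEntry (m + 1) a x (P.altTensor (m + 1) K.1) =
      ((-P.q ^ 2) ^ m) ^ (m + 1) • ∑ K : Sub N (m + 1),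
        star (P.altTensor (m + 1) K.1 x) • P.altTensor (m + 1) K.1 := by
  rw [← sub_eq_zero]
  have halt : P.IsAlt (∑ K : Sub N (m + 1), ∑ a : Word N (m + 1),
        ((∏ n, (P.q ^ 2) ^ (a n : ℕ)) * star (P.altTensor (m + 1) K.1 a)) •
          P.wordEntry (m + 1) a x (P.altTensor (m + 1) K.1) -
      ((-P.q ^ 2) ^ m) ^ (m + 1) • ∑ K : Sub N (m + 1),
        star (P.altTensor (m + 1) K.1 x) • P.altTensor (m + 1) K.1) := by
    refine IsAlt.sub P (P.isAlt_sum _ fun K _ => P.isAlt_sum _ fun a _ => IsAlt.smul P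
      (P.isAlt_wordEntry (P.isAlt_altTensor K.1) a x) _) (IsAlt.smul P (P.isAlt_sum _ fun K _ =>
      IsAlt.smul P (P.isAlt_altTensor K.1) _) _)
  -- an antisymmetric tensor is determined by its pairings with the tensors attached to subsets
  refine halt.eq_zero h2 fun w hw => ?_
  obtain ⟨J, rfl⟩ := exists_enum_eq hw
  refine (smul_eq_zero.mp ((halt.altPair_eq h2 J).symm.trans ?_)).resolve_left hm
  have hη := P.isAltFunctional_altPair (m := m) J.1
  rw [map_sub, map_smul, map_sum, map_sum, Finset.sum_congr rfl fun K _ => map_sum _ _ _,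
    sub_eq_zero, Finset.sum_comm]
  simp only [map_smul, smul_eq_mul]
  rw [P.sum_star_altTensor_mul_functional h2 hη]
  have h : ∀ a : Word N (m + 1), ∑ K : Sub N (m + 1),
      (∏ n, (P.q ^ 2) ^ (a n : ℕ)) * star (P.altTensor (m + 1) K.1 a) *
        P.altPair J.1 (P.wordEntry (m + 1) a x (P.altTensor (m + 1) K.1)) =
      P.qFact (m + 1) * ((∏ n, (P.q ^ 2) ^ (a n : ℕ)) *
        P.altPair J.1 (P.wordEntry (m + 1) a x (Pi.single a 1))) := by
    intro a
    have h := P.sum_star_altTensor_mul_functional h2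
      (η := P.altPair J.1 ∘ₗ P.wordEntry (m + 1) a x) (fun k f => by
        rw [LinearMap.comp_apply, ← braid_wordEntry, hη]; rfl) a
    rw [mul_left_comm, ← LinearMap.comp_apply, ← h, Finset.mul_sum]
    simp only [LinearMap.comp_apply, mul_assoc]
  have hs : ∀ a : Word N (m + 1), (fun w : Word N (m + 1) =>
      if List.ofFn w = List.ofFn a then (1 : F) else 0) = Pi.single a 1 := by
    intro a
    ext w
    simp only [Pi.single_apply, List.ofFn_inj]
  have h3 := P.sum_mul_wordEntry_single hη x []
  simp only [List.nil_append, List.append_nil, hs] at h3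
  rw [Finset.sum_congr rfl fun a _ => h a, ← Finset.mul_sum, h3]
  ring

theorem prod_qpow_of_altTensor_ne_zero {K : Finset (Fin N)} {a : Word N m}
    (ha : P.altTensor m K a ≠ 0) (f : Fin N → ℕ) :
    ∏ n, (P.q ^ 2) ^ f (a n) = (P.q ^ 2) ^ ∑ k ∈ K, f k := by
  rw [altTensor, ite_ne_right_iff] at ha
  obtain ⟨⟨hinj, rfl⟩, -⟩ := ha
  rw [Finset.prod_pow_eq_pow_sum, Finset.sum_image hinj.injOn]

/-- The trace of `X₁ ⋯ X_m Y_m ⋯ Y₁` over the antisymmetric tensors, with the factors `X` and `Y`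
interchanged and the weights reversed. -/
theorem altTrace_prodX_mul_prodY (h2 : 1 + P.q ^ 2 ≠ 0) (hm : P.qFact (m + 1) ≠ 0) :
    P.altTrace (P.prodX (m + 1) * P.prodY (m + 1)) =
      P.qFact (m + 1) • ∑ J : Sub N (m + 1), ∑ K : Sub N (m + 1),
        (P.q ^ 2) ^ (∑ j ∈ J.1, (N - 1 - (j : ℕ))) •
          (star (P.minorX P.X K J) * P.minorX P.X K J) := by
  -- the scalar by which the `m + 1` crossings with `m` strands act on antisymmetric tensors; both
  -- contractions produce it
  set κ : F := ((-P.q ^ 2) ^ m) ^ (m + 1) with hκ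
  have hκ0 : κ ≠ 0 := pow_ne_zero _ (pow_ne_zero _ (neg_ne_zero.mpr (pow_ne_zero _ P.q_ne_zero)))
  set y : Sub N (m + 1) → Word N (m + 1) → P.OqR := fun K =>
    P.prodY (m + 1) fun w => algebraMap F P.OqR (P.altTensor (m + 1) K.1 w) with hy
  -- the operator `Y_m ⋯ Y₁` on scalar tensors, as a linear map
  let Φ : (Word N (m + 1) → F) →ₗ[F] (Word N (m + 1) → P.OqR) :=
    P.prodY (m + 1) ∘ₗ (Algebra.linearMap F P.OqR).compLeft (Word N (m + 1))
  have hmove : ∀ (K : Sub N (m + 1)) (a : Word N (m + 1)), κ • P.prodX (m + 1) (y K) a =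
      ∑ c : Word N (m + 1), ∑ x : Word N (m + 1), (∏ n, (P.q ^ 2) ^ (N - 1 - (c n : ℕ))) •
        (Φ (P.wordEntry (m + 1) a x (P.altTensor (m + 1) K.1)) c * P.wordX x c) := by
    intro K a
    have h := P.smul_sum_wordX_mul_onList_prodY (P.isAlt_altTensor (m := m) K.1) a []
    simp only [List.nil_append, List.append_nil, onList_ofFn] at h
    rw [prodX_apply]
    exact h
  apply smul_right_injective _ hκ0
  change κ • _ = κ • _
  calc κ • P.altTrace (P.prodX (m + 1) * P.prodY (m + 1))
      = ∑ K : Sub N (m + 1), ∑ a : Word N (m + 1),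
          ((∏ n, (P.q ^ 2) ^ (a n : ℕ)) * star (P.altTensor (m + 1) K.1 a)) •
            κ • P.prodX (m + 1) (y K) a := by
        rw [altTrace_eq_sum_sub, Finset.smul_sum]
        refine Finset.sum_congr rfl fun K _ => ?_
        rw [altPair_apply, Finset.smul_sum, Finset.smul_sum]
        refine Finset.sum_congr rfl fun a _ => ?_
        by_cases ha : P.altTensor (m + 1) K.1 a = 0
        · simp [ha]
        · rw [P.prod_qpow_of_altTensor_ne_zero ha fun k => (k : ℕ), smul_smul, smul_smul, smul_smul]
          congr 1
          ring
    _ = ∑ c : Word N (m + 1), ∑ x : Word N (m + 1), (∏ n, (P.q ^ 2) ^ (N - 1 - (c n : ℕ))) •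
          (Φ (∑ K : Sub N (m + 1), ∑ a : Word N (m + 1),
            ((∏ n, (P.q ^ 2) ^ (a n : ℕ)) * star (P.altTensor (m + 1) K.1 a)) •
              P.wordEntry (m + 1) a x (P.altTensor (m + 1) K.1)) c * P.wordX x c) := by
        simp only [hmove, map_sum, map_smul, Finset.sum_apply, Pi.smul_apply, Finset.sum_mul,
          Finset.smul_sum, smul_mul_assoc]
        rw [Finset.sum_congr rfl fun K _ => Finset.sum_comm, Finset.sum_comm]
        refine Finset.sum_congr rfl fun c _ => ?_
        rw [Finset.sum_congr rfl fun K _ => Finset.sum_comm, Finset.sum_comm]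
        refine Finset.sum_congr rfl fun x _ => Finset.sum_congr rfl fun K _ =>
          Finset.sum_congr rfl fun a _ => ?_
        rw [smul_comm]
    _ = κ • ∑ K : Sub N (m + 1), ∑ c : Word N (m + 1), (∏ n, (P.q ^ 2) ^ (N - 1 - (c n : ℕ))) •
          (y K c * ∑ x : Word N (m + 1), star (P.altTensor (m + 1) K.1 x) • P.wordX x c) := by
        simp only [P.sum_wordEntry_altTensor h2 hm, map_sum, map_smul, Finset.sum_apply,
          Pi.smul_apply, Finset.sum_mul, Finset.smul_sum, smul_mul_assoc, Finset.mul_sum,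
          mul_smul_comm]
        rw [Finset.sum_congr rfl fun c _ => Finset.sum_comm, Finset.sum_comm]
        refine Finset.sum_congr rfl fun K _ => Finset.sum_congr rfl fun c _ =>
          Finset.sum_congr rfl fun x _ => ?_
        rw [smul_comm]
        rfl
    _ = _ := by
        congr 1
        conv_rhs => rw [Finset.sum_comm, Finset.smul_sum]
        refine Finset.sum_congr rfl fun K _ => ?_
        have hJ : ∀ J : Sub N (m + 1), ∑ c : Word N (m + 1),
            P.altTensor (m + 1) J.1 c • ∑ x : Word N (m + 1),
              star (P.altTensor (m + 1) K.1 x) • P.wordX x c =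
            P.qFact (m + 1) • P.minorX P.X K J := by
          intro J
          rw [← P.altPair_prodX h2, altPair_apply]
          simp only [prodX_apply, Finset.smul_sum]
          rw [Finset.sum_comm]
          refine Finset.sum_congr rfl fun x _ => Finset.sum_congr rfl fun c _ => ?_
          rw [← Algebra.commutes, ← Algebra.smul_def, smul_comm]
          rfl
        have hc : ∀ c : Word N (m + 1), (∏ n, (P.q ^ 2) ^ (N - 1 - (c n : ℕ))) •
            (y K c * ∑ x : Word N (m + 1), star (P.altTensor (m + 1) K.1 x) • P.wordX x c) =
            ∑ J : Sub N (m + 1), (P.q ^ 2) ^ (∑ j ∈ J.1, (N - 1 - (j : ℕ))) •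
              (star (P.minorX P.X K J) * (P.altTensor (m + 1) J.1 c •
                ∑ x : Word N (m + 1), star (P.altTensor (m + 1) K.1 x) • P.wordX x c)) := by
          intro c
          simp only [hy]
          rw [P.prodY_altTensor h2 hm, Finset.sum_apply, Finset.sum_mul, Finset.smul_sum]
          refine Finset.sum_congr rfl fun J _ => ?_
          by_cases ha : P.altTensor (m + 1) J.1 c = 0
          · simp [ha]
          · rw [P.prod_qpow_of_altTensor_ne_zero ha fun k => N - 1 - (k : ℕ), ← Algebra.smul_def,
              smul_mul_assoc, mul_smul_comm]
        rw [Finset.sum_congr rfl fun c _ => hc c, Finset.sum_comm, Finset.smul_sum]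
        refine Finset.sum_congr rfl fun J _ => ?_
        rw [← Finset.smul_sum, ← Finset.mul_sum, hJ, mul_smul_comm, smul_comm]

end Interchange

/-! ### Laurent monomials -/

section Laurent

variable {N : ℕ} {F : Type*} [Field F] [StarRing F] (P : QParam N F) {m : ℕ}

/-- The number of inversions of a word in which the letter `b` precedes the smaller letter `a`. -/
def invCount (w : Word N m) (a b : Fin N) : ℕ :=
  (Finset.univ.filter fun p : Fin m × Fin m =>
    (p.1 < p.2 ∧ w p.2 < w p.1) ∧ (w p.2, w p.1) = (a, b)).card

theorem negQCol_eq (w : Word N m) :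
    P.negQCol w = (-1) ^ (Finset.univ.filter fun p : Fin m × Fin m =>
      p.1 < p.2 ∧ w p.2 < w p.1).card * ∏ a, ∏ b, P.Q a b ^ invCount w a b := by
  rw [negQCol, ← Fintype.prod_prod_type', ← Finset.prod_filter, Finset.prod_neg]
  congr 1
  rw [← Fintype.prod_prod_type', ← Finset.prod_fiberwise' _
    (fun p : Fin m × Fin m => (w p.2, w p.1)) fun c => P.Q c.1 c.2]
  refine Finset.prod_congr rfl fun c _ => ?_
  rw [Finset.prod_const, Finset.filter_filter]
  rfl

theorem sign_eq_neg_one_pow (s : Equiv.Perm (Fin m)) :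
    Equiv.Perm.sign s = (-1) ^ (Finset.univ.filter fun p : Fin m × Fin m =>
      p.1 < p.2 ∧ s p.2 < s p.1).card := by
  rw [s.sign_eq_prod_prod_Ioi, ← Finset.prod_const, Finset.prod_filter, Fintype.prod_prod_type]
  refine Finset.prod_congr rfl fun i _ => ?_
  rw [← Finset.filter_lt_eq_Ioi, Finset.prod_filter]
  refine Finset.prod_congr rfl fun j _ => ?_
  by_cases hij : i < j
  · rcases lt_or_gt_of_ne (s.injective.ne hij.ne) with h | h
    · simp [hij, h, h.not_gt]
    · simp [hij, h, h.not_gt]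
  · simp [hij]

theorem laurent_mul (d d' : ℤ) (e e' : Fin N → Fin N → ℤ) :
    P.laurent d e * P.laurent d' e' = P.laurent (d + d') fun a b => e a b + e' a b := by
  simp only [laurent, zpow_add₀ P.q_ne_zero, zpow_add₀ (P.Q_ne_zero _ _),
    Finset.prod_mul_distrib]
  ring

theorem star_laurent (d : ℤ) (e : Fin N → Fin N → ℤ) :
    star (P.laurent d e) = P.laurent d fun a b => e b a := by
  simp only [laurent, star_mul', star_prod, star_zpow₀, P.star_q, P.star_Q]
  rw [Finset.prod_comm]

/-- The coefficients of the quantum minors are signed Laurent monomials. -/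
theorem negQCol_enum (K : Sub N m) (s : Equiv.Perm (Fin m)) :
    P.negQCol (fun n => K.enum (s n)) = ((Equiv.Perm.sign s : ℤ) : F) *
      P.laurent 0 fun a b => invCount (fun n => K.enum (s n)) a b := by
  rw [negQCol_eq, sign_eq_neg_one_pow]
  simp only [K.enum_strictMono.lt_iff_lt, laurent, zpow_zero, one_mul, zpow_natCast]
  push_cast
  rfl

theorem minorX_eq_sum (J K : Sub N m) :
    P.minorX P.X J K = ∑ s : Equiv.Perm (Fin m), (((Equiv.Perm.sign s : ℤ) : F) *
      P.laurent 0 fun a b => invCount (fun n => K.enum (s n)) a b) • P.monX J K s := by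
  rw [minorX]
  refine Finset.sum_congr rfl fun s _ => ?_
  rw [negQCol_enum, Algebra.smul_def]
  rfl

theorem star_minorX_eq_sum (J K : Sub N m) :
    star (P.minorX P.X J K) = ∑ t : Equiv.Perm (Fin m), (((Equiv.Perm.sign t : ℤ) : F) *
      P.laurent 0 fun a b => invCount (fun n => K.enum (t n)) b a) • P.monY K J t := by
  rw [minorX_eq_sum, star_sum]
  refine Finset.sum_congr rfl fun t _ => ?_
  rw [star_smul_OqR, star_mul', star_laurent, star_intCast, monX, star_prod_ofFn, monY]
  simp only [star_X]

theorem pow_mul_sign_mul_laurent (n : ℕ) (s t : Equiv.Perm (Fin m)) (e e' : Fin N → Fin N → ℤ) :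
    (P.q ^ 2) ^ n * ((((Equiv.Perm.sign s : ℤ) : F) * P.laurent 0 e) *
      (((Equiv.Perm.sign t : ℤ) : F) * P.laurent 0 e')) =
      (((Equiv.Perm.sign s * Equiv.Perm.sign t : ℤˣ) : ℤ) : F) *
        P.laurent (2 * n : ℕ) fun a b => e a b + e' a b := by
  have h : P.laurent (2 * n : ℕ) (fun a b => e a b + e' a b) =
      (P.q ^ 2) ^ n * (P.laurent 0 e * P.laurent 0 e') := by
    rw [laurent_mul, laurent, laurent, zpow_natCast, pow_mul, add_zero, zpow_zero, one_mul]
  rw [h]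
  push_cast
  ring

theorem pow_smul_minorX_mul_star (n : ℕ) (J K : Sub N m) :
    (P.q ^ 2) ^ n • (P.minorX P.X J K * star (P.minorX P.X J K)) =
      ∑ s : Equiv.Perm (Fin m), ∑ t : Equiv.Perm (Fin m),
        (((Equiv.Perm.sign s * Equiv.Perm.sign t : ℤˣ) : ℤ) : P.OqR) *
          algebraMap F P.OqR (P.laurent (2 * n : ℕ) fun a b =>
            invCount (fun n => K.enum (s n)) a b + invCount (fun n => K.enum (t n)) b a) *
          (P.monX J K s * P.monY K J t) := by
  rw [star_minorX_eq_sum, minorX_eq_sum, Finset.sum_mul_sum, Finset.smul_sum]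
  refine Finset.sum_congr rfl fun s _ => ?_
  rw [Finset.smul_sum]
  refine Finset.sum_congr rfl fun t _ => ?_
  rw [smul_mul_smul_comm, smul_smul, pow_mul_sign_mul_laurent, Algebra.smul_def, map_mul,
    map_intCast]

theorem pow_smul_star_minorX_mul (n : ℕ) (J K : Sub N m) :
    (P.q ^ 2) ^ n • (star (P.minorX P.X K J) * P.minorX P.X K J) =
      ∑ s : Equiv.Perm (Fin m), ∑ t : Equiv.Perm (Fin m),
        (((Equiv.Perm.sign s * Equiv.Perm.sign t : ℤˣ) : ℤ) : P.OqR) *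
          algebraMap F P.OqR (P.laurent (2 * n : ℕ) fun a b =>
            invCount (fun n => J.enum (s n)) a b + invCount (fun n => J.enum (t n)) b a) *
          (P.monY J K t * P.monX K J s) := by
  rw [star_minorX_eq_sum, minorX_eq_sum, Finset.sum_mul_sum, Finset.sum_comm, Finset.smul_sum]
  refine Finset.sum_congr rfl fun s _ => ?_
  rw [Finset.smul_sum]
  refine Finset.sum_congr rfl fun t _ => ?_
  rw [smul_mul_smul_comm, smul_smul, mul_comm (((Equiv.Perm.sign t : ℤ) : F) * _),
    pow_mul_sign_mul_laurent, Algebra.smul_def, map_mul, map_intCast]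

end Laurent

/-! ### The coefficients as sums of products of quantum minors -/

section Sigma

variable {N : ℕ} {F : Type*} [Field F] [StarRing F] (P : QParam N F)

theorem one_add_q_sq_ne_zero (hN : 2 ≤ N) (hq : ∀ n, 1 ≤ n → n ≤ N → P.qNum n ≠ 0) :
    1 + P.q ^ 2 ≠ 0 := by
  have h := hq 2 one_le_two hN
  simpa [qNum, Finset.sum_range_succ] using h

theorem minorX_zero (A : Matrix (Fin N) (Fin N) P.OqR) (J K : Sub N 0) : P.minorX A J K = 1 := by
  simp [minorX, negQCol]

theorem sum_sub_zero {M : Type*} [AddCommMonoid M] (f : Finset (Fin N) → Sub N 0 → M) :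
    ∑ J : Sub N 0, f J.1 J = f ∅ ⟨∅, rfl⟩ :=
  Fintype.sum_eq_single (⟨∅, rfl⟩ : Sub N 0) fun J hJ =>
    absurd (Subtype.ext (Finset.card_eq_zero.mp J.2)) hJ

theorem sigma_eq_sum_minorX_mul_star (hN : 2 ≤ N) (hq : ∀ n, 1 ≤ n → n ≤ N → P.qNum n ≠ 0)
    (i : ℕ) (hi : i ≤ N) :
    P.sigma i hi = ∑ J : Sub N i, ∑ K : Sub N i, (P.q ^ 2) ^ (∑ j ∈ J.1, (j : ℕ)) •
      (P.minorX P.X J K * star (P.minorX P.X J K)) := by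
  have h2 := P.one_add_q_sq_ne_zero hN hq
  cases i with
  | zero =>
    simp only [minorX_zero, star_one, mul_one]
    rw [sum_sub_zero fun J' J => ∑ K : Sub N 0, (P.q ^ 2) ^ (∑ j ∈ J', (j : ℕ)) • (1 : P.OqR),
      sum_sub_zero fun _ _ => (P.q ^ 2) ^ (∑ j ∈ (∅ : Finset (Fin N)), (j : ℕ)) • (1 : P.OqR)]
    simp [sigma]
  | succ n =>
    obtain ⟨m, rfl⟩ : ∃ m, N = m + 1 := ⟨N - 1, by omega⟩
    have hm := P.qFact_ne_zero hq hi
    apply smul_right_injective _ hm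
    change P.qFact (n + 1) • _ = P.qFact (n + 1) • _
    rw [qFact_smul_sigma P hq hi, altTrace_eq_sum_sub, Finset.smul_sum]
    refine Finset.sum_congr rfl fun J _ => ?_
    rw [Module.End.mul_apply, P.altPair_prodX_prodY h2 hm, smul_comm, Finset.smul_sum]

theorem sigma_eq_sum_star_mul_minorX (hN : 2 ≤ N) (hq : ∀ n, 1 ≤ n → n ≤ N → P.qNum n ≠ 0)
    (i : ℕ) (hi : i ≤ N) :
    P.sigma i hi = ∑ J : Sub N i, ∑ K : Sub N i,
      (P.q ^ 2) ^ (∑ j ∈ J.1, (N - 1 - (j : ℕ))) •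
        (star (P.minorX P.X K J) * P.minorX P.X K J) := by
  have h2 := P.one_add_q_sq_ne_zero hN hq
  cases i with
  | zero =>
    simp only [minorX_zero, star_one, mul_one]
    rw [sum_sub_zero fun J' J => ∑ K : Sub N 0,
        (P.q ^ 2) ^ (∑ j ∈ J', (N - 1 - (j : ℕ))) • (1 : P.OqR),
      sum_sub_zero fun _ _ =>
        (P.q ^ 2) ^ (∑ j ∈ (∅ : Finset (Fin N)), (N - 1 - (j : ℕ))) • (1 : P.OqR)]
    simp [sigma]
  | succ n =>
    obtain ⟨m, rfl⟩ : ∃ m, N = m + 1 := ⟨N - 1, by omega⟩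
    have hm := P.qFact_ne_zero hq hi
    apply smul_right_injective _ hm
    change P.qFact (n + 1) • _ = P.qFact (n + 1) • _
    rw [qFact_smul_sigma P hq hi, P.altTrace_prodX_mul_prodY h2 hm]

end Sigma

end QParam

theorem theorem1p1 (N : ℕ) (hN : 2 ≤ N) (i : ℕ) (hi : i ≤ N) :
    ∃ (d d' : QParam.Sub N i → QParam.Sub N i → Equiv.Perm (Fin i) → Equiv.Perm (Fin i) → ℤ)
      (e e' : QParam.Sub N i → QParam.Sub N i → Equiv.Perm (Fin i) → Equiv.Perm (Fin i) →
        Fin N → Fin N → ℤ),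
    ∀ (F : Type*) [Field F] [StarRing F] (P : QParam N F),
      (∀ n, 1 ≤ n → n ≤ N → P.qNum n ≠ 0) →
      P.sigma i hi = ∑ J : QParam.Sub N i, ∑ K : QParam.Sub N i,
        P.minorX (P.D * P.X) J K * P.minorY (P.Y * P.D) K J ∧
      P.sigma i hi = ∑ J : QParam.Sub N i, ∑ K : QParam.Sub N i,
        P.minorY (P.D' * P.Y) J K * P.minorX (P.X * P.D') K J ∧
      P.sigma i hi = ∑ J : QParam.Sub N i, ∑ K : QParam.Sub N i,
        ∑ s : Equiv.Perm (Fin i), ∑ t : Equiv.Perm (Fin i),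
          (((Equiv.Perm.sign s * Equiv.Perm.sign t : ℤˣ) : ℤ) : P.OqR) *
            algebraMap F P.OqR (P.laurent (d J K s t) (e J K s t)) *
            (P.monX J K s * P.monY K J t) ∧
      P.sigma i hi = ∑ J : QParam.Sub N i, ∑ K : QParam.Sub N i,
        ∑ s : Equiv.Perm (Fin i), ∑ t : Equiv.Perm (Fin i),
          (((Equiv.Perm.sign s * Equiv.Perm.sign t : ℤˣ) : ℤ) : P.OqR) *
            algebraMap F P.OqR (P.laurent (d' J K s t) (e' J K s t)) *
            (P.monY J K t * P.monX K J s) := by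
  refine ⟨fun J _ _ _ => (2 * ∑ j ∈ J.1, (j : ℕ) : ℕ),
    fun J _ _ _ => (2 * ∑ j ∈ J.1, (N - 1 - (j : ℕ)) : ℕ),
    fun _ K s t a b => (QParam.invCount (fun n => K.enum (s n)) a b : ℤ) +
      QParam.invCount (fun n => K.enum (t n)) b a,
    fun J _ s t a b => (QParam.invCount (fun n => J.enum (s n)) a b : ℤ) +
      QParam.invCount (fun n => J.enum (t n)) b a, ?_⟩
  intro F _ _ P hq
  have h1 := P.sigma_eq_sum_minorX_mul_star hN hq i hi
  have h2 := P.sigma_eq_sum_star_mul_minorX hN hq i hi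
  refine ⟨?_, ?_, ?_, ?_⟩
  · rw [h1]
    refine Finset.sum_congr rfl fun J _ => Finset.sum_congr rfl fun K _ => ?_
    rw [P.minorX_D_mul_X, P.minorY_Y_mul_D, smul_mul_smul_comm, ← mul_pow, pow_two]
  · rw [h2]
    refine Finset.sum_congr rfl fun J _ => Finset.sum_congr rfl fun K _ => ?_
    rw [P.minorX_X_mul_D', P.minorY_D'_mul_Y, smul_mul_smul_comm, ← mul_pow, pow_two]
  · rw [h1]
    exact Finset.sum_congr rfl fun J _ => Finset.sum_congr rfl fun K _ =>
      P.pow_smul_minorX_mul_star _ J K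
  · rw [h2]
    exact Finset.sum_congr rfl fun J _ => Finset.sum_congr rfl fun K _ =>
      P.pow_smul_star_minorX_mul _ J K
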